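/- **Network.** Let $(\mathcal V,\mathcal E)$ be a delay-free (acyclic) directed network with finitely many unit-capacity links $\mathcal E$ (parallel links allowed), source nodes $\mathcal S_1,\mathcal S_2$ and a receiver $\mathcal R$. Let $C_i$ be the minimum capacity of a cut that separates $\mathcal S_i$ from $\mathcal R$ and $C$ that of a cut that separates $\{\mathcal S_1,\mathcal S_2\}$ from $\mathcal R$, and suppose that exactly $C$ links end at $\mathcal R$. Let $R_1,R_2,z,k\ge 0$ be integers with $n:=R_1+2z\ge 1$, $N:=R_2+2z\ge 1$, $$R_1\le C_1-2z,\qquad R_2\le C_2-2z,\qquad R_1+R_2+2z=C .$$ **Codes.** Let $\mathbb F_p\subseteq\mathbb F_q\subseteq\mathbb F_Q$ be finite fields with $p$ a prime power, $q=p^n$, $Q=q^N$; fix bases of $\mathbb F_q$ over $\mathbb F_p$ and of $\mathbb F_Q$ over $\mathbb F_q$. *Unfolding* a matrix replaces every entry by the row of its coordinates; unfolding from $\mathbb F_Q$ to $\mathbb F_p$ is done through $\mathbb F_q$. Let $G_1\in\mathbb F_q^{n\times R_1}$ be a generator matrix of a Gabidulin code over $\mathbb F_q/\mathbb F_p$,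 that is, the columns of $G_1$ are a basis of the $\mathbb F_q$-span of the vectors $(g_i^{p^j})_{1\le i\le n}$, $0\le j<R_1$, where $g_1,\dots,g_n\in\mathbb F_q$ are linearly independent over $\mathbb F_p$. Let likewise $G_2\in\mathbb F_Q^{N\times R_2}$ be a generator matrix of a Gabidulin code over $\mathbb F_Q/\mathbb F_q$. The messages $X_1\in\mathbb F_q^{R_1\times kN}$ and $X_2\in\mathbb F_Q^{R_2\times k}$ are encoded as the unfoldings $M_1\in\mathbb F_p^{n\times\ell}$ of $G_1X_1$ and $M_2\in\mathbb F_p^{N\times\ell}$ of $G_2X_2$, where $\ell=knN$. **Transmission.** In random linear network coding every link carries an $\mathbb F_p$-linear combination of the packets (vectors in $\mathbb F_p^\ell$) available at the node where it starts, namely those of the links that end there and, at $\mathcal S_i$, the rows of $M_i$; all local coefficients are independent and uniform in $\mathbb F_p$. An adversary who knows everything (network, code, messages, coefficients) adds arbitrary packets of its own on at most $z$ links of its choice. The receiver gets $Y=T_1M_1+T_2M_2+E\in\mathbb F_p^{C\times\ell}$, where $T_1\in\mathbb F_p^{C\times n}$ and $T_2\in\mathbb F_p^{C\times N}$ are the transform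 matrices from the sources to the receiver and $E$ is caused by the adversary. **Theorem.** A receiver that knows $T_1$ and $T_2$ can efficiently decode both messages with probability at least $1-2|\mathcal E|/p$. Precisely: there are absolute constants $c,d$ and one fixed deterministic program, the same for all networks, fields, codes and parameters, with the following properties. Its input consists of $R_1,R_2,z,k$, of the description of the fields and codes in coordinates over $\mathbb F_p$ (multiplication tables and Frobenius images $a\mapsto a^p$, $b\mapsto b^q$ of the two bases, evaluation points and generator matrices of the two codes), and of $T_1,T_2,Y$. It uses $0$, $1$, addition, subtraction, multiplication, inversion and zero tests in $\mathbb F_p$, and loops over index variables. 1. On every input of this form, with $T_1$, $T_2$, $Y$ arbitrary matrices of the stated sizes, it stops after at most $c\,(C+\ell)^d$ steps, where every operation and test in $\mathbb F_p$, every entry of a loop and every iteration of a loop is a step. 2. With probability at least $1-2|\mathcal E|/p$ over the local coefficients, its output is $(X_1,X_2)$ for all messages $X_1,X_2$ and every choice of at most $z$ links and of the packets added there by the adversary. -/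

import Mathlib

open Matrix

/-! ### Networks -/

/-- A network with unit-capacity directed links `E` (parallel links are allowed), two sources and
one receiver.  It is delay-free: no link lies on a directed cycle. -/
structure Network (V E : Type*) where
  tail : E → V
  head : E → V
  source₁ : V
  source₂ : V
  receiver : V
  acyclic : ∀ e, ¬ Relation.TransGen (fun e₁ e₂ => head e₁ = tail e₂) e e

namespace Network

variable {V E : Type*} (𝒢 : Network V E)

/-- The capacity of the cut `U`: the number of links that leave the set of nodes `U`. -/
noncomputable def cutCapacity (U : Set V) : ℕ :=
  Set.ncard {e : E | 𝒢.tail e ∈ U ∧ 𝒢.head e ∉ U}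

/-- The minimum capacity of a cut that separates the set of nodes `S` from the receiver. -/
noncomputable def minCut (S : Set V) : ℕ :=
  sInf {c : ℕ | ∃ U : Set V, S ⊆ U ∧ 𝒢.receiver ∉ U ∧ 𝒢.cutCapacity U = c}

end Network

/-- The local coding coefficients of a linear network code over `F` when the two sources hold
`n₁` and `n₂` packets: `relay e e'` is the coefficient with which link `e` takes the packet of
link `e'`, and `inject₁ e i`, `inject₂ e i` are the coefficients with which link `e` takes the
`i`-th packet of the source.  Only the coefficients that are compatible with the network are used,
see `Network.relayMatrix` and `Network.injectMatrix`. -/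
abbrev CodingCoeffs (F E : Type*) (n₁ n₂ : ℕ) : Type _ :=
  Matrix E E F × Matrix E (Fin n₁) F × Matrix E (Fin n₂) F

namespace CodingCoeffs

variable {F E : Type*} {n₁ n₂ : ℕ}

abbrev relay (κ : CodingCoeffs F E n₁ n₂) : Matrix E E F := κ.1

abbrev inject₁ (κ : CodingCoeffs F E n₁ n₂) : Matrix E (Fin n₁) F := κ.2.1

abbrev inject₂ (κ : CodingCoeffs F E n₁ n₂) : Matrix E (Fin n₂) F := κ.2.2

end CodingCoeffs

namespace Network

section Transmission

variable {V E F : Type*} [DecidableEq V] [Field F] {n n₁ n₂ : ℕ} {ι : Type*} (𝒢 : Network V E)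

/-- Link `e` takes the packet of link `e'` only if `e'` ends at the node where `e` starts. -/
def relayMatrix (A : Matrix E E F) : Matrix E E F :=
  Matrix.of fun e e' => if 𝒢.head e' = 𝒢.tail e then A e e' else 0

/-- Link `e` takes packets of the source at the node `s` only if it starts at `s`. -/
def injectMatrix (s : V) (B : Matrix E (Fin n) F) : Matrix E (Fin n) F :=
  Matrix.of fun e i => if 𝒢.tail e = s then B e i else 0

variable [Fintype E]

/-- `P` is the family of packets on the links when the sources hold the packets (rows of) `M₁`
and `M₂` and the adversary adds the packet `W e` to link `e`: every link carries the linear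
combination, with the local coefficients, of the packets available at the node where it starts,
plus what the adversary adds. -/
def IsTransmission (κ : CodingCoeffs F E n₁ n₂) (M₁ : Matrix (Fin n₁) ι F)
    (M₂ : Matrix (Fin n₂) ι F) (W P : Matrix E ι F) : Prop :=
  P = 𝒢.relayMatrix κ.relay * P + 𝒢.injectMatrix 𝒢.source₁ κ.inject₁ * M₁
    + 𝒢.injectMatrix 𝒢.source₂ κ.inject₂ * M₂ + W

variable [DecidableEq E]

/-- The packets on the links; see `Network.isTransmission_iff`. -/
noncomputable def packets (κ : CodingCoeffs F E n₁ n₂) (M₁ : Matrix (Fin n₁) ι F)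
    (M₂ : Matrix (Fin n₂) ι F) (W : Matrix E ι F) : Matrix E ι F :=
  (1 - 𝒢.relayMatrix κ.relay)⁻¹ * (𝒢.injectMatrix 𝒢.source₁ κ.inject₁ * M₁
    + 𝒢.injectMatrix 𝒢.source₂ κ.inject₂ * M₂ + W)

theorem isUnit_one_sub_relayMatrix (A : Matrix E E F) : IsUnit (1 - 𝒢.relayMatrix A) := by
  rw [← Matrix.mulVec_injective_iff_isUnit]
  change Function.Injective (Matrix.mulVecLin (1 - 𝒢.relayMatrix A))
  rw [injective_iff_map_eq_zero]
  intro v hv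
  have hv' : ∀ e, v e = ∑ e', 𝒢.relayMatrix A e e' * v e' := by
    intro e
    have := congrFun hv e
    simp only [Matrix.mulVecLin_apply, Matrix.sub_mulVec, Matrix.one_mulVec, Pi.sub_apply,
      Pi.zero_apply, sub_eq_zero] at this
    exact this
  let r : E → E → Prop := Relation.TransGen (fun e₁ e₂ => 𝒢.head e₁ = 𝒢.tail e₂)
  have : IsTrans E r := ⟨fun _ _ _ h₁ h₂ => Relation.TransGen.trans h₁ h₂⟩
  have : Std.Irrefl r := ⟨𝒢.acyclic⟩
  have wf : WellFounded r := Finite.wellFounded_of_trans_of_irrefl r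
  funext e
  induction e using wf.induction with
  | _ e ih =>
    rw [hv' e]
    refine Finset.sum_eq_zero fun e' _ => ?_
    by_cases h : 𝒢.head e' = 𝒢.tail e
    · rw [ih e' (Relation.TransGen.single h)]; simp
    · simp [relayMatrix, h]

/-- In a delay-free network the local rules determine the packets on all links, and
`Network.packets` computes them. -/
theorem isTransmission_iff (κ : CodingCoeffs F E n₁ n₂) (M₁ : Matrix (Fin n₁) ι F)
    (M₂ : Matrix (Fin n₂) ι F) (W P : Matrix E ι F) :
    𝒢.IsTransmission κ M₁ M₂ W P ↔ P = 𝒢.packets κ M₁ M₂ W := by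
  have hdet : IsUnit (1 - 𝒢.relayMatrix κ.relay).det :=
    (Matrix.isUnit_iff_isUnit_det _).1 (𝒢.isUnit_one_sub_relayMatrix κ.relay)
  unfold IsTransmission packets
  generalize 𝒢.relayMatrix κ.relay = A at *
  constructor
  · intro h
    have h' : (1 - A) * P = 𝒢.injectMatrix 𝒢.source₁ κ.inject₁ * M₁
        + 𝒢.injectMatrix 𝒢.source₂ κ.inject₂ * M₂ + W := by
      rw [Matrix.sub_mul, Matrix.one_mul, sub_eq_iff_eq_add]
      conv_lhs => rw [h]
      abel
    rw [← h', Matrix.nonsing_inv_mul_cancel_left _ _ hdet]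
  · intro h
    have h' : (1 - A) * P = 𝒢.injectMatrix 𝒢.source₁ κ.inject₁ * M₁
        + 𝒢.injectMatrix 𝒢.source₂ κ.inject₂ * M₂ + W := by
      rw [h, Matrix.mul_nonsing_inv_cancel_left _ _ hdet]
    rw [Matrix.sub_mul, Matrix.one_mul, sub_eq_iff_eq_add] at h'
    conv_lhs => rw [h']
    abel

variable {C : ℕ} (incoming : Fin C ≃ {e : E // 𝒢.head e = 𝒢.receiver})

/-- The matrix whose rows are the packets that reach the receiver, its incoming links being
numbered by `incoming`. -/
noncomputable def received (κ : CodingCoeffs F E n₁ n₂) (M₁ : Matrix (Fin n₁) ι F)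
    (M₂ : Matrix (Fin n₂) ι F) (W : Matrix E ι F) : Matrix (Fin C) ι F :=
  (𝒢.packets κ M₁ M₂ W).submatrix (fun i => (incoming i : E)) id

/-- The transform matrix from the first source to the receiver: what is received, without errors,
if the first source holds the unit vectors and the second source the zero vectors. -/
noncomputable def transfer₁ (κ : CodingCoeffs F E n₁ n₂) : Matrix (Fin C) (Fin n₁) F :=
  𝒢.received incoming κ 1 0 0

/-- The transform matrix from the second source to the receiver. -/
noncomputable def transfer₂ (κ : CodingCoeffs F E n₁ n₂) : Matrix (Fin C) (Fin n₂) F :=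
  𝒢.received incoming κ 0 1 0

end Transmission

end Network

/-! ### Gabidulin codes and unfolding -/

/-- `G` is a generator matrix of the Gabidulin code of dimension `R` with evaluation points `g`,
where `K` is an extension of the finite field `F`: the evaluation points are linearly independent
over `F`, and the columns of `G` are a basis over `K` of the space spanned by the vectors
`(g i ^ |F| ^ j)_i`, for `0 ≤ j < R`. -/
def IsGabidulinGenerator (F : Type*) {K ι : Type*} [Field F] [Field K] [Algebra F K] {R : ℕ}
    (g : ι → K) (G : Matrix ι (Fin R) K) : Prop :=
  LinearIndependent F g ∧ LinearIndependent K Gᵀ ∧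
    Submodule.span K (Set.range Gᵀ) =
      Submodule.span K (Set.range fun (j : Fin R) (i : ι) => g i ^ Nat.card F ^ (j : ℕ))

/-- Unfolding: every entry is replaced by the row of its coordinates. -/
noncomputable def unfoldMatrix {F K m c ι : Type*} [Field F] [Field K] [Algebra F K]
    (a : Module.Basis ι F K) (A : Matrix m c K) : Matrix m (c × ι) F :=
  Matrix.of fun i j => a.repr (A i j.1) j.2

/-- The design of the two codes, for rates `R₁`, `R₂` and `z` corrupted links, over a tower of
fields `F ⊆ K ⊆ L` of degrees `[K : F] = R₁ + 2z` and `[L : K] = R₂ + 2z`. -/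
structure CodePair (F K L : Type*) [Field F] [Field K] [Field L] [Algebra F K] [Algebra K L]
    (R₁ R₂ z : ℕ) where
  a : Module.Basis (Fin (R₁ + 2 * z)) F K
  b : Module.Basis (Fin (R₂ + 2 * z)) K L
  g₁ : Fin (R₁ + 2 * z) → K
  G₁ : Matrix (Fin (R₁ + 2 * z)) (Fin R₁) K
  gabidulin₁ : IsGabidulinGenerator F g₁ G₁
  g₂ : Fin (R₂ + 2 * z) → L
  G₂ : Matrix (Fin (R₂ + 2 * z)) (Fin R₂) L
  gabidulin₂ : IsGabidulinGenerator K g₂ G₂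

/-- The positions of a packet of length `ℓ = k * (R₂ + 2z) * (R₁ + 2z)`. -/
abbrev PacketIdx (R₁ R₂ z k : ℕ) : Type :=
  (Fin k × Fin (R₂ + 2 * z)) × Fin (R₁ + 2 * z)

namespace CodePair

variable {F K L : Type*} [Field F] [Field K] [Field L] [Algebra F K] [Algebra K L]
  {R₁ R₂ z k : ℕ} (𝒞 : CodePair F K L R₁ R₂ z)

/-- The packets that the first source holds after encoding the message `X₁`. -/
noncomputable def encode₁ (X₁ : Matrix (Fin R₁) (Fin k × Fin (R₂ + 2 * z)) K) :
    Matrix (Fin (R₁ + 2 * z)) (PacketIdx R₁ R₂ z k) F :=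
  unfoldMatrix 𝒞.a (𝒞.G₁ * X₁)

/-- The packets that the second source holds after encoding the message `X₂`; the unfolding from
`L` to `F` goes through `K`. -/
noncomputable def encode₂ (X₂ : Matrix (Fin R₂) (Fin k) L) :
    Matrix (Fin (R₂ + 2 * z)) (PacketIdx R₁ R₂ z k) F :=
  unfoldMatrix 𝒞.a (unfoldMatrix 𝒞.b (𝒞.G₂ * X₂))

end CodePair

/-! ### A programming language with a step count

Programs compute in a field.  The memory consists of cells, each of which holds one field element;
the address of a cell is a finite list of natural numbers, the first of which can be thought of as
the name of an array.  Index variables hold natural numbers; they are set by the `loop`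
statement only. -/

/-- Expressions for natural numbers. -/
inductive IndexExpr where
  | const (c : ℕ)
  | var (v : ℕ)
  | add (s t : IndexExpr)
  | sub (s t : IndexExpr)
  | mul (s t : IndexExpr)

/-- The value of an expression when the index variables have the values `ρ`. -/
def IndexExpr.eval (ρ : ℕ → ℕ) : IndexExpr → ℕ
  | const c => c
  | var v => ρ v
  | add s t => s.eval ρ + t.eval ρ
  | sub s t => s.eval ρ - t.eval ρ
  | mul s t => s.eval ρ * t.eval ρ

/-- Expressions for addresses. -/
abbrev AddrExpr : Type := List IndexExpr

/-- The address when the index variables have the values `ρ`. -/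
def AddrExpr.eval (ρ : ℕ → ℕ) (x : AddrExpr) : List ℕ := x.map (IndexExpr.eval ρ)

/-- Programs.  The first argument of an arithmetic statement is the address of the result;
`ifZero x P Q` executes `P` if the cell `x` holds zero and `Q` otherwise; `loop v t P` executes `P`
once for each value `0, 1, …, t - 1` of the index variable `v`. -/
inductive Program where
  | skip
  | zero (dst : AddrExpr)
  | one (dst : AddrExpr)
  | add (dst x y : AddrExpr)
  | sub (dst x y : AddrExpr)
  | mul (dst x y : AddrExpr)
  | inv (dst x : AddrExpr)
  | seq (P Q : Program)
  | ifZero (x : AddrExpr) (P Q : Program)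
  | loop (v : ℕ) (t : IndexExpr) (P : Program)

/-- Memory contents. -/
abbrev Memory (F : Type*) : Type _ := List ℕ → F

open Classical in
/-- The effect of a program on the memory, together with the number of steps: every field operation
and every zero test is a step, and so are the entry of a loop and each of its iterations. -/
noncomputable def Program.run {F : Type*} [Field F] :
    Program → (ℕ → ℕ) → Memory F → Memory F × ℕ
  | skip, _, σ => (σ, 0)
  | zero dst, ρ, σ => (Function.update σ (dst.eval ρ) 0, 1)
  | one dst, ρ, σ => (Function.update σ (dst.eval ρ) 1, 1)
  | add dst x y, ρ, σ =>
      (Function.update σ (dst.eval ρ) (σ (x.eval ρ) + σ (y.eval ρ)), 1)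
  | sub dst x y, ρ, σ =>
      (Function.update σ (dst.eval ρ) (σ (x.eval ρ) - σ (y.eval ρ)), 1)
  | mul dst x y, ρ, σ =>
      (Function.update σ (dst.eval ρ) (σ (x.eval ρ) * σ (y.eval ρ)), 1)
  | inv dst x, ρ, σ => (Function.update σ (dst.eval ρ) (σ (x.eval ρ))⁻¹, 1)
  | seq P Q, ρ, σ =>
      ((Q.run ρ (P.run ρ σ).1).1, (P.run ρ σ).2 + (Q.run ρ (P.run ρ σ).1).2)
  | ifZero x P Q, ρ, σ =>
      if σ (x.eval ρ) = 0 then ((P.run ρ σ).1, (P.run ρ σ).2 + 1)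
      else ((Q.run ρ σ).1, (Q.run ρ σ).2 + 1)
  | loop v t P, ρ, σ =>
      (List.range (t.eval ρ)).foldl
        (fun s i => ((P.run (Function.update ρ v i) s.1).1,
          s.2 + (P.run (Function.update ρ v i) s.1).2 + 1)) (σ, 1)

/-! ### The input and the output of a decoder -/

/-- Extension of a finite array by zero. -/
def padZero {α : Type*} [Zero α] {n : ℕ} (f : Fin n → α) (i : ℕ) : α :=
  if h : i < n then f ⟨i, h⟩ else 0

namespace CodePair

variable {F K L : Type*} [Field F] [Field K] [Field L] [Algebra F K] [Algebra K L]
  {R₁ R₂ z k C : ℕ} (𝒞 : CodePair F K L R₁ R₂ z)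

/-- The coordinates over `F` of an element of `K`. -/
noncomputable def coordK (x : K) : ℕ → F :=
  padZero fun l => 𝒞.a.repr x l

/-- The coordinates over `F` of an element of `L`. -/
noncomputable def coordL (x : L) : ℕ → ℕ → F :=
  padZero fun s => 𝒞.coordK (𝒞.b.repr x s)

/-- The initial values of the index variables: `R₁, R₂, z, k`. -/
def params (R₁ R₂ z k : ℕ) : ℕ → ℕ
  | 0 => R₁
  | 1 => R₂
  | 2 => z
  | 3 => k
  | _ => 0

/-- The initial memory of a coherent receiver.  It holds, in coordinates over `F`, the
multiplication tables of the bases of `K` over `F` and of `L` over `K`, the Frobenius images of the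
basis elements, the evaluation points and generator matrices of the two codes, and then the transform
matrices `T₁`, `T₂` and the received matrix `Y`. -/
noncomputable def input (T₁ : Matrix (Fin C) (Fin (R₁ + 2 * z)) F)
    (T₂ : Matrix (Fin C) (Fin (R₂ + 2 * z)) F) (Y : Matrix (Fin C) (PacketIdx R₁ R₂ z k) F) :
    Memory F
  | [0, i, j, l] => padZero (fun i' => padZero (fun j' => 𝒞.coordK (𝒞.a i' * 𝒞.a j')) j) i l
  | [1, i, j, s, l] => padZero (fun i' => padZero (fun j' => 𝒞.coordL (𝒞.b i' * 𝒞.b j')) j) i s l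
  | [2, i, l] => padZero (fun i' => 𝒞.coordK (𝒞.a i' ^ Nat.card F)) i l
  | [3, i, s, l] => padZero (fun i' => 𝒞.coordL (𝒞.b i' ^ Nat.card K)) i s l
  | [4, i, l] => padZero (fun i' => 𝒞.coordK (𝒞.g₁ i')) i l
  | [5, i, s, l] => padZero (fun i' => 𝒞.coordL (𝒞.g₂ i')) i s l
  | [6, i, j, l] => padZero (fun i' => padZero (fun j' => 𝒞.coordK (𝒞.G₁ i' j')) j) i l
  | [7, i, j, s, l] => padZero (fun i' => padZero (fun j' => 𝒞.coordL (𝒞.G₂ i' j')) j) i s l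
  | [8, i, j] => padZero (fun i' => padZero (fun j' => T₁ i' j') j) i
  | [9, i, j] => padZero (fun i' => padZero (fun j' => T₂ i' j') j) i
  | [10, i, j, s, l] => padZero (fun i' => padZero (fun j' => padZero (fun s' =>
      padZero (fun l' => Y i' ((j', s'), l')) l) s) j) i
  | _ => 0

/-- The memory holds the coordinates of the messages `X₁`, `X₂` in the output cells. -/
def IsOutput (X₁ : Matrix (Fin R₁) (Fin k × Fin (R₂ + 2 * z)) K) (X₂ : Matrix (Fin R₂) (Fin k) L)
    (σ : Memory F) : Prop :=
  (∀ (i : Fin R₁) (j : Fin k) (s : Fin (R₂ + 2 * z)) (l : Fin (R₁ + 2 * z)),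
    σ [11, (i : ℕ), (j : ℕ), (s : ℕ), (l : ℕ)] = 𝒞.a.repr (X₁ i (j, s)) l) ∧
  (∀ (i : Fin R₂) (j : Fin k) (s : Fin (R₂ + 2 * z)) (l : Fin (R₁ + 2 * z)),
    σ [12, (i : ℕ), (j : ℕ), (s : ℕ), (l : ℕ)] = 𝒞.a.repr (𝒞.b.repr (X₂ i j) s) l)

end CodePair

/-- The probability that a uniformly random element of a finite type has the property `P`. -/
noncomputable def uniformProb {α : Type*} (P : α → Prop) : ℝ :=
  (Nat.card {x // P x} : ℝ) / Nat.card α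

/-! ### The running time of programs -/

/-! The second code lives over L/K, and the generator matrix G₁ of the first code has entries in K.
From the viewpoint of the second code, everything the first source does is therefore multiplication
by a matrix of scalars. Folding a block of the received packets into elements of L gives y = T₂G₂x₂
+ (T₁G₁)w + ε, where w ∈ L^R₁ is unknown and the entries of ε lie in a K-space of dimension at most
z, spanned by the folded packets of the adversary. The matrix [T₁G₁ | T₂] over K is square, since R₁
+ (R₂ + 2z) = C. If it is injective, the interference can be cancelled by K-linear row operations,
which leave a Gabidulin word of length R₂ + 2z with an error of rank at most z. Once x₂ is known and
its contribution subtracted, the K-coordinates of the remainder are words T₁G₁x₁ + ε' over K/F,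
without interference and with an error of F-rank at most z; injectivity of T₁ is then enough.

Both kinds of word satisfy `ReceivedWord` and are decoded in the manner of Welch and Berlekamp. Let
f be the linearized polynomial of the message (R coefficients), h = Tg the code points seen by the
receiver, κ the interference matrix and β ≠ 0 fixed. One looks for V with z + 1 coefficients, N with
R + z coefficients and constants c_j, not all zero, such that V(y_i) + N(h_i) + ∑ c_j κ_ij β = 0 for
all i. A solution exists: let V annihilate the error space, put N = -V∘f, and let the c_j absorb the
interference (`ReceivedWord.exists_relation`). Conversely, take any solution. The combinations of
rows that kill both interference and error give combinations of the h_i filling a space of dimension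
at least (R + 2z) - z, and there V∘f + N vanishes; having only R + z coefficients, it vanishes
identically (`ReceivedWord.skewPoly_eq`). This forces V ≠ 0 (`ReceivedWord.coeff_ne_zero`), and then
V(∑ x'_j H_ij) + τ N(h_i) = 0 has only the solutions x' = τx (`ReceivedWord.message_unique`). In
coordinates over F both problems are homogeneous linear systems.

The program solves such systems by keeping a spanning family of the solution space and imposing one
equation at a time (`IsKernel.step`). Loop bounds in the language are polynomials in the index
variables, so polynomial running time is automatic (`Program.exists_time_le`) and only correctness
needs work. Correctness is organised around `Program.fill`, which sets an array to the values of a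
term.

For the probability, all packet equations are collected in one square matrix with |E| + C rows
(`Network.flowMatrix`). Its injectivity means that the receiver can tell the chosen source symbols
apart. Only the |E| link rows contain coding coefficients, and they do so linearly, so the
determinant has degree at most |E|. It is not the zero polynomial because Hall's theorem, whose
condition follows from the cut bounds, provides a routing (`Network.exists_routing`) and hence a
choice of coefficients with injective matrix. Schwartz–Zippel bounds the failure probability by
|E|/p (`Network.card_not_injective_le`). This is applied to [T₁G₁ | T₂] and to [T₁ | T₂G₂], whence
the factor 2. -/

theorem add_le_pow_add_two {B a b x y : ℕ} (hx : x ≤ (B + 2) ^ a) (hy : y ≤ (B + 2) ^ b) :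
    x + y ≤ (B + 2) ^ (a + b + 1) := by
  have h1 : 1 ≤ (B + 2) ^ a := Nat.one_le_pow _ _ (by omega)
  have h2 : 1 ≤ (B + 2) ^ b := Nat.one_le_pow _ _ (by omega)
  rw [pow_succ, pow_add]
  generalize (B + 2) ^ a = u at *
  generalize (B + 2) ^ b = w at *
  have h3 : u ≤ u * w := Nat.le_mul_of_pos_right _ h2
  have h4 : w ≤ u * w := Nat.le_mul_of_pos_left _ h1
  nlinarith

/-- Bounds of the form (B + 2)^a are closed under sums and products up to a change of a, and the
base is at least 2, so that constants fit too. -/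
theorem IndexExpr.exists_eval_le (t : IndexExpr) :
    ∃ a : ℕ, ∀ (ρ : ℕ → ℕ) (B : ℕ), (∀ v, ρ v ≤ B) → t.eval ρ ≤ (B + 2) ^ a := by
  induction t with
  | const c =>
    refine ⟨c, fun ρ B _ => ?_⟩
    calc c ≤ 2 ^ c := Nat.lt_two_pow_self.le
      _ ≤ (B + 2) ^ c := Nat.pow_le_pow_left (by omega) _
  | var v => exact ⟨1, fun ρ B h => by simpa [eval] using (h v).trans (by omega)⟩
  | add s t hs ht =>
    obtain ⟨a, ha⟩ := hs
    obtain ⟨b, hb⟩ := ht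
    exact ⟨a + b + 1, fun ρ B h => add_le_pow_add_two (ha ρ B h) (hb ρ B h)⟩
  | sub s t hs ht =>
    obtain ⟨a, ha⟩ := hs
    exact ⟨a, fun ρ B h => (Nat.sub_le _ _).trans (ha ρ B h)⟩
  | mul s t hs ht =>
    obtain ⟨a, ha⟩ := hs
    obtain ⟨b, hb⟩ := ht
    refine ⟨a + b, fun ρ B h => ?_⟩
    rw [pow_add]
    exact Nat.mul_le_mul (ha ρ B h) (hb ρ B h)

namespace Program

theorem run_loop_time_le {F : Type*} [Field F] (v : ℕ) (t : IndexExpr) (P : Program) (ρ : ℕ → ℕ)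
    (σ : Memory F) (T : ℕ)
    (hT : ∀ i < t.eval ρ, ∀ σ : Memory F, (P.run (Function.update ρ v i) σ).2 ≤ T) :
    ((loop v t P).run ρ σ).2 ≤ 1 + t.eval ρ * (T + 1) := by
  simp only [run]
  generalize t.eval ρ = n at *
  induction n with
  | zero => simp
  | succ n ih =>
    rw [List.range_succ, List.foldl_append]
    simp only [List.foldl_cons, List.foldl_nil]
    have h1 := ih fun i hi => hT i (by omega)
    have h2 := hT n (by omega)
    refine (Nat.add_le_add_right (Nat.add_le_add h1 (h2 _)) 1).trans ?_
    ring_nf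
    omega

/-- The exponent depends on the program alone, so that it is uniform in the field, the memory and
the parameters. Branches on field elements are harmless because both are bounded. -/
theorem exists_time_le_aux.{u} (P : Program) :
    ∃ a : ℕ, ∀ (F : Type u) [Field F] (ρ : ℕ → ℕ) (σ : Memory F) (B : ℕ), (∀ v, ρ v ≤ B) →
      (P.run ρ σ).2 ≤ (B + 2) ^ a := by
  induction P with
  | skip => exact ⟨0, fun F _ ρ σ B _ => by simp [run]⟩
  | zero | one | add | sub | mul | inv => exact ⟨0, fun F _ ρ σ B _ => by simp [run]⟩
  | seq P Q hP hQ =>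
    obtain ⟨a, ha⟩ := hP
    obtain ⟨b, hb⟩ := hQ
    exact ⟨a + b + 1, fun F _ ρ σ B h => add_le_pow_add_two (ha F ρ σ B h) (hb F ρ _ B h)⟩
  | ifZero x P Q hP hQ =>
    obtain ⟨a, ha⟩ := hP
    obtain ⟨b, hb⟩ := hQ
    refine ⟨a + b + 0 + 1, fun F _ ρ σ B h => ?_⟩
    have h1 := ha F ρ σ B h
    have h2 := hb F ρ σ B h
    have p1 : 1 ≤ (B + 2) ^ a := Nat.one_le_pow _ _ (by omega)
    have p2 : 1 ≤ (B + 2) ^ b := Nat.one_le_pow _ _ (by omega)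
    have := add_le_pow_add_two (B := B) (a := a) (b := b) le_rfl le_rfl
    simp only [run]
    split_ifs
    · simp only [add_zero]; omega
    · simp only [add_zero]; omega
  | loop v t P hP =>
    obtain ⟨a, ha⟩ := t.exists_eval_le
    obtain ⟨b, hb⟩ := hP
    refine ⟨0 + (a + ((a + 2) * b + 0 + 1)) + 1, fun F _ ρ σ B h => ?_⟩
    have hn := ha ρ B h
    refine (run_loop_time_le v t P ρ σ ((B + 2) ^ ((a + 2) * b)) fun i hi σ => ?_).trans ?_
    -- Inside the loop the counter may reach (B + 2)^a, so the body is bounded with B + (B + 2)^a in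
    -- place of B; adding 2 to this stays below (B + 2)^(a + 2).
    · have h1 := hb F (Function.update ρ v i) σ (B + (B + 2) ^ a) fun w => by
        by_cases hw : w = v
        · subst hw; simp; omega
        · simpa [hw] using (h w).trans (by omega)
      refine h1.trans ?_
      rw [pow_mul]
      refine Nat.pow_le_pow_left ?_ _
      have p1 : 1 ≤ (B + 2) ^ a := Nat.one_le_pow _ _ (by omega)
      rw [pow_add]
      generalize (B + 2) ^ a = u at *
      have p2 : B + u + 2 ≤ u * (B + 3) := by nlinarith
      exact p2.trans (Nat.mul_le_mul_left _ (by nlinarith))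
    · refine add_le_pow_add_two (a := 0) (by simp) ?_
      rw [pow_add]
      exact Nat.mul_le_mul hn (add_le_pow_add_two (b := 0) le_rfl (by simp))

/-- Every program runs in polynomial time, since the numbers of iterations of its loops are
polynomials in the index variables. -/
theorem exists_time_le.{u} (P : Program) :
    ∃ c d : ℕ, ∀ (F : Type u) [Field F] (ρ : ℕ → ℕ) (σ : Memory F) (B : ℕ), 1 ≤ B →
      (∀ v, ρ v ≤ B) → (P.run ρ σ).2 ≤ c * B ^ d := by
  obtain ⟨a, ha⟩ := P.exists_time_le_aux
  refine ⟨3 ^ a, a, fun F _ ρ σ B hB h => (ha F ρ σ B h).trans ?_⟩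
  rw [← mul_pow]
  exact Nat.pow_le_pow_left (by omega) _

/-! ### The effect of programs -/

/-- The memory after the execution of a program. -/
noncomputable def sem {F : Type*} [Field F] (P : Program) (ρ : ℕ → ℕ) (σ : Memory F) : Memory F :=
  (P.run ρ σ).1

section sem

variable {F : Type*} [Field F] (ρ : ℕ → ℕ) (σ : Memory F)

theorem sem_seq (P Q : Program) : (seq P Q).sem ρ σ = Q.sem ρ (P.sem ρ σ) := rfl

open Classical in
theorem sem_ifZero (x : AddrExpr) (P Q : Program) :
    (ifZero x P Q).sem ρ σ = if σ (x.eval ρ) = 0 then P.sem ρ σ else Q.sem ρ σ := by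
  simp only [sem, run]
  split_ifs <;> rfl

/-- The memory after the first `n` iterations of a loop. -/
noncomputable def iterate (v : ℕ) (P : Program) (ρ : ℕ → ℕ) (σ : Memory F) : ℕ → Memory F
  | 0 => σ
  | n + 1 => P.sem (Function.update ρ v n) (iterate v P ρ σ n)

theorem sem_loop (v : ℕ) (t : IndexExpr) (P : Program) :
    (loop v t P).sem ρ σ = iterate v P ρ σ (t.eval ρ) := by
  simp only [sem, run]
  generalize t.eval ρ = n
  induction n with
  | zero => simp [iterate]
  | succ n ih =>
    rw [List.range_succ, List.foldl_append, iterate, ← ih]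
    rfl

/-- The loop rule. -/
theorem sem_loop_induction (v : ℕ) (t : IndexExpr) (P : Program) (I : ℕ → Memory F → Prop)
    (h0 : I 0 σ)
    (hs : ∀ i < t.eval ρ, ∀ σ, I i σ → I (i + 1) (P.sem (Function.update ρ v i) σ)) :
    I (t.eval ρ) ((loop v t P).sem ρ σ) := by
  rw [sem_loop]
  generalize t.eval ρ = n at *
  induction n with
  | zero => exact h0
  | succ n ih => exact hs n (by omega) _ (ih fun i hi => hs i (by omega))

end sem

/-- The address does not lie in array `n`. -/
def _root_.AddrExpr.Avoids (n : ℕ) : AddrExpr → Prop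
  | IndexExpr.const c :: _ => c ≠ n
  | _ => False

/-- The program does not write to array `n`. -/
def NoWrite (n : ℕ) : Program → Prop
  | skip => True
  | zero dst => AddrExpr.Avoids n dst
  | one dst => AddrExpr.Avoids n dst
  | add dst _ _ => AddrExpr.Avoids n dst
  | sub dst _ _ => AddrExpr.Avoids n dst
  | mul dst _ _ => AddrExpr.Avoids n dst
  | inv dst _ => AddrExpr.Avoids n dst
  | seq P Q => P.NoWrite n ∧ Q.NoWrite n
  | ifZero _ P Q => P.NoWrite n ∧ Q.NoWrite n
  | loop _ _ P => P.NoWrite n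

theorem _root_.AddrExpr.Avoids.ne {n : ℕ} {x : AddrExpr} (h : x.Avoids n) (ρ : ℕ → ℕ)
    (a : List ℕ) : n :: a ≠ x.eval ρ := by
  match x, h with
  | IndexExpr.const c :: _, h =>
    intro h'
    simp only [AddrExpr.eval, List.map_cons, IndexExpr.eval, List.cons.injEq] at h'
    exact h h'.1.symm

theorem sem_of_noWrite {F : Type*} [Field F] {n : ℕ} {P : Program} (h : P.NoWrite n)
    (ρ : ℕ → ℕ) (σ : Memory F) (a : List ℕ) : P.sem ρ σ (n :: a) = σ (n :: a) := by
  induction P generalizing ρ σ with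
  | skip => rfl
  | zero | one | add | sub | mul | inv =>
    exact Function.update_of_ne (AddrExpr.Avoids.ne h ρ a) _ _
  | seq P Q hP hQ => rw [sem_seq, hQ h.2, hP h.1]
  | ifZero x P Q hP hQ =>
    rw [sem_ifZero]
    split_ifs
    exacts [hP h.1 _ _, hQ h.2 _ _]
  | loop v t P hP =>
    exact sem_loop_induction ρ σ v t P (fun _ σ' => σ' (n :: a) = σ (n :: a)) rfl
      fun i _ σ' h' => (hP h _ _).trans h'

end Program

/-! ### Terms and comprehensions -/

/-- The value of `a` at the last index below the bound at which `c` is nonzero, or zero. -/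
noncomputable def lastValue {F : Type*} [Zero F] (c a : ℕ → F) : ℕ → F
  | 0 => 0
  | n + 1 => open Classical in if c n = 0 then lastValue c a n else a n

/-- The index is chosen before `a`. Addresses cannot depend on field elements, so a pivot cannot be
stored as an index; it is searched anew for every entry that is read, and this order of quantifiers
guarantees that all searches hit the same pivot. -/
theorem lastValue_spec {F : Type*} [Zero F] (c : ℕ → F) (n : ℕ) :
    ((∀ i < n, c i = 0) ∧ ∀ a, lastValue c a n = 0) ∨
      ∃ i < n, c i ≠ 0 ∧ ∀ a, lastValue c a n = a i := by
  induction n with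
  | zero => left; simp [lastValue]
  | succ n ih =>
    by_cases hc : c n = 0
    · rcases ih with ⟨h1, h2⟩ | ⟨i, hi, h1, h2⟩
      · left
        refine ⟨fun i hi => ?_, fun a => by simp [lastValue, hc, h2]⟩
        rcases Nat.lt_succ_iff_lt_or_eq.1 hi with h | h
        exacts [h1 i h, h ▸ hc]
      · exact Or.inr ⟨i, by omega, h1, fun a => by simp [lastValue, hc, h2]⟩
    · exact Or.inr ⟨n, by omega, hc, fun a => by simp [lastValue, hc]⟩

/-- Terms that compute a field element from the memory. The last constructor takes the value of `a`
at the last index `v < t` at which `c` does not vanish. -/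
inductive Term where
  | cell (n : ℕ) (idx : List IndexExpr)
  | zero
  | one
  | sub (a b : Term)
  | mul (a b : Term)
  | inv (a : Term)
  | sum (v : ℕ) (t : IndexExpr) (a : Term)
  | last (v : ℕ) (t : IndexExpr) (c a : Term)

namespace Term

variable {F : Type*} [Field F]

noncomputable def eval (ρ : ℕ → ℕ) (σ : Memory F) : Term → F
  | cell n idx => σ (n :: idx.map (IndexExpr.eval ρ))
  | zero => 0
  | one => 1
  | sub a b => a.eval ρ σ - b.eval ρ σ
  | mul a b => a.eval ρ σ * b.eval ρ σ
  | inv a => (a.eval ρ σ)⁻¹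
  | sum v t a => ∑ i ∈ Finset.range (t.eval ρ), a.eval (Function.update ρ v i) σ
  | last v t c a => lastValue (fun i => c.eval (Function.update ρ v i) σ)
      (fun i => a.eval (Function.update ρ v i) σ) (t.eval ρ)

/-- The term reads array `n`. -/
def Reads (n : ℕ) : Term → Prop
  | cell n' _ => n' = n
  | zero => False
  | one => False
  | sub a b => a.Reads n ∨ b.Reads n
  | mul a b => a.Reads n ∨ b.Reads n
  | inv a => a.Reads n
  | sum _ _ a => a.Reads n
  | last _ _ c a => c.Reads n ∨ a.Reads n

theorem eval_congr {t : Term} {σ σ' : Memory F}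
    (h : ∀ n, t.Reads n → ∀ a, σ (n :: a) = σ' (n :: a)) (ρ : ℕ → ℕ) :
    t.eval ρ σ = t.eval ρ σ' := by
  induction t generalizing ρ with
  | cell n idx => exact h n rfl _
  | zero => rfl
  | one => rfl
  | sub a b ha hb | mul a b ha hb =>
    simp only [eval]
    rw [ha fun n hn => h n (Or.inl hn), hb fun n hn => h n (Or.inr hn)]
  | inv a ha => simp only [eval]; rw [ha h]
  | sum v t a ha => exact Finset.sum_congr rfl fun i _ => ha h _
  | last v t c a hc ha =>
    simp only [eval]
    congr 1 <;> funext i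
    exacts [hc (fun n hn => h n (Or.inl hn)) _, ha (fun n hn => h n (Or.inr hn)) _]

/-- The array of auxiliary results. -/
abbrev scratch : ℕ := 13

/-- The address of an auxiliary result. -/
abbrev slot (k : ℕ) : AddrExpr := [IndexExpr.const scratch, IndexExpr.const k]

open Program in
/-- A program that writes the value of a term to an auxiliary cell. -/
def compile : Term → ℕ → Program
  | cell n idx, k => seq (Program.zero (slot k)) (add (slot k) (slot k) (IndexExpr.const n :: idx))
  | zero, k => Program.zero (slot k)
  | one, k => Program.one (slot k)
  | sub a b, k => seq (a.compile k) (seq (b.compile (k + 1))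
      (Program.sub (slot k) (slot k) (slot (k + 1))))
  | mul a b, k => seq (a.compile k) (seq (b.compile (k + 1))
      (Program.mul (slot k) (slot k) (slot (k + 1))))
  | inv a, k => seq (a.compile k) (Program.inv (slot k) (slot k))
  | sum v t a, k => seq (Program.zero (slot k)) (loop v t (seq (a.compile (k + 1))
      (add (slot k) (slot k) (slot (k + 1)))))
  | last v t c a, k => seq (Program.zero (slot k)) (loop v t (seq (c.compile (k + 1))
      (ifZero (slot (k + 1)) skip (seq (a.compile (k + 1))
        (seq (Program.zero (slot k)) (add (slot k) (slot k) (slot (k + 1))))))))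

theorem noWrite_compile {n : ℕ} (hn : scratch ≠ n) (t : Term) (k : ℕ) :
    (t.compile k).NoWrite n := by
  induction t generalizing k <;> simp_all [compile, Program.NoWrite, AddrExpr.Avoids]

open Program in
-- The auxiliary cells form a stack: evaluation at level k leaves the levels below k intact, so
-- partial results survive the evaluation of subterms.
theorem sem_compile {t : Term} (ht : ¬ t.Reads scratch) (k : ℕ) (ρ : ℕ → ℕ) (σ : Memory F) :
    (t.compile k).sem ρ σ [scratch, k] = t.eval ρ σ ∧
      ∀ j < k, (t.compile k).sem ρ σ [scratch, j] = σ [scratch, j] := by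
  have eval_eq : ∀ {t : Term}, ¬ t.Reads scratch → ∀ {σ σ' : Memory F} (ρ : ℕ → ℕ),
      (∀ n ≠ scratch, ∀ a, σ (n :: a) = σ' (n :: a)) → t.eval ρ σ = t.eval ρ σ' := by
    intro t ht σ σ' ρ h
    exact eval_congr (fun n hn => h n (by rintro rfl; exact ht hn)) ρ
  induction t generalizing k ρ σ with
  | cell n idx =>
    have hn : n ≠ 13 := ht
    constructor
    · simp [compile, sem, run, AddrExpr.eval, IndexExpr.eval, eval, hn]
    · intro j hj
      simp [compile, sem, run, AddrExpr.eval, IndexExpr.eval, hj.ne]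
  | zero | one =>
    constructor
    · simp [compile, sem, run, AddrExpr.eval, IndexExpr.eval, eval]
    · intro j hj
      simp [compile, sem, run, AddrExpr.eval, IndexExpr.eval, hj.ne]
  | sub a b ha hb | mul a b ha hb =>
    simp only [Reads, not_or] at ht
    obtain ⟨a1, a2⟩ := ha ht.1 k ρ σ
    obtain ⟨b1, b2⟩ := hb ht.2 (k + 1) ρ ((a.compile k).sem ρ σ)
    rw [eval_eq ht.2 (σ' := σ) ρ fun n hn a' =>
      sem_of_noWrite (noWrite_compile hn.symm a k) _ _ _] at b1
    simp only [compile, sem_seq]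
    constructor
    · simp only [sem, run, AddrExpr.eval, IndexExpr.eval, List.map, Function.update_self] at *
      rw [b1, b2 k (by omega), a1]
      rfl
    · intro j hj
      rw [← a2 j hj, ← b2 j (by omega)]
      exact Function.update_of_ne (by simp [AddrExpr.eval, IndexExpr.eval, hj.ne]) _ _
  | inv a ha =>
    obtain ⟨a1, a2⟩ := ha ht k ρ σ
    simp only [compile, sem_seq]
    constructor
    · simp only [sem, run, AddrExpr.eval, IndexExpr.eval, List.map, Function.update_self] at *
      rw [a1]
      rfl
    · intro j hj
      rw [← a2 j hj]
      exact Function.update_of_ne (by simp [AddrExpr.eval, IndexExpr.eval, hj.ne]) _ _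
  | sum v t a ha =>
    simp only [compile, sem_seq]
    have h := sem_loop_induction ρ ((Program.zero (slot k)).sem ρ σ) v t
      (seq (a.compile (k + 1)) (add (slot k) (slot k) (slot (k + 1))))
      (fun n σ' => (∀ n ≠ scratch, ∀ a, σ' (n :: a) = σ (n :: a)) ∧
        (∀ j < k, σ' [scratch, j] = σ [scratch, j]) ∧
        σ' [scratch, k] = ∑ i ∈ Finset.range n, a.eval (Function.update ρ v i) σ) ?_ ?_
    · exact ⟨h.2.2, h.2.1⟩
    · refine ⟨fun n hn a' => Function.update_of_ne (by simp [AddrExpr.eval, IndexExpr.eval, hn]) _ _,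
        fun j hj => Function.update_of_ne (by simp [AddrExpr.eval, IndexExpr.eval, hj.ne]) _ _, ?_⟩
      simp [sem, run, AddrExpr.eval, IndexExpr.eval]
    · rintro i hi σ' ⟨h1, h2, h3⟩
      obtain ⟨a1, a2⟩ := ha ht (k + 1) (Function.update ρ v i) σ'
      rw [eval_eq (t := a) ht _ h1] at a1
      simp only [sem_seq]
      refine ⟨fun n hn a' => ?_, fun j hj => ?_, ?_⟩
      · rw [← h1 n hn, ← sem_of_noWrite (noWrite_compile hn.symm a (k + 1))
          (Function.update ρ v i) σ']
        exact Function.update_of_ne (by simp [AddrExpr.eval, IndexExpr.eval, hn]) _ _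
      · rw [← h2 j hj, ← a2 j (by omega)]
        exact Function.update_of_ne (by simp [AddrExpr.eval, IndexExpr.eval, hj.ne]) _ _
      · rw [Finset.sum_range_succ, ← h3, ← a1, ← a2 k (by omega)]
        simp [sem, run, AddrExpr.eval, IndexExpr.eval]
  | last v t c a hc ha =>
    simp only [Reads, not_or] at ht
    simp only [compile, sem_seq]
    have h := sem_loop_induction ρ ((Program.zero (slot k)).sem ρ σ) v t
      (seq (c.compile (k + 1)) (ifZero (slot (k + 1)) skip (seq (a.compile (k + 1))
        (seq (Program.zero (slot k)) (add (slot k) (slot k) (slot (k + 1)))))))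
      (fun n σ' => (∀ n ≠ scratch, ∀ a, σ' (n :: a) = σ (n :: a)) ∧
        (∀ j < k, σ' [scratch, j] = σ [scratch, j]) ∧
        σ' [scratch, k] = lastValue (fun i => c.eval (Function.update ρ v i) σ)
          (fun i => a.eval (Function.update ρ v i) σ) n) ?_ ?_
    · exact ⟨h.2.2, h.2.1⟩
    · refine ⟨fun n hn a' => Function.update_of_ne (by simp [AddrExpr.eval, IndexExpr.eval, hn]) _ _,
        fun j hj => Function.update_of_ne (by simp [AddrExpr.eval, IndexExpr.eval, hj.ne]) _ _, ?_⟩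
      simp [sem, run, AddrExpr.eval, IndexExpr.eval, lastValue]
    · rintro i hi σ' ⟨h1, h2, h3⟩
      obtain ⟨c1, c2⟩ := hc ht.1 (k + 1) (Function.update ρ v i) σ'
      rw [eval_eq ht.1 _ h1] at c1
      have c3 : ∀ n ≠ scratch, ∀ a, (c.compile (k + 1)).sem (Function.update ρ v i) σ' (n :: a)
          = σ (n :: a) := fun n hn a' => by
        rw [← h1 n hn, sem_of_noWrite (noWrite_compile hn.symm c (k + 1))]
      simp only [sem_seq, sem_ifZero, lastValue]
      generalize (c.compile (k + 1)).sem (Function.update ρ v i) σ' = σ₁ at *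
      have hs : AddrExpr.eval (Function.update ρ v i) (slot (k + 1)) = [13, k + 1] := rfl
      rw [hs, c1]
      by_cases hz : c.eval (Function.update ρ v i) σ = 0
      · simp only [hz, if_true]
        exact ⟨c3, fun j hj => (c2 j (by omega)).trans (h2 j hj), (c2 k (by omega)).trans h3⟩
      · simp only [hz, if_false]
        obtain ⟨a1, a2⟩ := ha ht.2 (k + 1) (Function.update ρ v i) σ₁
        rw [eval_eq ht.2 _ c3] at a1
        refine ⟨fun n hn a' => ?_, fun j hj => ?_, ?_⟩
        · rw [← c3 n hn, ← sem_of_noWrite (noWrite_compile hn.symm a (k + 1))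
            (Function.update ρ v i) σ₁]
          simp [sem, run, AddrExpr.eval, IndexExpr.eval, hn]
        · rw [← h2 j hj, ← c2 j (by omega), ← a2 j (by omega)]
          simp [sem, run, AddrExpr.eval, IndexExpr.eval, hj.ne]
        · rw [← a1]
          simp [sem, run, AddrExpr.eval, IndexExpr.eval]

end Term

namespace Program

open Term (scratch slot)

/-- Nested loops. -/
def loops : List (ℕ × IndexExpr) → Program → Program
  | [], P => P
  | (v, t) :: vs, P => loop v t (loops vs P)

/-- The body of nested loops is executed with the values `ρ'` of the index variables. -/
def InLoops : List (ℕ × IndexExpr) → (ℕ → ℕ) → (ℕ → ℕ) → Prop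
  | [], ρ, ρ' => ρ' = ρ
  | (v, t) :: vs, ρ, ρ' => ∃ i < t.eval ρ, InLoops vs (Function.update ρ v i) ρ'

/-- Sets the cells `d, idx` to the value of a term, for all values of the loop variables. -/
def fill (vs : List (ℕ × IndexExpr)) (d : ℕ) (idx : List IndexExpr) (t : Term) : Program :=
  loops vs (seq (t.compile 0) (seq (zero (IndexExpr.const d :: idx))
    (add (IndexExpr.const d :: idx) (IndexExpr.const d :: idx) (slot 0))))

theorem noWrite_fill {vs : List (ℕ × IndexExpr)} {d : ℕ} {idx : List IndexExpr} {t : Term} {n : ℕ} :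
    scratch ≠ n → d ≠ n → (fill vs d idx t).NoWrite n := by
  intro h1 h2
  unfold fill
  induction vs with
  | nil => simp [loops, NoWrite, Term.noWrite_compile h1, AddrExpr.Avoids, h2]
  | cons v vs ih => exact ih

variable {F : Type*} [Field F]

/-- The term reads neither the target array nor the auxiliary cells, so every iteration sees the
initial values of what it reads. Since several iterations might address the same cell, only some
iteration is asserted to determine it; uniqueness is added in `sem_fill`. -/
theorem sem_fill_spec (vs : List (ℕ × IndexExpr)) {d : ℕ} (hd : d ≠ scratch) (idx : List IndexExpr)
    {t : Term} (ht : ¬ t.Reads scratch) (htd : ¬ t.Reads d) (ρ : ℕ → ℕ) (σ : Memory F)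
    (a : List ℕ) :
    ((∀ ρ', InLoops vs ρ ρ' → idx.map (IndexExpr.eval ρ') ≠ a) ∧
      (fill vs d idx t).sem ρ σ (d :: a) = σ (d :: a)) ∨
    ∃ ρ', InLoops vs ρ ρ' ∧ idx.map (IndexExpr.eval ρ') = a ∧
      (fill vs d idx t).sem ρ σ (d :: a) = t.eval ρ' σ := by
  induction vs generalizing ρ σ with
  | nil =>
    obtain ⟨h1, -⟩ := Term.sem_compile ht 0 ρ σ
    have h2 : ∀ a, (t.compile 0).sem ρ σ (d :: a) = σ (d :: a) :=
      sem_of_noWrite (Term.noWrite_compile hd.symm t 0) _ _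
    simp only [InLoops, forall_eq, fill, loops, sem_seq, exists_eq_left]
    by_cases ha : idx.map (IndexExpr.eval ρ) = a
    · right
      refine ⟨ha, ?_⟩
      rw [← h1]
      simp [sem, run, AddrExpr.eval, IndexExpr.eval, ha, hd.symm]
    · left
      refine ⟨ha, ?_⟩
      rw [← h2]
      simp [sem, run, AddrExpr.eval, IndexExpr.eval, Ne.symm ha]
  | cons v vs ih =>
    obtain ⟨v, s⟩ := v
    have key := sem_loop_induction ρ σ v s (fill vs d idx t) (fun n σ' =>
      (∀ n, t.Reads n → ∀ a, σ' (n :: a) = σ (n :: a)) ∧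
      (((∀ i < n, ∀ ρ', InLoops vs (Function.update ρ v i) ρ' → idx.map (IndexExpr.eval ρ') ≠ a) ∧
      σ' (d :: a) = σ (d :: a)) ∨
      ∃ i < n, ∃ ρ', InLoops vs (Function.update ρ v i) ρ' ∧ idx.map (IndexExpr.eval ρ') = a ∧
      σ' (d :: a) = t.eval ρ' σ)) ⟨fun _ _ _ => rfl, Or.inl ⟨by simp, rfl⟩⟩ ?_
    · rcases key.2 with h | ⟨i, hi, ρ', h1, h2⟩
      · left
        refine ⟨?_, h.2⟩
        rintro ρ' ⟨i, hi, h'⟩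
        exact h.1 i hi ρ' h'
      · exact Or.inr ⟨ρ', ⟨i, hi, h1⟩, h2⟩
    · rintro i hi σ' ⟨h1, h2⟩
      refine ⟨fun n hn a => ?_, ?_⟩
      · rw [sem_of_noWrite (noWrite_fill _ _), h1 n hn]
        · rintro rfl; exact ht hn
        · rintro rfl; exact htd hn
      · rcases ih (Function.update ρ v i) σ' with ⟨h3, h4⟩ | ⟨ρ', h3, h4, h5⟩
        · rw [h4]
          rcases h2 with ⟨h5, h6⟩ | ⟨j, hj, h5⟩
          · left
            refine ⟨fun j hj => ?_, h6⟩
            rcases Nat.lt_succ_iff_lt_or_eq.1 hj with h | rfl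
            exacts [h5 j h, h3]
          · exact Or.inr ⟨j, by omega, h5⟩
        · exact Or.inr ⟨i, by omega, ρ', h3, h4, h5.trans (Term.eval_congr h1 _)⟩

/-- The cells that a comprehension writes. -/
theorem sem_fill {vs : List (ℕ × IndexExpr)} {d : ℕ} {idx : List IndexExpr} {t : Term}
    {ρ : ℕ → ℕ} (ρ' : ℕ → ℕ) (hd : d ≠ scratch) (ht : ¬ t.Reads scratch) (htd : ¬ t.Reads d)
    {a : List ℕ} (ha : idx.map (IndexExpr.eval ρ') = a) (hρ : InLoops vs ρ ρ')
    (hinj : ∀ ρ'', InLoops vs ρ ρ'' → idx.map (IndexExpr.eval ρ'') = a → ρ'' = ρ')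
    (σ : Memory F) : (fill vs d idx t).sem ρ σ (d :: a) = t.eval ρ' σ := by
  rcases sem_fill_spec vs hd idx ht htd ρ σ a with ⟨h, -⟩ | ⟨ρ'', h1, h2, h3⟩
  · exact absurd ha (h ρ' hρ)
  · rw [h3, hinj ρ'' h1 h2]

/-- The cells that a comprehension does not write. -/
theorem sem_fill_of_ne {vs : List (ℕ × IndexExpr)} {d : ℕ} {idx : List IndexExpr} {t : Term}
    {ρ : ℕ → ℕ} (hd : d ≠ scratch) (ht : ¬ t.Reads scratch) (htd : ¬ t.Reads d) {a : List ℕ}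
    (h : ∀ ρ', InLoops vs ρ ρ' → idx.map (IndexExpr.eval ρ') ≠ a) (σ : Memory F) :
    (fill vs d idx t).sem ρ σ (d :: a) = σ (d :: a) := by
  rcases sem_fill_spec vs hd idx ht htd ρ σ a with ⟨-, h'⟩ | ⟨ρ'', h1, h2, -⟩
  · exact h'
  · exact absurd h2 (h _ h1)

end Program

/-! ### Environments with fixed parameters -/

/-- The index variables below `4`, which hold the parameters, have the same values. -/
def SameParams (ρ₀ ρ : ℕ → ℕ) : Prop := ∀ v < 4, ρ v = ρ₀ v

theorem SameParams.refl (ρ : ℕ → ℕ) : SameParams ρ ρ := fun _ _ => rfl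

@[simp]
theorem sameParams_update {ρ₀ ρ : ℕ → ℕ} {v i : ℕ} (hv : 4 ≤ v) :
    SameParams ρ₀ (Function.update ρ v i) ↔ SameParams ρ₀ ρ := by
  refine forall₂_congr fun w hw => ?_
  rw [Function.update_of_ne (by omega)]

/-- The value of the expression is `n` whenever the parameters have the values `ρ₀`. -/
def IndexExpr.Denotes (ρ₀ : ℕ → ℕ) (t : IndexExpr) (n : ℕ) : Prop :=
  ∀ ρ, SameParams ρ₀ ρ → t.eval ρ = n

namespace Program

theorem InLoops.eq_of_notMem {vs : List (ℕ × IndexExpr)} {ρ ρ' : ℕ → ℕ} (h : InLoops vs ρ ρ')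
    {w : ℕ} (hw : ∀ x ∈ vs, x.1 ≠ w) : ρ' w = ρ w := by
  induction vs generalizing ρ with
  | nil => rw [show ρ' = ρ from h]
  | cons v vs ih =>
    obtain ⟨v, t⟩ := v
    obtain ⟨i, -, h⟩ := h
    rw [ih h fun x hx => hw x (List.mem_cons_of_mem _ hx),
      Function.update_of_ne (hw (v, t) List.mem_cons_self).symm]

theorem InLoops.ext {vs : List (ℕ × IndexExpr)} {ρ ρ₁ ρ₂ : ℕ → ℕ} (h₁ : InLoops vs ρ ρ₁)
    (h₂ : InLoops vs ρ ρ₂) (h : ∀ x ∈ vs, ρ₁ x.1 = ρ₂ x.1) : ρ₁ = ρ₂ := by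
  funext w
  by_cases hw : ∃ x ∈ vs, x.1 = w
  · obtain ⟨x, hx, rfl⟩ := hw
    exact h x hx
  · push Not at hw
    rw [h₁.eq_of_notMem hw, h₂.eq_of_notMem hw]

theorem InLoops.sameParams {vs : List (ℕ × IndexExpr)} {ρ₀ ρ ρ' : ℕ → ℕ} (h : InLoops vs ρ ρ')
    (hv : ∀ x ∈ vs, 4 ≤ x.1) (hρ : SameParams ρ₀ ρ) : SameParams ρ₀ ρ' := by
  intro w hw
  rw [h.eq_of_notMem fun x hx => by have := hv x hx; omega, hρ w hw]

variable {F : Type*} [Field F]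

/-- Uniqueness of the iteration has to be checked on the loop variables only, because the other
index variables keep their values. -/
theorem sem_fill_eq {vs : List (ℕ × IndexExpr)} {d : ℕ} {idx : List IndexExpr} {t : Term}
    {ρ : ℕ → ℕ} (σ : Memory F) (ρ' : ℕ → ℕ) {a : List ℕ} (hd : d ≠ Term.scratch)
    (ht : ¬ t.Reads Term.scratch) (htd : ¬ t.Reads d) (hρ : InLoops vs ρ ρ')
    (ha : idx.map (IndexExpr.eval ρ') = a)
    (hinj : ∀ ρ'', InLoops vs ρ ρ'' → idx.map (IndexExpr.eval ρ'') = a →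
      ∀ x ∈ vs, ρ'' x.1 = ρ' x.1) : (fill vs d idx t).sem ρ σ (d :: a) = t.eval ρ' σ :=
  sem_fill ρ' hd ht htd ha hρ (fun ρ'' h1 h2 => h1.ext hρ (hinj ρ'' h1 h2)) σ

end Program

/-! ### The solution of homogeneous linear systems -/

section Kernel

open Program Term

/-- The sum of `f` over the pairs of indices below `n₁` and `n₂`. -/
abbrev sum₂ {F : Type*} [AddCommMonoid F] (n₁ n₂ : ℕ) (f : ℕ → ℕ → F) : F :=
  ∑ c ∈ Finset.range n₁, ∑ u ∈ Finset.range n₂, f c u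

theorem sum₂_congr {F : Type*} [AddCommMonoid F] {n₁ n₂ : ℕ} {f g : ℕ → ℕ → F}
    (h : ∀ c < n₁, ∀ u < n₂, f c u = g c u) : sum₂ n₁ n₂ f = sum₂ n₁ n₂ g :=
  Finset.sum_congr rfl fun c hc => Finset.sum_congr rfl fun u hu =>
    h c (Finset.mem_range.1 hc) u (Finset.mem_range.1 hu)

theorem sum₂_comm {F : Type*} [AddCommMonoid F] {n₁ n₂ n₃ n₄ : ℕ} {f : ℕ → ℕ → ℕ → ℕ → F} :
    sum₂ n₁ n₂ (fun c u => sum₂ n₃ n₄ (f c u)) =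
      sum₂ n₃ n₄ (fun d w => sum₂ n₁ n₂ (fun c u => f c u d w)) := by
  have h : ∀ n₁ n₂ (g : ℕ → ℕ → F), sum₂ n₁ n₂ g =
      ∑ p ∈ Finset.range n₁ ×ˢ Finset.range n₂, g p.1 p.2 := fun n₁ n₂ g =>
    (Finset.sum_product' _ _ _).symm
  simp only [h]
  exact Finset.sum_comm

variable {F : Type*} [Field F]

/-- The columns of `B` span the space of solutions of the linear equations `A i l`, for
`(i, l) ∈ S`. -/
structure IsKernel (n₁ n₂ : ℕ) (A : ℕ → ℕ → ℕ → ℕ → F) (S : ℕ → ℕ → Prop)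
    (B : ℕ → ℕ → ℕ → ℕ → F) : Prop where
  mem : ∀ i l, S i l → ∀ d < n₁, ∀ w < n₂, sum₂ n₁ n₂ (fun c u => A i l c u * B c u d w) = 0
  span : ∀ x : ℕ → ℕ → F, (∀ i l, S i l → sum₂ n₁ n₂ (fun c u => A i l c u * x c u) = 0) →
    ∃ y : ℕ → ℕ → F, ∀ c < n₁, ∀ u < n₂, x c u = sum₂ n₁ n₂ (fun d w => B c u d w * y d w)

theorem IsKernel.congr {n₁ n₂ : ℕ} {A : ℕ → ℕ → ℕ → ℕ → F} {S S' : ℕ → ℕ → Prop}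
    {B B' : ℕ → ℕ → ℕ → ℕ → F} (h : IsKernel n₁ n₂ A S B) (hS : ∀ i l, S' i l ↔ S i l)
    (hB : ∀ c < n₁, ∀ u < n₂, ∀ d < n₁, ∀ w < n₂, B' c u d w = B c u d w) :
    IsKernel n₁ n₂ A S' B' := by
  have e1 : ∀ i l, ∀ d < n₁, ∀ w < n₂, sum₂ n₁ n₂ (fun c u => A i l c u * B' c u d w)
      = sum₂ n₁ n₂ (fun c u => A i l c u * B c u d w) := fun i l d hd w hw =>
    sum₂_congr fun c hc u hu => by rw [hB c hc u hu d hd w hw]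
  have e2 : ∀ (y : ℕ → ℕ → F), ∀ c < n₁, ∀ u < n₂, sum₂ n₁ n₂ (fun d w => B' c u d w * y d w)
      = sum₂ n₁ n₂ (fun d w => B c u d w * y d w) := fun y c hc u hu =>
    sum₂_congr fun d hd w hw => by rw [hB c hc u hu d hd w hw]
  refine ⟨fun i l hil d hd w hw => ?_, fun x hx => ?_⟩
  · rw [e1 i l d hd w hw]; exact h.mem i l ((hS i l).1 hil) d hd w hw
  · obtain ⟨y, hy⟩ := h.span x fun i l hil => hx i l ((hS i l).2 hil)
    exact ⟨y, fun c hc u hu => (hy c hc u hu).trans (e2 y c hc u hu).symm⟩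

/-- Starting point of the elimination: no equation imposed, and the unit vectors span everything. -/
theorem isKernel_identity (n₁ n₂ : ℕ) (A : ℕ → ℕ → ℕ → ℕ → F) :
    IsKernel n₁ n₂ A (fun _ _ => False) (fun c u d w => if c = d ∧ u = w then 1 else 0) := by
  refine ⟨fun _ _ h => h.elim, fun x _ => ⟨x, fun c hc u hu => ?_⟩⟩
  rw [sum₂, Finset.sum_eq_single c, Finset.sum_eq_single u]
  · simp
  · intro w _ hw; simp [hw.symm]
  · intro h; exact absurd (Finset.mem_range.2 hu) h
  · intro d _ hd; simp [hd.symm]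
  · intro h; exact absurd (Finset.mem_range.2 hc) h

/-- One more equation. -/
theorem IsKernel.step {n₁ n₂ : ℕ} {A : ℕ → ℕ → ℕ → ℕ → F} {S : ℕ → ℕ → Prop}
    {B : ℕ → ℕ → ℕ → ℕ → F} (h : IsKernel n₁ n₂ A S B) (i l : ℕ) (s p : ℕ → ℕ → F)
    (hs : ∀ d < n₁, ∀ w < n₂, s d w = sum₂ n₁ n₂ (fun c u => A i l c u * B c u d w))
    (hp : (∀ d < n₁, ∀ w < n₂, s d w = 0) ∧ (∀ c u, p c u = 0) ∨
      ∃ d < n₁, ∃ w < n₂, s d w ≠ 0 ∧ ∀ c u, p c u = B c u d w * (s d w)⁻¹) :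
    IsKernel n₁ n₂ A (fun i' l' => S i' l' ∨ i' = i ∧ l' = l)
      (fun c u d w => B c u d w - s d w * p c u) := by
  have lin : ∀ a : ℕ → ℕ → F, ∀ d w, sum₂ n₁ n₂ (fun c u => a c u * (B c u d w - s d w * p c u))
      = sum₂ n₁ n₂ (fun c u => a c u * B c u d w)
        - s d w * sum₂ n₁ n₂ (fun c u => a c u * p c u) := by
    intro a d w
    simp only [sum₂, Finset.mul_sum, ← Finset.sum_sub_distrib]
    exact Finset.sum_congr rfl fun c _ => Finset.sum_congr rfl fun u _ => by ring
  have lin' : ∀ a : ℕ → ℕ → F, ∀ d w (e : F), sum₂ n₁ n₂ (fun c u => a c u * (B c u d w * e))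
      = sum₂ n₁ n₂ (fun c u => a c u * B c u d w) * e := by
    intro a d w e
    simp only [sum₂, Finset.sum_mul]
    exact Finset.sum_congr rfl fun c _ => Finset.sum_congr rfl fun u _ => by ring
  constructor
  · intro i' l' hil d hd w hw
    rw [lin]
    rcases hil with hil | ⟨rfl, rfl⟩
    · rw [h.mem i' l' hil d hd w hw]
      rcases hp with ⟨-, h2⟩ | ⟨d', hd', w', hw', -, h2⟩
      · simp [h2]
      · simp only [h2]
        rw [lin', h.mem i' l' hil d' hd' w' hw']
        simp
    · rcases hp with ⟨h1, -⟩ | ⟨d', hd', w', hw', h1, h2⟩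
      · rw [← hs d hd w hw, h1 d hd w hw]; simp
      · simp only [h2]
        rw [lin', ← hs d hd w hw, ← hs d' hd' w' hw', mul_inv_cancel₀ h1]
        ring
  · intro x hx
    obtain ⟨y, hy⟩ := h.span x fun i' l' h' => hx i' l' (Or.inl h')
    refine ⟨y, fun c hc u hu => ?_⟩
    -- The old coefficients `y` still work: the correction is a multiple of the pivot column with
    -- factor ∑ s y, which is the value of the new equation at `x`, hence zero. The pivot column
    -- itself becomes zero, so the number of columns never changes and the result is a spanning
    -- family rather than a basis.
    have h0 : sum₂ n₁ n₂ (fun d w => s d w * y d w) = 0 := by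
      rw [← hx i l (Or.inr ⟨rfl, rfl⟩)]
      calc sum₂ n₁ n₂ (fun d w => s d w * y d w)
          = sum₂ n₁ n₂ (fun d w => sum₂ n₁ n₂ (fun c u => A i l c u * (B c u d w * y d w))) := by
            refine sum₂_congr fun d hd w hw => ?_
            rw [hs d hd w hw, lin']
        _ = sum₂ n₁ n₂ (fun c u => sum₂ n₁ n₂ (fun d w => A i l c u * (B c u d w * y d w))) := by
            exact sum₂_comm
        _ = sum₂ n₁ n₂ (fun c u => A i l c u * x c u) := by
            refine sum₂_congr fun c hc u hu => ?_
            rw [hy c hc u hu]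
            simp only [sum₂, Finset.mul_sum]
    calc x c u = sum₂ n₁ n₂ (fun d w => B c u d w * y d w)
          - sum₂ n₁ n₂ (fun d w => s d w * y d w) * p c u := by
          rw [h0, zero_mul, sub_zero, hy c hc u hu]
      _ = _ := by
          simp only [sum₂, Finset.sum_mul, ← Finset.sum_sub_distrib]
          exact Finset.sum_congr rfl fun d _ => Finset.sum_congr rfl fun w _ => by ring

/-- The value of `a` at some pair of indices at which `c` is nonzero, or zero. -/
theorem lastValue_lastValue_spec (n₁ n₂ : ℕ) (c : ℕ → ℕ → F) :
    ((∀ i < n₁, ∀ j < n₂, c i j = 0) ∧ ∀ a : ℕ → ℕ → F, lastValue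
      (fun i => lastValue (c i) (fun _ => 1) n₂) (fun i => lastValue (c i) (a i) n₂) n₁ = 0) ∨
    ∃ i < n₁, ∃ j < n₂, c i j ≠ 0 ∧ ∀ a : ℕ → ℕ → F, lastValue
      (fun i => lastValue (c i) (fun _ => 1) n₂) (fun i => lastValue (c i) (a i) n₂) n₁ = a i j := by
  rcases lastValue_spec (fun i => lastValue (c i) (fun _ => 1) n₂) n₁ with ⟨h1, h2⟩ | ⟨i, hi, h1, h2⟩
  · refine Or.inl ⟨fun i hi => ?_, fun a => h2 _⟩
    rcases lastValue_spec (c i) n₂ with ⟨h3, -⟩ | ⟨j, hj, h3, h4⟩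
    · exact h3
    · have := h1 i hi
      rw [h4] at this
      exact absurd this one_ne_zero
  · rcases lastValue_spec (c i) n₂ with ⟨-, h3⟩ | ⟨j, hj, h3, h4⟩
    · exact absurd (h3 _) h1
    · exact Or.inr ⟨i, hi, j, hj, h3, fun a => (h2 _).trans (h4 _)⟩

namespace Arrays

/-- The matrix of a linear system. -/
abbrev system : ℕ := 27

/-- The solutions of a linear system. -/
abbrev kernel : ℕ := 28

abbrev nextKernel : ℕ := 29

abbrev residue : ℕ := 30

end Arrays

open Arrays

abbrev ix (v : ℕ) : IndexExpr := IndexExpr.var v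

/-- A nested version of `Term.last`. -/
def Term.last₂ (v₁ : ℕ) (t₁ : IndexExpr) (v₂ : ℕ) (t₂ : IndexExpr) (c a : Term) : Term :=
  last v₁ t₁ (last v₂ t₂ c one) (last v₂ t₂ c a)

/-- Takes one more equation of the linear system into account. -/
def kernelStep (c₁ c₂ : IndexExpr) : Program :=
  seq (fill [(34, c₁), (35, c₂)] residue [ix 34, ix 35]
    (sum 32 c₁ (sum 33 c₂ (mul (cell system [ix 30, ix 31, ix 32, ix 33])
      (cell kernel [ix 32, ix 33, ix 34, ix 35]))))) <|
  seq (fill [(32, c₁), (33, c₂), (34, c₁), (35, c₂)] nextKernel [ix 32, ix 33, ix 34, ix 35]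
    (sub (cell kernel [ix 32, ix 33, ix 34, ix 35]) (mul (cell residue [ix 34, ix 35])
      (last₂ 36 c₁ 37 c₂ (cell residue [ix 36, ix 37])
        (mul (cell kernel [ix 32, ix 33, ix 36, ix 37]) (inv (cell residue [ix 36, ix 37]))))))) <|
  fill [(32, c₁), (33, c₂), (34, c₁), (35, c₂)] kernel [ix 32, ix 33, ix 34, ix 35]
    (cell nextKernel [ix 32, ix 33, ix 34, ix 35])

/-- Solves a homogeneous linear system, whose rows and columns are numbered by pairs of indices. -/
def kernelProgram (r₁ r₂ c₁ c₂ : IndexExpr) : Program :=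
  seq (fill [(32, c₁), (33, c₂), (34, c₁), (35, c₂)] kernel [ix 32, ix 33, ix 34, ix 35] zero) <|
  seq (fill [(32, c₁), (33, c₂)] kernel [ix 32, ix 33, ix 32, ix 33] one) <|
  loop 30 r₁ <| loop 31 r₂ <| kernelStep c₁ c₂

theorem noWrite_kernelStep {n : ℕ} {c₁ c₂ : IndexExpr} (hn : n ∉ [13, 28, 29, 30]) :
    (kernelStep c₁ c₂).NoWrite n := by
  refine ⟨noWrite_fill ?_ ?_, noWrite_fill ?_ ?_, noWrite_fill ?_ ?_⟩ <;>
    (rintro rfl; exact hn (by decide))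

theorem noWrite_kernelProgram {n : ℕ} {r₁ r₂ c₁ c₂ : IndexExpr} (hn : n ∉ [13, 28, 29, 30]) :
    (kernelProgram r₁ r₂ c₁ c₂).NoWrite n := by
  have h := noWrite_kernelStep (c₁ := c₁) (c₂ := c₂) hn
  refine ⟨noWrite_fill ?_ ?_, noWrite_fill ?_ ?_, h⟩ <;>
    (rintro rfl; exact hn (by decide))

variable {ρ₀ : ℕ → ℕ} {r₁ r₂ c₁ c₂ : IndexExpr} {m₁ m₂ n₁ n₂ : ℕ}

/-- The three passes compute the values `s` of the new equation on the columns, the corrected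
columns, and a copy back. The detour through a second array is needed because each correction reads
the pivot column of the old family. -/
theorem kernelStep_spec (hc₁ : c₁.Denotes ρ₀ n₁) (hc₂ : c₂.Denotes ρ₀ n₂) {ρ : ℕ → ℕ}
    (hρ : SameParams ρ₀ ρ) (σ : Memory F) (S : ℕ → ℕ → Prop)
    (h : IsKernel n₁ n₂ (fun i l c u => σ [system, i, l, c, u]) S
      (fun c u d w => σ [kernel, c, u, d, w])) :
    IsKernel n₁ n₂ (fun i l c u => σ [system, i, l, c, u])
      (fun i l => S i l ∨ i = ρ 30 ∧ l = ρ 31)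
      (fun c u d w => (kernelStep c₁ c₂).sem ρ σ [kernel, c, u, d, w]) := by
  unfold IndexExpr.Denotes at hc₁ hc₂
  unfold kernelStep
  simp only [sem_seq]
  generalize hσ₁ : (fill [(34, c₁), (35, c₂)] residue [ix 34, ix 35] _).sem ρ σ = σ₁
  generalize hσ₂ : (fill [(32, c₁), (33, c₂), (34, c₁), (35, c₂)] nextKernel _ _).sem ρ σ₁ = σ₂
  have hs : ∀ d < n₁, ∀ w < n₂, σ₁ [residue, d, w] = sum₂ n₁ n₂ (fun c u =>
      σ [system, ρ 30, ρ 31, c, u] * σ [kernel, c, u, d, w]) := by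
    intro d hd w hw
    rw [← hσ₁, sem_fill_eq σ (Function.update (Function.update ρ 34 d) 35 w)]
    · simp [Term.eval, IndexExpr.eval, hc₁, hc₂, hρ]
    · decide
    · simp [Term.Reads]
    · simp [Term.Reads]
    · exact ⟨d, by simp [hc₁, hρ, hd], w, by simp [hc₂, hρ, hw], rfl⟩
    · simp [IndexExpr.eval]
    · intro ρ' _; simp [IndexExpr.eval]
  have hk₁ : ∀ a, σ₁ (kernel :: a) = σ (kernel :: a) := fun a => by
    rw [← hσ₁]; exact sem_of_noWrite (noWrite_fill (by decide) (by decide)) _ _ _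
  have hp := lastValue_lastValue_spec n₁ n₂ (fun d w => σ₁ [residue, d, w])
  have hn : ∀ c < n₁, ∀ u < n₂, ∀ d < n₁, ∀ w < n₂, σ₂ [nextKernel, c, u, d, w] =
      σ [kernel, c, u, d, w] - σ₁ [residue, d, w] *
        lastValue (fun i => lastValue (fun j => σ₁ [residue, i, j]) (fun _ => 1) n₂)
          (fun i => lastValue (fun j => σ₁ [residue, i, j])
            (fun j => σ [kernel, c, u, i, j] * (σ₁ [residue, i, j])⁻¹) n₂) n₁ := by
    intro c hc u hu d hd w hw
    rw [← hσ₂, sem_fill_eq σ₁ (Function.update (Function.update (Function.update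
      (Function.update ρ 32 c) 33 u) 34 d) 35 w)]
    · simp [Term.last₂, Term.eval, IndexExpr.eval, hc₁, hc₂, hρ, hk₁]
    · decide
    · simp [Term.Reads, Term.last₂]
    · simp [Term.Reads, Term.last₂]
    · exact ⟨c, by simp [hc₁, hρ, hc], u, by simp [hc₂, hρ, hu], d, by simp [hc₁, hρ, hd], w,
        by simp [hc₂, hρ, hw], rfl⟩
    · simp [IndexExpr.eval]
    · intro ρ' _; simp [IndexExpr.eval]
  refine (h.step (ρ 30) (ρ 31) (fun d w => σ₁ [residue, d, w]) (fun c u =>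
    lastValue (fun i => lastValue (fun j => σ₁ [residue, i, j]) (fun _ => 1) n₂)
      (fun i => lastValue (fun j => σ₁ [residue, i, j])
        (fun j => σ [kernel, c, u, i, j] * (σ₁ [residue, i, j])⁻¹) n₂) n₁) hs ?_).congr
    (fun _ _ => Iff.rfl) ?_
  · rcases hp with ⟨h1, h2⟩ | ⟨d, hd, w, hw, h1, h2⟩
    · exact Or.inl ⟨h1, fun c u => h2 _⟩
    · exact Or.inr ⟨d, hd, w, hw, h1, fun c u => h2 _⟩
  · intro c hc u hu d hd w hw
    rw [← hn c hc u hu d hd w hw, sem_fill_eq σ₂ (Function.update (Function.update (Function.update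
      (Function.update ρ 32 c) 33 u) 34 d) 35 w)]
    · simp [Term.eval, IndexExpr.eval]
    · decide
    · simp [Term.Reads]
    · simp [Term.Reads]
    · exact ⟨c, by simp [hc₁, hρ, hc], u, by simp [hc₂, hρ, hu], d, by simp [hc₁, hρ, hd], w,
        by simp [hc₂, hρ, hw], rfl⟩
    · simp [IndexExpr.eval]
    · intro ρ' _; simp [IndexExpr.eval]

theorem kernelProgram_spec (hr₁ : r₁.Denotes ρ₀ m₁) (hr₂ : r₂.Denotes ρ₀ m₂)
    (hc₁ : c₁.Denotes ρ₀ n₁) (hc₂ : c₂.Denotes ρ₀ n₂) {ρ : ℕ → ℕ}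
    (hρ : SameParams ρ₀ ρ) (σ : Memory F) :
    IsKernel n₁ n₂ (fun i l c u => σ [system, i, l, c, u]) (fun i l => i < m₁ ∧ l < m₂)
      (fun c u d w => (kernelProgram r₁ r₂ c₁ c₂).sem ρ σ [kernel, c, u, d, w]) := by
  unfold kernelProgram
  simp only [sem_seq]
  generalize hσ₁ : (fill [(32, c₁), (33, c₂), (34, c₁), (35, c₂)] kernel _ _).sem ρ σ = σ₁
  generalize hσ₂ : (fill [(32, c₁), (33, c₂)] kernel _ _).sem ρ σ₁ = σ₂
  have hsys : ∀ a, σ₂ (system :: a) = σ (system :: a) := fun a => by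
    rw [← hσ₂, ← hσ₁]
    rw [sem_of_noWrite (noWrite_fill (by decide) (by decide)),
      sem_of_noWrite (noWrite_fill (by decide) (by decide))]
  have h0 : IsKernel n₁ n₂ (fun i l c u => σ [system, i, l, c, u]) (fun _ _ => False)
      (fun c u d w => σ₂ [kernel, c, u, d, w]) := by
    refine (isKernel_identity n₁ n₂ _).congr (fun _ _ => Iff.rfl) ?_
    intro c hc u hu d hd w hw
    rw [← hσ₂]
    by_cases hcd : c = d ∧ u = w
    · obtain ⟨rfl, rfl⟩ := hcd
      rw [sem_fill_eq σ₁ (Function.update (Function.update ρ 32 c) 33 u)]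
      · simp [Term.eval]
      · decide
      · simp [Term.Reads]
      · simp [Term.Reads]
      · exact ⟨c, by simpa [hc₁ _ hρ] using hc, u, by
          rw [hc₂ _ (by simpa using hρ)]; exact hu, rfl⟩
      · simp [IndexExpr.eval]
      · intro ρ' _; simp +contextual [IndexExpr.eval]
    · rw [sem_fill_of_ne (by decide) (by simp [Term.Reads]) (by simp [Term.Reads]), ← hσ₁,
        sem_fill_eq σ (Function.update (Function.update (Function.update
          (Function.update ρ 32 c) 33 u) 34 d) 35 w)]
      · simp [Term.eval, hcd]
      · decide
      · simp [Term.Reads]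
      · simp [Term.Reads]
      · unfold IndexExpr.Denotes at hc₁ hc₂
        exact ⟨c, by simp [hc₁, hρ, hc], u, by simp [hc₂, hρ, hu], d, by simp [hc₁, hρ, hd], w,
          by simp [hc₂, hρ, hw], rfl⟩
      · simp [IndexExpr.eval]
      · intro ρ' _; simp [IndexExpr.eval]
      · intro ρ' _ h'
        simp only [IndexExpr.eval, List.map_cons, List.map_nil, List.cons.injEq] at h'
        exact hcd ⟨h'.1.symm.trans h'.2.2.1, h'.2.1.symm.trans h'.2.2.2.1⟩
  -- Invariant: exactly the equations that precede the current pair of indices lexicographically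
  -- have been imposed, and the system is untouched.
  have key := sem_loop_induction ρ σ₂ 30 r₁ (loop 31 r₂ (kernelStep c₁ c₂)) (fun i σ' =>
    (∀ a, σ' (system :: a) = σ (system :: a)) ∧
    IsKernel n₁ n₂ (fun i l c u => σ [system, i, l, c, u]) (fun i' l => i' < i ∧ l < m₂)
      (fun c u d w => σ' [kernel, c, u, d, w])) ⟨hsys, h0.congr (by simp) (fun _ _ _ _ _ _ _ _ => rfl)⟩ ?_
  · rw [hr₁ ρ hρ] at key
    exact key.2
  · rintro i - σ' ⟨h1, h2⟩
    have key' := sem_loop_induction (Function.update ρ 30 i) σ' 31 r₂ (kernelStep c₁ c₂)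
      (fun l σ' => (∀ a, σ' (system :: a) = σ (system :: a)) ∧
      IsKernel n₁ n₂ (fun i l c u => σ [system, i, l, c, u])
        (fun i' l' => (i' < i ∧ l' < m₂) ∨ (i' = i ∧ l' < l))
        (fun c u d w => σ' [kernel, c, u, d, w]))
        ⟨h1, h2.congr (by simp) (fun _ _ _ _ _ _ _ _ => rfl)⟩ ?_
    · rw [hr₂ _ (by simpa using hρ)] at key'
      refine ⟨key'.1, key'.2.congr (fun i' l' => ?_) (fun _ _ _ _ _ _ _ _ => rfl)⟩
      omega
    · rintro l - σ'' ⟨h3, h4⟩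
      refine ⟨fun a => ?_, ?_⟩
      · rw [sem_of_noWrite (noWrite_kernelStep (by decide)), h3]
      · have := kernelStep_spec hc₁ hc₂ (ρ := Function.update (Function.update ρ 30 i) 31 l)
          (by simpa using hρ) σ'' _ (by simpa only [h3] using h4)
        simp only [h3] at this
        refine this.congr (fun i' l' => ?_) (fun _ _ _ _ _ _ _ _ => rfl)
        simp
        omega

end Kernel

/-! ### Coordinates -/

section Coordinates

variable {F A : Type*} [Field F] [Field A] [Algebra F A] {m : ℕ} (e : Module.Basis (Fin m) F A)

/-- The coordinates of an element, extended by zero. -/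
noncomputable def coord (x : A) : ℕ → F := padZero fun l => e.repr x l

/-- The element with given coordinates. -/
noncomputable def ofCoord (w : ℕ → F) : A := ∑ l : Fin m, w l • e l

theorem coord_fin (x : A) (l : Fin m) : coord e x l = e.repr x l := by
  simp [coord, padZero]

theorem coord_of_lt (x : A) {l : ℕ} (hl : l < m) : coord e x l = e.repr x ⟨l, hl⟩ := by
  simp [coord, padZero, hl]

theorem coord_of_le (x : A) {l : ℕ} (hl : m ≤ l) : coord e x l = 0 := by
  simp [coord, padZero, hl]

theorem coord_ofCoord (w : ℕ → F) {l : ℕ} (hl : l < m) : coord e (ofCoord e w) l = w l := by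
  rw [coord_of_lt _ _ hl, ofCoord, e.repr_sum_self]

theorem ofCoord_coord (x : A) : ofCoord e (coord e x) = x := by
  simp only [ofCoord, coord_fin, e.sum_repr]

theorem coord_add (x y : A) (l : ℕ) : coord e (x + y) l = coord e x l + coord e y l := by
  by_cases hl : l < m
  · simp [coord_of_lt _ _ hl]
  · simp [coord_of_le _ _ (not_lt.1 hl)]

theorem coord_sub (x y : A) (l : ℕ) : coord e (x - y) l = coord e x l - coord e y l := by
  by_cases hl : l < m
  · simp [coord_of_lt _ _ hl]
  · simp [coord_of_le _ _ (not_lt.1 hl)]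

theorem coord_smul (c : F) (x : A) (l : ℕ) : coord e (c • x) l = c * coord e x l := by
  by_cases hl : l < m
  · simp [coord_of_lt _ _ hl]
  · simp [coord_of_le _ _ (not_lt.1 hl)]

theorem coord_zero (l : ℕ) : coord e 0 l = 0 := by
  by_cases hl : l < m
  · simp [coord_of_lt _ _ hl]
  · simp [coord_of_le _ _ (not_lt.1 hl)]

theorem coord_sum {ι : Type*} (s : Finset ι) (f : ι → A) (l : ℕ) :
    coord e (∑ i ∈ s, f i) l = ∑ i ∈ s, coord e (f i) l := by
  induction s using Finset.cons_induction with
  | empty => simp [coord_zero]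
  | cons a s ha ih => rw [Finset.sum_cons, Finset.sum_cons, coord_add, ih]

theorem eq_of_coord_eq {x y : A} (h : ∀ l < m, coord e x l = coord e y l) : x = y := by
  refine e.repr.injective (Finsupp.ext fun l => ?_)
  simpa [coord_fin] using h l l.2

/-- The basis, extended by zero. -/
noncomputable def basisElt : ℕ → A := padZero e

theorem basisElt_fin (l : Fin m) : basisElt e l = e l := by simp [basisElt, padZero]

theorem coord_basisElt {u : ℕ} (hu : u < m) (l : ℕ) :
    coord e (basisElt e u) l = if u = l then 1 else 0 := by
  have h := basisElt_fin e ⟨u, hu⟩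
  simp only at h
  rw [h]
  by_cases hl : l < m
  · rw [coord_of_lt _ _ hl, e.repr_self, Finsupp.single_apply]
    simp
  · rw [coord_of_le _ _ (not_lt.1 hl), if_neg (by omega)]

theorem ofCoord_eq_sum (w : ℕ → F) : ofCoord e w = ∑ u ∈ Finset.range m, w u • basisElt e u := by
  rw [Finset.sum_range]
  simp [ofCoord, basisElt_fin]

theorem coord_linearMap (f : A →ₗ[F] A) (a : A) (l : ℕ) :
    coord e (f a) l = ∑ u ∈ Finset.range m, coord e a u * coord e (f (basisElt e u)) l := by
  conv_lhs => rw [← ofCoord_coord e a, ofCoord_eq_sum, map_sum, coord_sum]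
  simp [coord_smul]

theorem coord_basisElt_mul {u : ℕ} (b : A) (l : ℕ) :
    coord e (basisElt e u * b) l = ∑ w ∈ Finset.range m,
      coord e b w * coord e (basisElt e u * basisElt e w) l := by
  rw [← LinearMap.mulLeft_apply (R := F), coord_linearMap]
  simp

theorem coord_mul (a b : A) (l : ℕ) :
    coord e (a * b) l = ∑ u ∈ Finset.range m, ∑ w ∈ Finset.range m,
      coord e a u * coord e b w * coord e (basisElt e u * basisElt e w) l := by
  rw [← LinearMap.mulRight_apply (R := F), coord_linearMap]
  refine Finset.sum_congr rfl fun u _ => ?_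
  rw [LinearMap.mulRight_apply, coord_basisElt_mul, Finset.mul_sum]
  simp [mul_assoc]

/-- The value of a polynomial in `φ` with the coefficients `c 0, …, c (d - 1)`. -/
noncomputable def skewPoly (φ : A →ₗ[F] A) (c : ℕ → A) (d : ℕ) : A →ₗ[F] A :=
  ∑ t ∈ Finset.range d, LinearMap.mulLeft F (c t) ∘ₗ (φ ^ t)

theorem skewPoly_apply (φ : A →ₗ[F] A) (c : ℕ → A) (d : ℕ) (a : A) :
    skewPoly φ c d a = ∑ t ∈ Finset.range d, c t * (φ ^ t) a := by
  simp [skewPoly, LinearMap.sum_apply]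

end Coordinates

/-! ### The decoder -/

section Decoder

open Program Term

namespace Arrays

/-- The multiplication table. -/
abbrev table : ℕ := 20

/-- The images of the basis under the Frobenius map. -/
abbrev frob : ℕ := 21

/-- The points of the code. -/
abbrev points : ℕ := 22

/-- The generator matrix of the code. -/
abbrev generator : ℕ := 23

/-- The matrix of the interference. -/
abbrev nuisance : ℕ := 24

/-- The received word. -/
abbrev word : ℕ := 25

/-- The powers of the Frobenius map. -/
abbrev frobPow : ℕ := 26

abbrev nextPow : ℕ := 31

/-- The coefficients of the annihilating polynomials. -/
abbrev coeffs : ℕ := 32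

abbrev errorMap : ℕ := 33

abbrev codeMap : ℕ := 34

/-- The decoded message. -/
abbrev message : ℕ := 35

end Arrays

open Arrays

/-- Computes the powers of the Frobenius map up to the exponent `d`. -/
def powersProgram (m d : IndexExpr) : Program :=
  seq (fill [(10, m), (11, m)] frobPow [.const 0, ix 10, ix 11] zero) <|
  seq (fill [(10, m)] frobPow [.const 0, ix 10, ix 10] one) <|
  loop 12 d <|
    seq (fill [(10, m), (11, m)] nextPow [ix 10, ix 11]
      (sum 13 m (mul (cell frobPow [ix 12, ix 10, ix 13]) (cell frob [ix 13, ix 11])))) <|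
    fill [(10, m), (11, m)] frobPow [.add (ix 12) (.const 1), ix 10, ix 11]
      (cell nextPow [ix 10, ix 11])

/-- Finds the coefficients of a nontrivial relation between the Frobenius powers of the received
word, those of the code points, and the interference. -/
def annihilatorProgram (m len a b r : IndexExpr) : Program :=
  seq (fill [(10, len), (11, m), (12, a), (13, m)] system [ix 10, ix 11, ix 12, ix 13]
    (sum 14 m (sum 15 m (mul (mul (cell word [ix 10, ix 14]) (cell frobPow [ix 12, ix 14, ix 15]))
      (cell table [ix 13, ix 15, ix 11]))))) <|
  seq (fill [(10, len), (11, m), (12, b), (13, m)] system [ix 10, ix 11, .add a (ix 12), ix 13]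
    (sum 14 m (sum 15 m (mul (mul (cell points [ix 10, ix 14]) (cell frobPow [ix 12, ix 14, ix 15]))
      (cell table [ix 13, ix 15, ix 11]))))) <|
  seq (fill [(10, len), (11, m), (12, r), (13, m)] system
    [ix 10, ix 11, .add (.add a b) (ix 12), ix 13]
    (sum 14 m (mul (cell nuisance [ix 10, ix 12, ix 14]) (cell table [ix 13, ix 14, ix 11])))) <|
  seq (kernelProgram len m (.add (.add a b) r) m) <|
  -- The outer search finds a row of the kernel array with a nonzero entry, the inner one a column
  -- in which that row is nonzero; this column is copied.
  fill [(10, .add (.add a b) r), (11, m)] coeffs [ix 10, ix 11]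
    (last₂ 12 (.add (.add a b) r) 13 m
      (last₂ 14 (.add (.add a b) r) 15 m (cell kernel [ix 12, ix 13, ix 14, ix 15]) one)
      (last₂ 14 (.add (.add a b) r) 15 m (cell kernel [ix 12, ix 13, ix 14, ix 15])
        (cell kernel [ix 10, ix 11, ix 14, ix 15])))

/-- Recovers the message from the annihilating polynomials. -/
def messageProgram (m len a b R : IndexExpr) : Program :=
  seq (fill [(10, m), (11, m)] errorMap [ix 10, ix 11]
    (sum 12 a (sum 13 m (sum 14 m (mul (mul (cell coeffs [ix 12, ix 13])
      (cell frobPow [ix 12, ix 10, ix 14])) (cell table [ix 13, ix 14, ix 11])))))) <|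
  seq (fill [(10, m), (11, m)] codeMap [ix 10, ix 11]
    (sum 12 b (sum 13 m (sum 14 m (mul (mul (cell coeffs [.add a (ix 12), ix 13])
      (cell frobPow [ix 12, ix 10, ix 14])) (cell table [ix 13, ix 14, ix 11])))))) <|
  seq (fill [(10, len), (11, m), (12, R), (13, m)] system [ix 10, ix 11, ix 12, ix 13]
    (sum 14 m (mul (sum 15 m (mul (cell generator [ix 10, ix 12, ix 15])
      (cell table [ix 13, ix 15, ix 14]))) (cell errorMap [ix 14, ix 11])))) <|
  -- The last unknown τ is a scalar of F, whereas every unknown of the solver has m coordinates;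
  -- only coordinate 0 of block R is used, and the columns of the others are zero.
  seq (fill [(10, len), (11, m), (13, m)] system [ix 10, ix 11, R, ix 13] zero) <|
  seq (fill [(10, len), (11, m)] system [ix 10, ix 11, R, .const 0]
    (sum 14 m (mul (cell points [ix 10, ix 14]) (cell codeMap [ix 14, ix 11])))) <|
  seq (kernelProgram len m (.add R (.const 1)) m) <|
  -- A solution column with τ ≠ 0 is selected and divided by τ.
  fill [(10, R), (11, m)] message [ix 10, ix 11]
    (last₂ 14 (.add R (.const 1)) 15 m (cell kernel [R, .const 0, ix 14, ix 15])
      (mul (cell kernel [ix 10, ix 11, ix 14, ix 15])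
        (inv (cell kernel [R, .const 0, ix 14, ix 15]))))

variable {F A : Type*} [Field F] [Field A] [Algebra F A] {m : ℕ} (e : Module.Basis (Fin m) F A)

/-- The columns of the linear system for the annihilating polynomials. -/
noncomputable def relationColumn (φ : A →ₗ[F] A) (a b : ℕ) (y h : ℕ → A) (J : ℕ → ℕ → A)
    (i c : ℕ) : A :=
  if c < a then (φ ^ c) (y i) else if c < a + b then (φ ^ (c - a)) (h i) else J i (c - (a + b))

/-- The single vector of unknowns `W` packs together the coefficients of V, those of N, and the
interference constants, in this order. -/
theorem sum_relationColumn (φ : A →ₗ[F] A) (a b r : ℕ) (y h : ℕ → A) (J : ℕ → ℕ → A)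
    (i : ℕ) (W : ℕ → A) :
    ∑ c ∈ Finset.range (a + b + r), W c * relationColumn φ a b y h J i c =
      skewPoly φ W a (y i) + skewPoly φ (fun t => W (a + t)) b (h i) +
        ∑ j ∈ Finset.range r, W (a + b + j) * J i j := by
  rw [Finset.sum_range_add, Finset.sum_range_add, skewPoly_apply, skewPoly_apply]
  congr 1
  · congr 1
    · refine Finset.sum_congr rfl fun c hc => ?_
      simp [relationColumn, Finset.mem_range.1 hc]
    · refine Finset.sum_congr rfl fun c hc => ?_
      simp [relationColumn, Finset.mem_range.1 hc]
  · refine Finset.sum_congr rfl fun c hc => ?_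
    rw [relationColumn, if_neg (by omega), if_neg (by omega), Nat.add_sub_cancel_left]

variable {ρ₀ ρ : ℕ → ℕ} {mE lenE aE bE rE RE dE : IndexExpr} {len a b r R d : ℕ}

theorem noWrite_powersProgram {n : ℕ} (hn : n ∉ [13, 26, 31]) : (powersProgram mE dE).NoWrite n := by
  refine ⟨noWrite_fill ?_ ?_, noWrite_fill ?_ ?_, noWrite_fill ?_ ?_, noWrite_fill ?_ ?_⟩ <;>
    (rintro rfl; exact hn (by decide))

theorem noWrite_annihilatorProgram {n : ℕ} (hn : n ∉ [13, 27, 28, 29, 30, 32]) :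
    (annihilatorProgram mE lenE aE bE rE).NoWrite n := by
  refine ⟨noWrite_fill ?_ ?_, noWrite_fill ?_ ?_, noWrite_fill ?_ ?_,
    noWrite_kernelProgram fun h => hn (by simp at h ⊢; omega), noWrite_fill ?_ ?_⟩ <;>
    (rintro rfl; exact hn (by decide))

theorem noWrite_messageProgram {n : ℕ} (hn : n ∉ [13, 27, 28, 29, 30, 33, 34, 35]) :
    (messageProgram mE lenE aE bE RE).NoWrite n := by
  refine ⟨noWrite_fill ?_ ?_, noWrite_fill ?_ ?_, noWrite_fill ?_ ?_, noWrite_fill ?_ ?_,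
    noWrite_fill ?_ ?_, noWrite_kernelProgram fun h => hn (by simp at h ⊢; omega),
    noWrite_fill ?_ ?_⟩ <;>
    (rintro rfl; exact hn (by decide))

theorem powersProgram_spec (hm : mE.Denotes ρ₀ m) (hd : dE.Denotes ρ₀ d) (hρ : SameParams ρ₀ ρ)
    (σ : Memory F) (φ : A →ₗ[F] A)
    (hφ : ∀ u < m, ∀ l < m, σ [frob, u, l] = coord e (φ (basisElt e u)) l) :
    ∀ t ≤ d, ∀ u < m, ∀ l < m, (powersProgram mE dE).sem ρ σ [frobPow, t, u, l] =
      coord e ((φ ^ t) (basisElt e u)) l := by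
  unfold IndexExpr.Denotes at hm hd
  unfold powersProgram
  simp only [sem_seq]
  generalize hσ₁ : (fill [(10, mE), (11, mE)] frobPow _ zero).sem ρ σ = σ₁
  generalize hσ₂ : (fill [(10, mE)] frobPow _ one).sem ρ σ₁ = σ₂
  have h0 : ∀ u < m, ∀ l < m, σ₂ [frobPow, 0, u, l] = coord e ((φ ^ 0) (basisElt e u)) l := by
    intro u hu l hl
    rw [pow_zero, Module.End.one_apply, coord_basisElt e hu, ← hσ₂]
    by_cases hul : u = l
    · subst hul
      rw [sem_fill_eq σ₁ (Function.update ρ 10 u)]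
      · simp [Term.eval]
      · decide
      · simp [Term.Reads]
      · simp [Term.Reads]
      · exact ⟨u, by simp [hm, hρ, hu], rfl⟩
      · simp [IndexExpr.eval]
      · intro ρ' _; simp [IndexExpr.eval]
    · rw [sem_fill_of_ne (by decide) (by simp [Term.Reads]) (by simp [Term.Reads]), ← hσ₁,
        sem_fill_eq σ (Function.update (Function.update ρ 10 u) 11 l)]
      · simp [Term.eval, hul]
      · decide
      · simp [Term.Reads]
      · simp [Term.Reads]
      · exact ⟨u, by simp [hm, hρ, hu], l, by simp [hm, hρ, hl], rfl⟩
      · simp [IndexExpr.eval]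
      · intro ρ' _; simp [IndexExpr.eval]
      · intro ρ' _ h'
        simp only [IndexExpr.eval, List.map_cons, List.map_nil, List.cons.injEq] at h'
        exact hul (h'.2.1.symm.trans h'.2.2.1)
  have hf : ∀ u < m, ∀ l < m, σ₂ [frob, u, l] = coord e (φ (basisElt e u)) l := by
    intro u hu l hl
    rw [← hφ u hu l hl, ← hσ₂, ← hσ₁, sem_of_noWrite (noWrite_fill (by decide) (by decide)),
      sem_of_noWrite (noWrite_fill (by decide) (by decide))]
  generalize hP : seq (fill [(10, mE), (11, mE)] nextPow _ _) _ = P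
  have key := sem_loop_induction ρ σ₂ 12 dE P (fun n σ' =>
    (∀ u < m, ∀ l < m, σ' [frob, u, l] = coord e (φ (basisElt e u)) l) ∧
    ∀ t ≤ n, ∀ u < m, ∀ l < m, σ' [frobPow, t, u, l] = coord e ((φ ^ t) (basisElt e u)) l)
    ⟨hf, fun t ht => by obtain rfl : t = 0 := by omega
                        exact h0⟩ ?_
  · rw [hd ρ hρ] at key
    exact key.2
  · rintro n - σ' ⟨h1, h2⟩
    rw [← hP, sem_seq]
    generalize hρ' : Function.update ρ 12 n = ρ'
    have hρ'' : SameParams ρ₀ ρ' := by rw [← hρ']; simpa using hρ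
    have hn : ρ' 12 = n := by simp [← hρ']
    generalize hσ₃ : (fill [(10, mE), (11, mE)] nextPow _ _).sem ρ' σ' = σ₃
    have h3 : ∀ u < m, ∀ l < m, σ₃ [nextPow, u, l] = coord e ((φ ^ (n + 1)) (basisElt e u)) l := by
      intro u hu l hl
      rw [← hσ₃, sem_fill_eq σ' (Function.update (Function.update ρ' 10 u) 11 l)]
      · rw [pow_succ', Module.End.mul_apply, coord_linearMap]
        simp only [Term.eval]
        rw [hm _ (by simpa using hρ'')]
        refine Finset.sum_congr rfl fun w hw => ?_
        rw [Finset.mem_range] at hw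
        simp [IndexExpr.eval, hn, h1 w hw l hl, h2 n le_rfl u hu w hw]
      · decide
      · simp [Term.Reads]
      · simp [Term.Reads]
      · exact ⟨u, by simp [hm, hρ'', hu], l, by simp [hm, hρ'', hl], rfl⟩
      · simp [IndexExpr.eval]
      · intro ρ' _; simp [IndexExpr.eval]
    refine ⟨fun u hu l hl => ?_, fun t ht u hu l hl => ?_⟩
    · rw [sem_of_noWrite (noWrite_fill (by decide) (by decide)), ← hσ₃,
        sem_of_noWrite (noWrite_fill (by decide) (by decide)), h1 u hu l hl]
    · by_cases htn : t = n + 1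
      · subst htn
        rw [sem_fill_eq σ₃ (Function.update (Function.update ρ' 10 u) 11 l)]
        · simp [Term.eval, IndexExpr.eval, h3 u hu l hl]
        · decide
        · simp [Term.Reads]
        · simp [Term.Reads]
        · exact ⟨u, by simp [hm, hρ'', hu], l, by simp [hm, hρ'', hl], rfl⟩
        · simp [IndexExpr.eval, hn]
        · intro ρ' _; simp [IndexExpr.eval]
      · rw [sem_fill_of_ne (by decide) (by simp [Term.Reads]) (by simp [Term.Reads]), ← hσ₃,
          sem_of_noWrite (noWrite_fill (by decide) (by decide)), h2 t (by omega) u hu l hl]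
        intro ρ'' hl'' h'
        simp only [IndexExpr.eval, List.map_cons, List.map_nil, List.cons.injEq] at h'
        rw [hl''.eq_of_notMem (by simp), hn] at h'
        exact htn h'.1.symm

end Decoder

/-! ### Correctness of the search for annihilating polynomials -/

section Decoder

open Program Term Arrays

variable {F A : Type*} [Field F] [Field A] [Algebra F A] {m : ℕ} (e : Module.Basis (Fin m) F A)
variable {ρ₀ ρ : ℕ → ℕ} {mE lenE aE bE rE RE : IndexExpr} {len a b r R : ℕ}

theorem IndexExpr.Denotes.add {s t : IndexExpr} {i j : ℕ} (hs : s.Denotes ρ₀ i)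
    (ht : t.Denotes ρ₀ j) : (IndexExpr.add s t).Denotes ρ₀ (i + j) := fun ρ hρ => by
  rw [IndexExpr.eval, hs ρ hρ, ht ρ hρ]

theorem IndexExpr.denotes_const (c : ℕ) : (IndexExpr.const c).Denotes ρ₀ c := fun _ _ => rfl

/-- Multiplication by a fixed element is F-linear, so a linear equation with unknowns in A becomes m
equations over F in the coordinates of the unknowns. -/
theorem coord_sum_mul (W D : ℕ → A) (n l : ℕ) :
    coord e (∑ c ∈ Finset.range n, W c * D c) l =
      sum₂ n m (fun c u => coord e (basisElt e u * D c) l * coord e (W c) u) := by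
  rw [coord_sum]
  refine Finset.sum_congr rfl fun c _ => ?_
  rw [← LinearMap.mulRight_apply (R := F), coord_linearMap]
  exact Finset.sum_congr rfl fun u _ => by rw [LinearMap.mulRight_apply, mul_comm]

/-- Once the system array is seen to hold the coordinates of the relation columns times basis
elements, the kernel columns are coordinate vectors of relations. The kernel is known only through a
spanning family that may contain zero columns; a nontrivial relation, assumed to exist, forces some
column to be nonzero. -/
theorem annihilatorProgram_spec (hm : mE.Denotes ρ₀ m) (hlen : lenE.Denotes ρ₀ len)
    (ha : aE.Denotes ρ₀ a) (hb : bE.Denotes ρ₀ b) (hr : rE.Denotes ρ₀ r) (hρ : SameParams ρ₀ ρ)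
    (σ : Memory F) (φ : A →ₗ[F] A) (y h : ℕ → A) (J : ℕ → ℕ → A)
    (htab : ∀ u < m, ∀ w < m, ∀ l < m,
      σ [table, u, w, l] = coord e (basisElt e u * basisElt e w) l)
    (hpow : ∀ t < max a b, ∀ u < m, ∀ l < m,
      σ [frobPow, t, u, l] = coord e ((φ ^ t) (basisElt e u)) l)
    (hy : ∀ i < len, ∀ l < m, σ [word, i, l] = coord e (y i) l)
    (hh : ∀ i < len, ∀ l < m, σ [points, i, l] = coord e (h i) l)
    (hJ : ∀ i < len, ∀ j < r, ∀ l < m, σ [nuisance, i, j, l] = coord e (J i j) l)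
    (hex : ∃ W : ℕ → A, (∃ c < a + b + r, W c ≠ 0) ∧ ∀ i < len,
      ∑ c ∈ Finset.range (a + b + r), W c * relationColumn φ a b y h J i c = 0) :
    ∃ W : ℕ → A, ((∃ c < a + b + r, W c ≠ 0) ∧ ∀ i < len,
      ∑ c ∈ Finset.range (a + b + r), W c * relationColumn φ a b y h J i c = 0) ∧
      ∀ c < a + b + r, ∀ u < m, (annihilatorProgram mE lenE aE bE rE).sem ρ σ [coeffs, c, u] =
        coord e (W c) u := by
  have hc := (ha.add hb).add hr
  unfold annihilatorProgram
  simp only [sem_seq]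
  generalize hσ₁ : (fill [(10, lenE), (11, mE), (12, aE), (13, mE)] system _ _).sem ρ σ = σ₁
  generalize hσ₂ : (fill [(10, lenE), (11, mE), (12, bE), (13, mE)] system _ _).sem ρ σ₁ = σ₂
  generalize hσ₃ : (fill [(10, lenE), (11, mE), (12, rE), (13, mE)] system _ _).sem ρ σ₂ = σ₃
  have hk := kernelProgram_spec hlen hm hc hm hρ σ₃
  generalize hσ₄ : (kernelProgram lenE mE _ mE).sem ρ σ₃ = σ₄ at *
  unfold IndexExpr.Denotes at *
  have f₁ : ∀ n ≠ scratch, n ≠ system → ∀ x, σ₁ (n :: x) = σ (n :: x) := fun n h1 h2 x => by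
    rw [← hσ₁, sem_of_noWrite (noWrite_fill h1.symm h2.symm)]
  have f₂ : ∀ n ≠ scratch, n ≠ system → ∀ x, σ₂ (n :: x) = σ (n :: x) := fun n h1 h2 x => by
    rw [← hσ₂, sem_of_noWrite (noWrite_fill h1.symm h2.symm), f₁ n h1 h2]
  have s₁ : ∀ i < len, ∀ l < m, ∀ c < a, ∀ u < m, σ₁ [system, i, l, c, u] =
      coord e (basisElt e u * (φ ^ c) (y i)) l := by
    intro i hi l hl c hc u hu
    rw [← hσ₁, sem_fill_eq σ (Function.update (Function.update (Function.update
      (Function.update ρ 10 i) 11 l) 12 c) 13 u)]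
    · simp only [Term.eval, IndexExpr.eval, List.map_cons, List.map_nil]
      rw [coord_basisElt_mul]
      simp only [sameParams_update, hρ, hm, Nat.reduceLeDiff]
      rw [Finset.sum_comm]
      refine Finset.sum_congr rfl fun x hx => ?_
      rw [coord_linearMap, Finset.sum_mul]
      refine Finset.sum_congr rfl fun w hw => ?_
      rw [Finset.mem_range] at hx hw
      simp [hy i hi w hw, hpow c (lt_max_of_lt_left hc) w hw x hx, htab u hu x hx l hl]
    · decide
    · simp [Term.Reads]
    · simp [Term.Reads]
    · exact ⟨i, by simp [hlen, hρ, hi], l, by simp [hm, hρ, hl], c, by simp [ha, hρ, hc], u,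
        by simp [hm, hρ, hu], rfl⟩
    · simp [IndexExpr.eval]
    · intro ρ' _; simp [IndexExpr.eval]
  have s₂ : ∀ i < len, ∀ l < m, ∀ c < b, ∀ u < m, σ₂ [system, i, l, a + c, u] =
      coord e (basisElt e u * (φ ^ c) (h i)) l := by
    intro i hi l hl c hc u hu
    rw [← hσ₂, sem_fill_eq σ₁ (Function.update (Function.update (Function.update
      (Function.update ρ 10 i) 11 l) 12 c) 13 u)]
    · simp only [Term.eval, IndexExpr.eval, List.map_cons, List.map_nil]
      rw [coord_basisElt_mul]
      simp only [sameParams_update, hρ, hm, Nat.reduceLeDiff]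
      rw [Finset.sum_comm]
      refine Finset.sum_congr rfl fun x hx => ?_
      rw [coord_linearMap, Finset.sum_mul]
      refine Finset.sum_congr rfl fun w hw => ?_
      rw [Finset.mem_range] at hx hw
      simp [f₁, hh i hi w hw, hpow c (lt_max_of_lt_right hc) w hw x hx, htab u hu x hx l hl]
    · decide
    · simp [Term.Reads]
    · simp [Term.Reads]
    · exact ⟨i, by simp [hlen, hρ, hi], l, by simp [hm, hρ, hl], c, by simp [hb, hρ, hc], u,
        by simp [hm, hρ, hu], rfl⟩
    · simp [IndexExpr.eval, ha, hρ]
    · intro ρ' h'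
      have := h'.sameParams (by simp) hρ
      simp [IndexExpr.eval, ha, this]
  have s₂' : ∀ i < len, ∀ l < m, ∀ c < a, ∀ u < m, σ₂ [system, i, l, c, u] =
      coord e (basisElt e u * (φ ^ c) (y i)) l := by
    intro i hi l hl c hc u hu
    rw [← s₁ i hi l hl c hc u hu, ← hσ₂, sem_fill_of_ne (by decide) (by simp [Term.Reads])
      (by simp [Term.Reads])]
    intro ρ' h'
    have := h'.sameParams (by simp) hρ
    simp [IndexExpr.eval, ha, this]
    omega
  have s₃ : ∀ i < len, ∀ l < m, ∀ c < r, ∀ u < m, σ₃ [system, i, l, a + b + c, u] =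
      coord e (basisElt e u * J i c) l := by
    intro i hi l hl c hc u hu
    rw [← hσ₃, sem_fill_eq σ₂ (Function.update (Function.update (Function.update
      (Function.update ρ 10 i) 11 l) 12 c) 13 u)]
    · simp only [Term.eval, IndexExpr.eval, List.map_cons, List.map_nil]
      rw [coord_basisElt_mul, hm _ (by simpa using hρ)]
      refine Finset.sum_congr rfl fun x hx => ?_
      rw [Finset.mem_range] at hx
      simp [f₂, hJ i hi c hc x hx, htab u hu x hx l hl]
    · decide
    · simp [Term.Reads]
    · simp [Term.Reads]
    · exact ⟨i, by simp [hlen, hρ, hi], l, by simp [hm, hρ, hl], c, by simp [hr, hρ, hc], u,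
        by simp [hm, hρ, hu], rfl⟩
    · simp [IndexExpr.eval, ha, hb, hρ]
    · intro ρ' h'
      have := h'.sameParams (by simp) hρ
      simp [IndexExpr.eval, ha, hb, this]
  have s₃' : ∀ i l c u, c < a + b → σ₃ [system, i, l, c, u] = σ₂ [system, i, l, c, u] := by
    intro i l c u hc
    rw [← hσ₃, sem_fill_of_ne (by decide) (by simp [Term.Reads]) (by simp [Term.Reads])]
    intro ρ' h'
    have := h'.sameParams (by simp) hρ
    simp [IndexExpr.eval, ha, hb, this]
    omega
  have s : ∀ i < len, ∀ l < m, ∀ c < a + b + r, ∀ u < m, σ₃ [system, i, l, c, u] =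
      coord e (basisElt e u * relationColumn φ a b y h J i c) l := by
    intro i hi l hl c hc u hu
    unfold relationColumn
    split_ifs with h1 h2
    · rw [s₃' i l c u (by omega), s₂' i hi l hl c h1 u hu]
    · obtain ⟨c, rfl⟩ := Nat.exists_eq_add_of_le (not_lt.1 h1)
      rw [s₃' i l _ u h2, s₂ i hi l hl c (by omega) u hu, Nat.add_sub_cancel_left]
    · obtain ⟨c, rfl⟩ := Nat.exists_eq_add_of_le (not_lt.1 h2)
      rw [s₃ i hi l hl c (by omega) u hu, Nat.add_sub_cancel_left]
  have hrel : ∀ (W : ℕ → A) (i : ℕ), i < len → ∀ l < m,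
      coord e (∑ c ∈ Finset.range (a + b + r), W c * relationColumn φ a b y h J i c) l =
      sum₂ (a + b + r) m (fun c u => σ₃ [system, i, l, c, u] * coord e (W c) u) := by
    intro W i hi l hl
    rw [coord_sum_mul]
    exact sum₂_congr fun c hc u hu => by rw [s i hi l hl c hc u hu]
  have hcols : ∃ c < a + b + r, ∃ u < m, ∃ d < a + b + r, ∃ w < m, σ₄ [kernel, c, u, d, w] ≠ 0 := by
    by_contra! hz
    obtain ⟨W, ⟨c, hc, hW⟩, hW'⟩ := hex
    obtain ⟨x, hx⟩ := hk.span (fun c u => coord e (W c) u) fun i l hil => by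
      rw [← hrel W i hil.1 l hil.2, hW' i hil.1, coord_zero]
    apply hW
    refine eq_of_coord_eq e fun u hu => ?_
    rw [hx c hc u hu, coord_zero]
    exact Finset.sum_eq_zero fun d hd => Finset.sum_eq_zero fun w hw =>
      mul_eq_zero_of_left (hz c hc u hu d (Finset.mem_range.1 hd) w (Finset.mem_range.1 hw)) _
  have hpick : ∃ d < a + b + r, ∃ w < m, (∃ c < a + b + r, ∃ u < m, σ₄ [kernel, c, u, d, w] ≠ 0) ∧
      ∀ f : ℕ → ℕ → F, lastValue (fun i => lastValue (fun j =>
        lastValue (fun d => lastValue (fun w => σ₄ [kernel, i, j, d, w]) (fun _ => 1) m)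
          (fun d => lastValue (fun w => σ₄ [kernel, i, j, d, w]) (fun _ => 1) m) (a + b + r))
            (fun _ => 1) m) (fun i => lastValue (fun j =>
        lastValue (fun d => lastValue (fun w => σ₄ [kernel, i, j, d, w]) (fun _ => 1) m)
          (fun d => lastValue (fun w => σ₄ [kernel, i, j, d, w]) (fun _ => 1) m) (a + b + r))
        (fun j => lastValue (fun d => lastValue (fun w => σ₄ [kernel, i, j, d, w]) (fun _ => 1) m)
          (fun d => lastValue (fun w => σ₄ [kernel, i, j, d, w]) (fun w => f d w) m) (a + b + r)) m)
          (a + b + r) = f d w := by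
    rcases lastValue_lastValue_spec (a + b + r) m (fun i j =>
        lastValue (fun d => lastValue (fun w => σ₄ [kernel, i, j, d, w]) (fun _ => 1) m)
          (fun d => lastValue (fun w => σ₄ [kernel, i, j, d, w]) (fun _ => 1) m) (a + b + r))
      with ⟨h1, -⟩ | ⟨i, hi, j, hj, h1, h2⟩
    · obtain ⟨c, hc, u, hu, d, hd, w, hw, hne⟩ := hcols
      rcases lastValue_lastValue_spec (a + b + r) m (fun d w => σ₄ [kernel, c, u, d, w])
        with ⟨h3, -⟩ | ⟨d', hd', w', hw', h3, h4⟩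
      · exact absurd (h3 d hd w hw) hne
      · exact absurd ((h4 fun _ _ => 1).symm.trans (h1 c hc u hu)) one_ne_zero
    · rcases lastValue_lastValue_spec (a + b + r) m (fun d w => σ₄ [kernel, i, j, d, w])
        with ⟨-, h3⟩ | ⟨d', hd', w', hw', h3, h4⟩
      · exact absurd (h3 fun _ _ => 1) h1
      · exact ⟨d', hd', w', hw', ⟨i, hi, j, hj, h3⟩, fun f =>
          (h2 fun i j => lastValue (fun d => lastValue (fun w => σ₄ [kernel, i, j, d, w])
            (fun _ => 1) m) (fun d => lastValue (fun w => σ₄ [kernel, i, j, d, w])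
              (fun w => f d w) m) (a + b + r)).trans (h4 f)⟩
  obtain ⟨d, hd, w, hw, ⟨c₀, hc₀, u₀, hu₀, hne⟩, hpick⟩ := hpick
  have hW : ∀ c, ∀ u < m, coord e (ofCoord e fun u => σ₄ [kernel, c, u, d, w]) u =
      σ₄ [kernel, c, u, d, w] := fun c u hu => coord_ofCoord e _ hu
  refine ⟨fun c => ofCoord e fun u => σ₄ [kernel, c, u, d, w], ⟨⟨c₀, hc₀, fun h0 => hne ?_⟩,
    fun i hi => eq_of_coord_eq e fun l hl => ?_⟩, fun c hc' u hu => ?_⟩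
  · rw [← hW c₀ u₀ hu₀, show ofCoord e _ = 0 from h0, coord_zero]
  · rw [hrel _ i hi l hl, coord_zero, ← hk.mem i l ⟨hi, hl⟩ d hd w hw]
    exact sum₂_congr fun c hc u hu => by rw [hW c u hu]
  · rw [sem_fill_eq σ₄ (Function.update (Function.update ρ 10 c) 11 u)]
    · rw [hW c u hu, ← hpick fun d w => σ₄ [kernel, c, u, d, w]]
      have hc2 : ∀ ρ, SameParams ρ₀ ρ → IndexExpr.eval ρ ((aE.add bE).add rE) = a + b + r := hc
      simp only [Term.last₂, Term.eval, List.map_cons, List.map_nil, hc2, hm, sameParams_update, hρ,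
        Nat.reduceLeDiff]
      simp [IndexExpr.eval]
    · decide
    · simp [Term.Reads, Term.last₂]
    · simp [Term.Reads, Term.last₂]
    · exact ⟨c, by simpa only [hc ρ hρ] using hc', u, by simp [hm, hρ, hu], rfl⟩
    · simp [IndexExpr.eval]
    · intro ρ' _; simp [IndexExpr.eval]

end Decoder

/-! ### Correctness of the recovery of the message -/

section Decoder

open Program Term Arrays

variable {F A : Type*} [Field F] [Field A] [Algebra F A] {m : ℕ} (e : Module.Basis (Fin m) F A)
variable {ρ₀ ρ : ℕ → ℕ} {mE lenE aE bE RE : IndexExpr} {len a b R : ℕ}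

theorem coord_skewPoly (φ : A →ₗ[F] A) (W : ℕ → A) (d : ℕ) (x : A) (l : ℕ) :
    coord e (skewPoly φ W d x) l = ∑ t ∈ Finset.range d, ∑ u ∈ Finset.range m,
      ∑ w ∈ Finset.range m, coord e (W t) u * coord e ((φ ^ t) x) w *
        coord e (basisElt e u * basisElt e w) l := by
  rw [skewPoly_apply, coord_sum]
  exact Finset.sum_congr rfl fun t _ => coord_mul e _ _ _

/-- The true message with τ = 1 is a solution, so some column of the kernel has τ ≠ 0. By uniqueness
that column is τ times the message. -/
theorem messageProgram_spec (hm : mE.Denotes ρ₀ m) (hlen : lenE.Denotes ρ₀ len)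
    (ha : aE.Denotes ρ₀ a) (hb : bE.Denotes ρ₀ b) (hR : RE.Denotes ρ₀ R) (hρ : SameParams ρ₀ ρ)
    (hm0 : 0 < m) (σ : Memory F) (φ : A →ₗ[F] A) (h : ℕ → A) (H : ℕ → ℕ → A) (W x : ℕ → A)
    (htab : ∀ u < m, ∀ w < m, ∀ l < m,
      σ [table, u, w, l] = coord e (basisElt e u * basisElt e w) l)
    (hpow : ∀ t < max a b, ∀ u < m, ∀ l < m,
      σ [frobPow, t, u, l] = coord e ((φ ^ t) (basisElt e u)) l)
    (hh : ∀ i < len, ∀ l < m, σ [points, i, l] = coord e (h i) l)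
    (hH : ∀ i < len, ∀ j < R, ∀ l < m, σ [generator, i, j, l] = coord e (H i j) l)
    (hW : ∀ c < a + b, ∀ u < m, σ [coeffs, c, u] = coord e (W c) u)
    (hx : ∀ i < len, skewPoly φ W a (∑ j ∈ Finset.range R, x j * H i j) +
      skewPoly φ (fun t => W (a + t)) b (h i) = 0)
    (huniq : ∀ (x' : ℕ → A) (τ : F), (∀ i < len,
      skewPoly φ W a (∑ j ∈ Finset.range R, x' j * H i j) +
        τ • skewPoly φ (fun t => W (a + t)) b (h i) = 0) → ∀ j < R, x' j = τ • x j) :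
    ∀ j < R, ∀ l < m, (messageProgram mE lenE aE bE RE).sem ρ σ [message, j, l] =
      coord e (x j) l := by
  have hc := hR.add (IndexExpr.denotes_const (ρ₀ := ρ₀) 1)
  unfold messageProgram
  simp only [sem_seq]
  generalize hσ₁ : (fill [(10, mE), (11, mE)] errorMap _ _).sem ρ σ = σ₁
  generalize hσ₂ : (fill [(10, mE), (11, mE)] codeMap _ _).sem ρ σ₁ = σ₂
  generalize hσ₃ : (fill [(10, lenE), (11, mE), (12, RE), (13, mE)] system _ _).sem ρ σ₂ = σ₃
  generalize hσ₄ : (fill [(10, lenE), (11, mE), (13, mE)] system _ _).sem ρ σ₃ = σ₄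
  generalize hσ₅ : (fill [(10, lenE), (11, mE)] system _ _).sem ρ σ₄ = σ₅
  have hk := kernelProgram_spec hlen hm hc hm hρ σ₅
  generalize hσ₆ : (kernelProgram lenE mE _ mE).sem ρ σ₅ = σ₆ at *
  unfold IndexExpr.Denotes at *
  have f₁ : ∀ n ≠ scratch, n ≠ errorMap → ∀ x, σ₁ (n :: x) = σ (n :: x) := fun n h1 h2 x => by
    rw [← hσ₁, sem_of_noWrite (noWrite_fill h1.symm h2.symm)]
  have f₂ : ∀ n ≠ scratch, n ≠ codeMap → ∀ x, σ₂ (n :: x) = σ₁ (n :: x) := fun n h1 h2 x => by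
    rw [← hσ₂, sem_of_noWrite (noWrite_fill h1.symm h2.symm)]
  have f₃ : ∀ n ≠ scratch, n ≠ system → ∀ x, σ₃ (n :: x) = σ₂ (n :: x) := fun n h1 h2 x => by
    rw [← hσ₃, sem_of_noWrite (noWrite_fill h1.symm h2.symm)]
  have f₄ : ∀ n ≠ scratch, n ≠ system → ∀ x, σ₄ (n :: x) = σ₂ (n :: x) := fun n h1 h2 x => by
    rw [← hσ₄, sem_of_noWrite (noWrite_fill h1.symm h2.symm), f₃ n h1 h2]
  set V := skewPoly φ W a
  set N := skewPoly φ (fun t => W (a + t)) b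
  have sV : ∀ w < m, ∀ l < m, σ₁ [errorMap, w, l] = coord e (V (basisElt e w)) l := by
    intro w hw l hl
    rw [← hσ₁, sem_fill_eq σ (Function.update (Function.update ρ 10 w) 11 l)]
    · simp only [V, Term.eval, IndexExpr.eval, List.map_cons, List.map_nil, coord_skewPoly]
      simp only [sameParams_update, hρ, hm, ha, Nat.reduceLeDiff]
      refine Finset.sum_congr rfl fun t ht => Finset.sum_congr rfl fun u hu =>
        Finset.sum_congr rfl fun v hv => ?_
      rw [Finset.mem_range] at ht hu hv
      simp [hW t (by omega) u hu, hpow t (lt_max_of_lt_left ht) w hw v hv, htab u hu v hv l hl]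
    · decide
    · simp [Term.Reads]
    · simp [Term.Reads]
    · exact ⟨w, by simp [hm, hρ, hw], l, by simp [hm, hρ, hl], rfl⟩
    · simp [IndexExpr.eval]
    · intro ρ' _; simp [IndexExpr.eval]
  have sN : ∀ w < m, ∀ l < m, σ₂ [codeMap, w, l] = coord e (N (basisElt e w)) l := by
    intro w hw l hl
    rw [← hσ₂, sem_fill_eq σ₁ (Function.update (Function.update ρ 10 w) 11 l)]
    · simp only [N, Term.eval, IndexExpr.eval, List.map_cons, List.map_nil, coord_skewPoly]
      simp only [sameParams_update, hρ, hm, ha, hb, Nat.reduceLeDiff]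
      refine Finset.sum_congr rfl fun t ht => Finset.sum_congr rfl fun u hu =>
        Finset.sum_congr rfl fun v hv => ?_
      rw [Finset.mem_range] at ht hu hv
      simp [f₁, hW (a + t) (by omega) u hu, hpow t (lt_max_of_lt_right ht) w hw v hv,
        htab u hu v hv l hl]
    · decide
    · simp [Term.Reads]
    · simp [Term.Reads]
    · exact ⟨w, by simp [hm, hρ, hw], l, by simp [hm, hρ, hl], rfl⟩
    · simp [IndexExpr.eval]
    · intro ρ' _; simp [IndexExpr.eval]
  have s₃ : ∀ i < len, ∀ l < m, ∀ c < R, ∀ u < m, σ₃ [system, i, l, c, u] =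
      coord e (V (basisElt e u * H i c)) l := by
    intro i hi l hl c hc u hu
    rw [← hσ₃, sem_fill_eq σ₂ (Function.update (Function.update (Function.update
      (Function.update ρ 10 i) 11 l) 12 c) 13 u)]
    · simp only [Term.eval, IndexExpr.eval, List.map_cons, List.map_nil]
      rw [coord_linearMap]
      simp only [sameParams_update, hρ, hm, Nat.reduceLeDiff]
      refine Finset.sum_congr rfl fun x hx => ?_
      rw [coord_basisElt_mul]
      rw [Finset.mem_range] at hx
      congr 1
      · refine Finset.sum_congr rfl fun w hw => ?_
        rw [Finset.mem_range] at hw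
        simp [f₁, f₂, hH i hi c hc w hw, htab u hu w hw x hx]
      · simp [f₂, sV x hx l hl]
    · decide
    · simp [Term.Reads]
    · simp [Term.Reads]
    · exact ⟨i, by simp [hlen, hρ, hi], l, by simp [hm, hρ, hl], c, by simp [hR, hρ, hc], u,
        by simp [hm, hρ, hu], rfl⟩
    · simp [IndexExpr.eval]
    · intro ρ' _; simp [IndexExpr.eval]
  have s₅ : ∀ i < len, ∀ l < m, ∀ c < R, ∀ u < m, σ₅ [system, i, l, c, u] =
      coord e (V (basisElt e u * H i c)) l := by
    intro i hi l hl c hc u hu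
    rw [← s₃ i hi l hl c hc u hu, ← hσ₅, sem_fill_of_ne (by decide) (by simp [Term.Reads])
      (by simp [Term.Reads]), ← hσ₄, sem_fill_of_ne (by decide) (by simp [Term.Reads])
      (by simp [Term.Reads])]
    · intro ρ' h'
      have := h'.sameParams (by simp) hρ
      simp [IndexExpr.eval, hR, this]
      omega
    · intro ρ' h'
      have := h'.sameParams (by simp) hρ
      simp [IndexExpr.eval, hR, this]
      omega
  have s₅' : ∀ i < len, ∀ l < m, ∀ u < m, σ₅ [system, i, l, R, u] =
      if u = 0 then coord e (N (h i)) l else 0 := by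
    intro i hi l hl u hu
    split_ifs with hu0
    · subst hu0
      rw [← hσ₅, sem_fill_eq σ₄ (Function.update (Function.update ρ 10 i) 11 l)]
      · simp only [Term.eval, IndexExpr.eval, List.map_cons, List.map_nil]
        rw [coord_linearMap]
        simp only [sameParams_update, hρ, hm, Nat.reduceLeDiff]
        refine Finset.sum_congr rfl fun x hx => ?_
        rw [Finset.mem_range] at hx
        simp [f₁, f₂, f₄, hh i hi x hx, sN x hx l hl]
      · decide
      · simp [Term.Reads]
      · simp [Term.Reads]
      · exact ⟨i, by simp [hlen, hρ, hi], l, by simp [hm, hρ, hl], rfl⟩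
      · simp [IndexExpr.eval, hR, hρ]
      · intro ρ' _; simp +contextual [IndexExpr.eval]
    · rw [← hσ₅, sem_fill_of_ne (by decide) (by simp [Term.Reads]) (by simp [Term.Reads]), ← hσ₄,
        sem_fill_eq σ₃ (Function.update (Function.update (Function.update ρ 10 i) 11 l) 13 u)]
      · simp [Term.eval]
      · decide
      · simp [Term.Reads]
      · simp [Term.Reads]
      · exact ⟨i, by simp [hlen, hρ, hi], l, by simp [hm, hρ, hl], u, by simp [hm, hρ, hu], rfl⟩
      · simp [IndexExpr.eval, hR, hρ]
      · intro ρ' _; simp +contextual [IndexExpr.eval]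
      · intro ρ' _
        simp [IndexExpr.eval, Ne.symm hu0]
  have hrel : ∀ w : ℕ → ℕ → F, ∀ i < len, ∀ l < m,
      sum₂ (R + 1) m (fun c u => σ₅ [system, i, l, c, u] * w c u) =
        coord e (V (∑ c ∈ Finset.range R, ofCoord e (w c) * H i c) + w R 0 • N (h i)) l := by
    intro w i hi l hl
    rw [sum₂, Finset.sum_range_succ, coord_add, map_sum, coord_sum, coord_smul]
    congr 1
    · refine Finset.sum_congr rfl fun c hc => ?_
      rw [← LinearMap.mulRight_apply (R := F), ← LinearMap.comp_apply, coord_linearMap]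
      refine Finset.sum_congr rfl fun u hu => ?_
      rw [Finset.mem_range] at hc hu
      rw [s₅ i hi l hl c hc u hu, coord_ofCoord e _ hu, mul_comm, LinearMap.comp_apply,
        LinearMap.mulRight_apply]
    · rw [Finset.sum_eq_single 0]
      · rw [s₅' i hi l hl 0 hm0, if_pos rfl, mul_comm]
      · intro u hu hu0
        rw [s₅' i hi l hl u (Finset.mem_range.1 hu), if_neg hu0, zero_mul]
      · intro h0
        exact absurd (Finset.mem_range.2 hm0) h0
  have hcol : ∃ d < R + 1, ∃ w < m, σ₆ [kernel, R, 0, d, w] ≠ 0 := by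
    by_contra! hz
    obtain ⟨y, hy⟩ := hk.span (fun c u => if c < R then coord e (x c) u else 1) fun i l hil => by
      rw [hrel _ i hil.1 l hil.2]
      have h1 : ∑ c ∈ Finset.range R, ofCoord e (fun u => if c < R then coord e (x c) u else 1) *
          H i c = ∑ c ∈ Finset.range R, x c * H i c := Finset.sum_congr rfl fun c hc => by
        simp only [Finset.mem_range.1 hc, if_true]
        rw [ofCoord_coord]
      simp only [lt_irrefl, if_false, one_smul]
      rw [h1, hx i hil.1, coord_zero]
    have h1 := hy R (by omega) 0 hm0
    simp only [lt_irrefl, if_false] at h1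
    refine one_ne_zero (h1.trans ?_)
    exact Finset.sum_eq_zero fun d hd => Finset.sum_eq_zero fun w hw =>
      mul_eq_zero_of_left (hz d (Finset.mem_range.1 hd) w (Finset.mem_range.1 hw)) _
  intro j hj l hl
  rcases lastValue_lastValue_spec (R + 1) m (fun d w => σ₆ [kernel, R, 0, d, w])
    with ⟨h1, -⟩ | ⟨d, hd, w, hw, h1, h2⟩
  · obtain ⟨d, hd, w, hw, h3⟩ := hcol
    exact absurd (h1 d hd w hw) h3
  have h3 := huniq (fun c => ofCoord e fun u => σ₆ [kernel, c, u, d, w]) (σ₆ [kernel, R, 0, d, w])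
    (fun i hi => eq_of_coord_eq e fun l hl => by
      rw [← hrel (fun c u => σ₆ [kernel, c, u, d, w]) i hi l hl, coord_zero]
      exact hk.mem i l ⟨hi, hl⟩ d hd w hw) j hj
  rw [sem_fill_eq σ₆ (Function.update (Function.update ρ 10 j) 11 l)]
  · have hc2 : ∀ ρ, SameParams ρ₀ ρ → IndexExpr.eval ρ (RE.add (IndexExpr.const 1)) = R + 1 := hc
    have h4 := h2 fun d w => σ₆ [kernel, j, l, d, w] * (σ₆ [kernel, R, 0, d, w])⁻¹
    have h5 : coord e (x j) l = σ₆ [kernel, j, l, d, w] * (σ₆ [kernel, R, 0, d, w])⁻¹ := by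
      rw [← coord_ofCoord e (fun u => σ₆ [kernel, j, u, d, w]) hl, h3, coord_smul]
      field_simp
    rw [h5, ← h4]
    simp only [Term.last₂, Term.eval, List.map_cons, List.map_nil, hc2, hm, hR, sameParams_update,
      hρ, Nat.reduceLeDiff]
    simp [IndexExpr.eval]
  · decide
  · simp [Term.Reads, Term.last₂]
  · simp [Term.Reads, Term.last₂]
  · exact ⟨j, by simp [hR, hρ, hj], l, by simp [hm, hρ, hl], rfl⟩
  · simp [IndexExpr.eval]
  · intro ρ' _; simp [IndexExpr.eval]

end Decoder

/-! ### Decoding Gabidulin codes with interference -/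

section SkewPoly

variable {k A : Type*} [Field k] [Field A] [Algebra k A] {φ : A →ₗ[k] A}

theorem skewPoly_congr {c c' : ℕ → A} {d : ℕ} (h : ∀ t < d, c t = c' t) :
    skewPoly φ c d = skewPoly φ c' d := by
  ext x
  rw [skewPoly_apply, skewPoly_apply]
  exact Finset.sum_congr rfl fun t ht => by rw [h t (Finset.mem_range.1 ht)]

theorem frobenius_pow_apply {q : ℕ} (hφ : ∀ x, φ x = x ^ q) (t : ℕ) (x : A) :
    (φ ^ t) x = x ^ q ^ t := by
  induction t with
  | zero => simp
  | succ t ih => rw [pow_succ', Module.End.mul_apply, ih, hφ, ← pow_mul, ← pow_succ]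

/-- A nonzero linearized polynomial with `d` coefficients does not vanish on a subspace of dimension
at least `d`. -/
theorem eq_zero_of_skewPoly_eq_zero [Finite k] [FiniteDimensional k A]
    (hφ : ∀ x, φ x = x ^ Nat.card k) {c : ℕ → A} {d : ℕ} (U : Submodule k A)
    (hU : d ≤ Module.finrank k U) (h : ∀ x ∈ U, skewPoly φ c d x = 0) : ∀ t < d, c t = 0 := by
  classical
  have : Finite A := Module.finite_of_finite k
  have : Fintype U := Fintype.ofFinite U
  have hq : 1 < Nat.card k := Finite.one_lt_card
  set q := Nat.card k
  let P : Polynomial A := ∑ t ∈ Finset.range d, Polynomial.C (c t) * Polynomial.X ^ q ^ t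
  have hcard : (Finset.univ.map (Function.Embedding.subtype (· ∈ U)) : Finset A).card
      = q ^ Module.finrank k U := by
    rw [Finset.card_map, Finset.card_univ, ← Nat.card_eq_fintype_card,
      Module.natCard_eq_pow_finrank (K := k)]
  -- The degree is below |k|^d, which is at most the number of elements of `U`, and all of these are
  -- roots.
  have hP : P = 0 := by
    refine Polynomial.eq_zero_of_degree_lt_of_eval_finset_eq_zero
      (Finset.univ.map (Function.Embedding.subtype (· ∈ U))) ?_ ?_
    · rw [hcard, ← Polynomial.mem_degreeLT]
      refine Submodule.sum_mem _ fun t ht => ?_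
      rw [Polynomial.mem_degreeLT]
      refine (Polynomial.degree_C_mul_X_pow_le _ _).trans_lt ?_
      exact_mod_cast Nat.pow_lt_pow_right hq ((Finset.mem_range.1 ht).trans_le hU)
    · intro x hx
      simp only [Finset.mem_map, Finset.mem_univ, true_and, Function.Embedding.subtype_apply,
        Subtype.exists, exists_prop, exists_eq_right] at hx
      rw [← h x hx, skewPoly_apply, Polynomial.eval_finsetSum]
      simp [frobenius_pow_apply hφ]
  intro t ht
  have h1 : P.coeff (q ^ t) = c t := by
    simp only [P, Polynomial.finsetSum_coeff, Polynomial.coeff_C_mul, Polynomial.coeff_X_pow]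
    rw [Finset.sum_eq_single t]
    · simp
    · intro s _ hs
      rw [if_neg, mul_zero]
      exact fun h => hs (Nat.pow_right_injective hq h.symm)
    · intro h; exact absurd (Finset.mem_range.2 ht) h
  rw [← h1, hP, Polynomial.coeff_zero]

/-- Frobenius is multiplicative, so moving it past a coefficient only replaces the coefficient by
its Frobenius image; q-degrees add as for ordinary polynomials, which leaves (z + 1) + R - 1
coefficients. -/
theorem exists_skewPoly_comp (hφ : ∀ x, φ x = x ^ Nat.card k) (v f : ℕ → A) (z R : ℕ) :
    ∃ g : ℕ → A, ∀ x, skewPoly φ v (z + 1) (skewPoly φ f R x) = skewPoly φ g (R + z) x := by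
  classical
  refine ⟨fun s => ∑ t ∈ Finset.range (z + 1), ∑ j ∈ Finset.range R,
    if j + t = s then v t * (φ ^ t) (f j) else 0, fun x => ?_⟩
  rw [skewPoly_apply, skewPoly_apply, skewPoly_apply]
  simp only [map_sum, Finset.mul_sum, Finset.sum_mul]
  rw [Finset.sum_comm]
  rw [Finset.sum_comm (s := Finset.range (R + z))]
  rw [Finset.sum_comm]
  refine Finset.sum_congr rfl fun t ht => ?_
  rw [Finset.sum_comm (s := Finset.range (R + z))]
  refine Finset.sum_congr rfl fun j hj => ?_
  rw [Finset.mem_range] at ht hj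
  rw [Finset.sum_eq_single (j + t)]
  · simp only [if_true, frobenius_pow_apply hφ, mul_pow]
    ring
  · intro s _ hs
    rw [if_neg hs.symm, zero_mul]
  · intro h
    exact absurd (Finset.mem_range.2 (by omega)) h

/-- Vanishing on a basis of `S` is at most z linear conditions over A on z + 1 coefficients, and
k-linearity extends it to all of `S`. -/
theorem exists_skewPoly_eq_zero [FiniteDimensional k A] (S : Submodule k A) {z : ℕ}
    (hS : Module.finrank k S ≤ z) :
    ∃ v : ℕ → A, (∃ t < z + 1, v t ≠ 0) ∧ ∀ s ∈ S, skewPoly φ v (z + 1) s = 0 := by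
  let b := Module.finBasis k S
  let M : Matrix (Fin (Module.finrank k S)) (Fin (z + 1)) A :=
    Matrix.of fun s t => (φ ^ (t : ℕ)) (b s)
  have hker : LinearMap.ker M.mulVecLin ≠ ⊥ :=
    LinearMap.ker_ne_bot_of_finrank_lt (by simpa using Nat.lt_succ_of_le hS)
  obtain ⟨w, hw, hw0⟩ := Submodule.exists_mem_ne_zero_of_ne_bot hker
  have hpad : ∀ t : Fin (z + 1), padZero w t = w t := fun t => dif_pos t.2
  refine ⟨padZero w, ?_, fun s hs => ?_⟩
  · obtain ⟨t, ht⟩ := Function.ne_iff.1 hw0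
    exact ⟨t, t.2, by rw [hpad]; exact ht⟩
  · have hb : ∀ i, skewPoly φ (padZero w) (z + 1) (b i) = 0 := by
      intro i
      have := congrFun (LinearMap.mem_ker.1 hw) i
      rw [skewPoly_apply, Finset.sum_range]
      simp only [hpad]
      rw [← show (M.mulVecLin w) i = 0 from this, Matrix.mulVecLin_apply]
      exact Finset.sum_congr rfl fun t _ => mul_comm _ _
    have : (skewPoly φ (padZero w) (z + 1)) ∘ₗ S.subtype = 0 := b.ext fun i => hb i
    exact LinearMap.congr_fun this ⟨s, hs⟩

/-- Restricting to the kernel of `g` costs at most rank g dimensions in the image of `f`: apply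
rank–nullity to `g`, to `f` and to the restriction of `f`, whose kernel embeds in that of `f`. -/
theorem finrank_le_finrank_map_ker {M N P : Type*} [AddCommGroup M] [Module k M] [AddCommGroup N]
    [Module k N] [AddCommGroup P] [Module k P] [FiniteDimensional k M] [FiniteDimensional k N]
    (f : M →ₗ[k] N) (g : M →ₗ[k] P) (hf : Function.Surjective f) :
    Module.finrank k N ≤ Module.finrank k ((LinearMap.ker g).map f) +
      Module.finrank k (LinearMap.range g) := by
  have h1 := LinearMap.finrank_range_add_finrank_ker g
  have h2 := LinearMap.finrank_range_add_finrank_ker f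
  have h3 := LinearMap.finrank_range_add_finrank_ker (f.domRestrict (LinearMap.ker g))
  rw [LinearMap.range_eq_top.2 hf, finrank_top] at h2
  rw [LinearMap.range_domRestrict] at h3
  have h4 : Module.finrank k (LinearMap.ker (f.domRestrict (LinearMap.ker g))) ≤
      Module.finrank k (LinearMap.ker f) := by
    refine LinearMap.finrank_le_finrank_of_injective
      (f := ((LinearMap.ker g).subtype.comp (LinearMap.ker (f.domRestrict _)).subtype).codRestrict
        (LinearMap.ker f) fun x => x.2) ?_
    intro x y hxy
    have h := congrArg (LinearMap.ker f).subtype hxy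
    exact Subtype.ext (Subtype.ext h)
  omega

/-- A received word `y`: a codeword with the points `h` and the generator matrix `H`, interference
with the coefficients `κ`, and an error of small rank. -/
structure ReceivedWord (φ : A →ₗ[k] A) (len R r z : ℕ) (h : ℕ → A) (H : ℕ → ℕ → A)
    (κ : ℕ → ℕ → k) (y x : ℕ → A) : Prop where
  frob : ∀ x, φ x = x ^ Nat.card k
  finrank : Module.finrank k A = R + 2 * z
  eq : ∃ (w ε : ℕ → A) (S : Submodule k A), Module.finrank k S ≤ z ∧ (∀ i < len, ε i ∈ S) ∧
    ∀ i < len, y i = ∑ j ∈ Finset.range R, x j * H i j + ∑ j ∈ Finset.range r, κ i j • w j + ε i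
  code : ∀ x' : ℕ → A, ∃ f : ℕ → A, ∀ i < len,
    ∑ j ∈ Finset.range R, x' j * H i j = skewPoly φ f R (h i)
  code_injective : ∀ x' : ℕ → A, (∀ i < len, ∑ j ∈ Finset.range R, x' j * H i j = 0) →
    ∀ j < R, x' j = 0
  nuisance_injective : ∀ u : ℕ → A, (∀ i < len, ∑ j ∈ Finset.range r, κ i j • u j = 0) →
    ∀ j < r, u j = 0
  surjective : ∀ a : A, ∃ c : ℕ → k, (∀ j < r, ∑ i ∈ Finset.range len, c i * κ i j = 0) ∧
    ∑ i ∈ Finset.range len, c i • h i = a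

namespace ReceivedWord

variable {len R r z : ℕ} {h : ℕ → A} {H : ℕ → ℕ → A} {κ : ℕ → ℕ → k} {y x : ℕ → A}

/-- Take V annihilating the error space and N = -V∘f. By k-linearity V maps the interference ∑ κ_ij
w_j to ∑ κ_ij V(w_j), which the constants -V(w_j)β⁻¹ cancel; this is what β ≠ 0 is for. -/
theorem exists_relation [FiniteDimensional k A] (hw : ReceivedWord φ len R r z h H κ y x) {β : A}
    (hβ : β ≠ 0) :
    ∃ W : ℕ → A, (∃ c < z + 1 + (R + z) + r, W c ≠ 0) ∧ ∀ i < len,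
      ∑ c ∈ Finset.range (z + 1 + (R + z) + r), W c *
        relationColumn φ (z + 1) (R + z) y h (fun i j => κ i j • β) i c = 0 := by
  obtain ⟨w, ε, S, hS, hε, hy⟩ := hw.eq
  obtain ⟨v, ⟨t, ht, hv⟩, hvS⟩ := exists_skewPoly_eq_zero (φ := φ) S hS
  obtain ⟨f, hf⟩ := hw.code x
  obtain ⟨g, hg⟩ := exists_skewPoly_comp hw.frob v f z R
  let W : ℕ → A := fun c => if c < z + 1 then v c else if c < z + 1 + (R + z) then -g (c - (z + 1))
    else -(skewPoly φ v (z + 1) (w (c - (z + 1 + (R + z)))) * β⁻¹)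
  refine ⟨W, ⟨t, by omega, by simpa only [W, if_pos ht] using hv⟩, fun i hi => ?_⟩
  have h1 : skewPoly φ W (z + 1) = skewPoly φ v (z + 1) :=
    skewPoly_congr fun t ht => by simp only [W, if_pos ht]
  have h2 : skewPoly φ (fun t => W (z + 1 + t)) (R + z) = skewPoly φ (fun t => -g t) (R + z) :=
    skewPoly_congr fun t ht => by
      simp only [W]
      rw [if_neg (by omega), if_pos (by omega), Nat.add_sub_cancel_left]
  have h3 : ∀ j, W (z + 1 + (R + z) + j) = -(skewPoly φ v (z + 1) (w j) * β⁻¹) := fun j => by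
    simp only [W]
    rw [if_neg (by omega), if_neg (by omega), Nat.add_sub_cancel_left]
  have h4 : skewPoly φ (fun t => -g t) (R + z) (h i) = -skewPoly φ g (R + z) (h i) := by
    simp [skewPoly_apply]
  rw [sum_relationColumn, h1, h2, h4, ← hg, ← hf i hi, hy i hi, map_add, map_add,
    hvS _ (hε i hi), map_sum (skewPoly φ v (z + 1)) (fun j => κ i j • w j)]
  have h5 : ∑ j ∈ Finset.range r, W (z + 1 + (R + z) + j) * κ i j • β =
      -∑ j ∈ Finset.range r, skewPoly φ v (z + 1) (κ i j • w j) := by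
    rw [← Finset.sum_neg_distrib]
    refine Finset.sum_congr rfl fun j _ => ?_
    rw [h3, map_smul, mul_smul_comm, neg_mul, inv_mul_cancel_right₀ hβ, smul_neg]
  rw [h5]
  ring

/-- Combine the equations with scalars c that annihilate all interference columns and the error.
Then ∑ c_i y_i = f(∑ c_i h_i), and the relation says that V∘f + N vanishes at ∑ c_i h_i. These
points form a space of dimension at least R + z, too large for a nonzero polynomial with R + z
coefficients. -/
theorem skewPoly_eq [Finite k] [FiniteDimensional k A]
    (hw : ReceivedWord φ len R r z h H κ y x) {β : A} {W : ℕ → A}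
    (hW : ∀ i < len, ∑ c ∈ Finset.range (z + 1 + (R + z) + r), W c *
        relationColumn φ (z + 1) (R + z) y h (fun i j => κ i j • β) i c = 0)
    {f : ℕ → A} (hf : ∀ i < len, ∑ j ∈ Finset.range R, x j * H i j = skewPoly φ f R (h i)) (a : A) :
    skewPoly φ W (z + 1) (skewPoly φ f R a) + skewPoly φ (fun t => W (z + 1 + t)) (R + z) a = 0 := by
  obtain ⟨w, ε, S, hS, hε, hy⟩ := hw.eq
  obtain ⟨g, hg⟩ := exists_skewPoly_comp hw.frob W f z R
  -- `M` consists of the scalars that cancel the interference. On it `f₁` is the combination of the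
  -- code points, onto A by assumption, and `f₂` that of the errors, of rank at most z; the relevant
  -- points are the image under `f₁` of the kernel of `f₂`.
  let M : Submodule k (Fin len → k) := LinearMap.ker
    (LinearMap.pi fun j : Fin r => ∑ i : Fin len, κ i j • LinearMap.proj (R := k) (φ := fun _ => k) i)
  have hM : ∀ c : Fin len → k, c ∈ M ↔ ∀ j : Fin r, ∑ i : Fin len, c i * κ i j = 0 := by
    intro c
    rw [LinearMap.mem_ker, funext_iff]
    simp [mul_comm]
  let f₁ : M →ₗ[k] A := (Fintype.linearCombination k fun i : Fin len => h i) ∘ₗ M.subtype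
  let f₂ : M →ₗ[k] A := (Fintype.linearCombination k fun i : Fin len => ε i) ∘ₗ M.subtype
  have hf₁ : Function.Surjective f₁ := by
    intro a
    obtain ⟨c, hc, hca⟩ := hw.surjective a
    refine ⟨⟨fun i => c i, (hM _).2 fun j => ?_⟩, ?_⟩
    · rw [← hc j j.2, Finset.sum_range]
    · rw [← hca, Finset.sum_range]
      simp [f₁, Fintype.linearCombination_apply]
  have hf₂ : Module.finrank k (LinearMap.range f₂) ≤ z := by
    refine (Submodule.finrank_mono ?_).trans hS
    rintro _ ⟨c, rfl⟩
    simp only [f₂, LinearMap.comp_apply, Fintype.linearCombination_apply]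
    exact Submodule.sum_mem _ fun i _ => S.smul_mem _ (hε i i.2)
  have hdim := finrank_le_finrank_map_ker f₁ f₂ hf₁
  rw [hw.finrank] at hdim
  have hadd : ∀ a, skewPoly φ (fun t => g t + W (z + 1 + t)) (R + z) a =
      skewPoly φ W (z + 1) (skewPoly φ f R a) +
        skewPoly φ (fun t => W (z + 1 + t)) (R + z) a := fun a => by
    rw [hg]
    simp [skewPoly_apply, add_mul, Finset.sum_add_distrib]
  have hzero := eq_zero_of_skewPoly_eq_zero hw.frob (c := fun t => g t + W (z + 1 + t)) (d := R + z)
    ((LinearMap.ker f₂).map f₁) (by omega) ?_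
  · rw [← hadd, skewPoly_congr (c' := 0) hzero]
    simp [skewPoly_apply]
  · rintro _ ⟨⟨c, hcM⟩, hc₂, rfl⟩
    have hc := (hM c).1 hcM
    have hc₁ : f₁ ⟨c, hcM⟩ = ∑ i : Fin len, c i • h i := by
      simp [f₁, Fintype.linearCombination_apply]
    replace hc₂ : ∑ i : Fin len, c i • ε i = 0 := by
      have : f₂ ⟨c, hcM⟩ = 0 := hc₂
      simpa [f₂, Fintype.linearCombination_apply] using this
    rw [hadd, hc₁]
    have hκ : ∀ u : ℕ → A, ∑ i : Fin len, c i • ∑ j ∈ Finset.range r, κ i j • u j = 0 := by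
      intro u
      simp only [Finset.smul_sum, smul_smul]
      rw [Finset.sum_comm]
      refine Finset.sum_eq_zero fun j hj => ?_
      rw [← Finset.sum_smul, hc ⟨j, Finset.mem_range.1 hj⟩, zero_smul]
    have hsum : ∑ i : Fin len, c i • y i = skewPoly φ f R (∑ i : Fin len, c i • h i) := by
      rw [map_sum]
      simp only [map_smul]
      calc ∑ i : Fin len, c i • y i = ∑ i : Fin len, (c i • skewPoly φ f R (h i) +
            c i • ∑ j ∈ Finset.range r, κ i j • w j + c i • ε i) :=
            Finset.sum_congr rfl fun i _ => by rw [hy i i.2, hf i i.2, smul_add, smul_add]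
        _ = _ := by rw [Finset.sum_add_distrib, Finset.sum_add_distrib, hκ, hc₂, add_zero, add_zero]
    rw [← hsum, map_sum, map_sum, ← Finset.sum_add_distrib]
    have hκ' := hκ fun j => W (z + 1 + (R + z) + j) * β
    calc ∑ i : Fin len, (skewPoly φ W (z + 1) (c i • y i) +
          skewPoly φ (fun t => W (z + 1 + t)) (R + z) (c i • h i))
        = ∑ i : Fin len, c i • ∑ t ∈ Finset.range (z + 1 + (R + z) + r), W t *
            relationColumn φ (z + 1) (R + z) y h (fun i j => κ i j • β) i t
          - ∑ i : Fin len, c i • ∑ j ∈ Finset.range r, κ i j • (W (z + 1 + (R + z) + j) * β) := by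
          rw [← Finset.sum_sub_distrib]
          refine Finset.sum_congr rfl fun i _ => ?_
          rw [sum_relationColumn, ← smul_sub]
          simp only [mul_smul_comm, map_smul, add_sub_cancel_right, smul_add]
      _ = 0 := by
          rw [hκ', sub_zero]
          exact Finset.sum_eq_zero fun i _ => by rw [hW i i.2, smul_zero]

/-- If V = 0, then N = -V∘f is zero as a map, hence coefficientwise since R + z ≤ dim A, and the
remaining interference terms vanish by injectivity; the relation would be trivial. -/
theorem coeff_ne_zero [Finite k] [FiniteDimensional k A]
    (hw : ReceivedWord φ len R r z h H κ y x) {β : A} (hβ : β ≠ 0) {W : ℕ → A}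
    (hW0 : ∃ c < z + 1 + (R + z) + r, W c ≠ 0)
    (hW : ∀ i < len, ∑ c ∈ Finset.range (z + 1 + (R + z) + r), W c *
        relationColumn φ (z + 1) (R + z) y h (fun i j => κ i j • β) i c = 0) :
    ∃ t < z + 1, W t ≠ 0 := by
  by_contra! hz
  obtain ⟨f, hf⟩ := hw.code x
  have h1 : skewPoly φ W (z + 1) = 0 := by
    ext a
    rw [skewPoly_congr (c' := 0) hz]
    simp [skewPoly_apply]
  have h2 : ∀ a, skewPoly φ (fun t => W (z + 1 + t)) (R + z) a = 0 := fun a => by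
    have := hw.skewPoly_eq hW hf a
    rwa [h1, LinearMap.zero_apply, zero_add] at this
  have h3 := eq_zero_of_skewPoly_eq_zero hw.frob (c := fun t => W (z + 1 + t)) (d := R + z) ⊤
    (by rw [finrank_top, hw.finrank]; omega) fun a _ => h2 a
  have h4 := hw.nuisance_injective (fun j => W (z + 1 + (R + z) + j) * β) fun i hi => by
    have := hW i hi
    rw [sum_relationColumn, h1, h2, LinearMap.zero_apply, zero_add, zero_add] at this
    simpa only [mul_smul_comm] using this
  obtain ⟨c, hc, hWc⟩ := hW0
  apply hWc
  by_cases hc1 : c < z + 1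
  · exact hz c hc1
  by_cases hc2 : c < z + 1 + (R + z)
  · obtain ⟨c, rfl⟩ := Nat.exists_eq_add_of_le (not_lt.1 hc1)
    exact h3 c (by omega)
  · obtain ⟨c, rfl⟩ := Nat.exists_eq_add_of_le (not_lt.1 hc2)
    simpa [hβ] using h4 c (by omega)

/-- The polynomial f' of the difference x' - τx satisfies V∘f' = 0, first on the code points and
then everywhere because they span. As V ≠ 0 has z + 1 coefficients, its kernel has dimension at most
z, so f' has rank at most z. Its kernel then has dimension at least R + z, which is impossible for a
nonzero polynomial with R coefficients. -/
theorem message_unique [Finite k] [FiniteDimensional k A]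
    (hw : ReceivedWord φ len R r z h H κ y x) {β : A} (hβ : β ≠ 0) {W : ℕ → A}
    (hW0 : ∃ c < z + 1 + (R + z) + r, W c ≠ 0)
    (hW : ∀ i < len, ∑ c ∈ Finset.range (z + 1 + (R + z) + r), W c *
        relationColumn φ (z + 1) (R + z) y h (fun i j => κ i j • β) i c = 0)
    {x' : ℕ → A} {τ : k} (hx' : ∀ i < len, skewPoly φ W (z + 1) (∑ j ∈ Finset.range R, x' j * H i j) +
      τ • skewPoly φ (fun t => W (z + 1 + t)) (R + z) (h i) = 0) : ∀ j < R, x' j = τ • x j := by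
  obtain ⟨f, hf⟩ := hw.code x
  obtain ⟨f', hf'⟩ := hw.code fun j => x' j - τ • x j
  have h1 : ∀ i < len, skewPoly φ W (z + 1) (skewPoly φ f' R (h i)) = 0 := by
    intro i hi
    have h2 := hw.skewPoly_eq hW hf (h i)
    rw [← hf i hi] at h2
    rw [← hf' i hi]
    simp only [sub_mul, Finset.sum_sub_distrib, smul_mul_assoc, ← Finset.smul_sum, map_sub, map_smul]
    rw [eq_neg_of_add_eq_zero_left h2, eq_neg_of_add_eq_zero_left (hx' i hi)]
    simp
  have h2 : ∀ a, skewPoly φ W (z + 1) (skewPoly φ f' R a) = 0 := by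
    intro a
    obtain ⟨c, -, rfl⟩ := hw.surjective a
    simp only [map_sum, map_smul]
    exact Finset.sum_eq_zero fun i hi => by rw [h1 i (Finset.mem_range.1 hi), smul_zero]
  have h3 : Module.finrank k (LinearMap.ker (skewPoly φ W (z + 1))) ≤ z := by
    by_contra! hlt
    obtain ⟨t, ht, hWt⟩ := hw.coeff_ne_zero hβ hW0 hW
    exact hWt (eq_zero_of_skewPoly_eq_zero hw.frob _ hlt (fun a ha => ha) t ht)
  have h4 : Module.finrank k (LinearMap.range (skewPoly φ f' R)) ≤ z := by
    refine (Submodule.finrank_mono ?_).trans h3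
    rintro _ ⟨a, rfl⟩
    exact h2 a
  have h5 := LinearMap.finrank_range_add_finrank_ker (skewPoly φ f' R)
  rw [hw.finrank] at h5
  have h6 := eq_zero_of_skewPoly_eq_zero hw.frob (LinearMap.ker (skewPoly φ f' R))
    (c := f') (d := R) (by omega) fun a ha => ha
  intro j hj
  refine sub_eq_zero.1 (hw.code_injective (fun j => x' j - τ • x j) (fun i hi => ?_) j hj)
  rw [hf' i hi, skewPoly_congr (c' := 0) h6]
  simp [skewPoly_apply]

end ReceivedWord

end SkewPoly

/-! ### The program that decodes one received word -/

section DecodeProgram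

open Program Term Arrays

/-- Decodes one received word. -/
def decodeProgram (m len z R r : IndexExpr) : Program :=
  seq (powersProgram m (.add R z)) <|
  seq (annihilatorProgram m len (.add z (.const 1)) (.add R z) r) <|
  messageProgram m len (.add z (.const 1)) (.add R z) R

theorem noWrite_decodeProgram {m len z R r : IndexExpr} {n : ℕ}
    (hn : n ∉ [13, 26, 27, 28, 29, 30, 31, 32, 33, 34, 35]) :
    (decodeProgram m len z R r).NoWrite n := by
  simp only [List.mem_cons, List.not_mem_nil, or_false, not_or] at hn
  refine ⟨noWrite_powersProgram ?_, noWrite_annihilatorProgram ?_, noWrite_messageProgram ?_⟩ <;>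
    simp only [List.mem_cons, List.not_mem_nil, or_false, not_or] <;> omega

variable {F k A : Type*} [Field F] [Field k] [Field A] [Algebra F k] [Algebra k A] [Algebra F A]
  [IsScalarTower F k A]

theorem restrictScalars_pow_apply (φ : A →ₗ[k] A) (t : ℕ) (x : A) :
    (φ.restrictScalars F ^ t) x = (φ ^ t) x := by
  induction t with
  | zero => rfl
  | succ t ih =>
    rw [pow_succ', pow_succ', Module.End.mul_apply, Module.End.mul_apply, ih]
    rfl

theorem skewPoly_restrictScalars (φ : A →ₗ[k] A) (c : ℕ → A) (d : ℕ) (x : A) :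
    skewPoly (φ.restrictScalars F) c d x = skewPoly φ c d x := by
  simp only [skewPoly_apply, restrictScalars_pow_apply]

theorem relationColumn_restrictScalars (φ : A →ₗ[k] A) (a b : ℕ) (y h : ℕ → A) (J : ℕ → ℕ → A)
    (i c : ℕ) :
    relationColumn (φ.restrictScalars F) a b y h J i c = relationColumn φ a b y h J i c := by
  simp only [relationColumn, restrictScalars_pow_apply]

variable {m : ℕ} (e : Module.Basis (Fin m) F A) {ρ₀ ρ : ℕ → ℕ}
  {mE lenE zE RE rE : IndexExpr} {len z R r : ℕ}

/-- Three fields are involved: the Frobenius map, the interference and the rank of the error refer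
to k, while memory and linear algebra are over the smaller F. For the second message F ⊆ k ⊆ A is F
⊆ K ⊆ L; for the first it is F = F ⊆ K. -/
theorem decodeProgram_spec [Finite k] (hm : mE.Denotes ρ₀ m) (hlen : lenE.Denotes ρ₀ len)
    (hz : zE.Denotes ρ₀ z) (hR : RE.Denotes ρ₀ R) (hr : rE.Denotes ρ₀ r) (hρ : SameParams ρ₀ ρ)
    (σ : Memory F) (φ : A →ₗ[k] A) (y h : ℕ → A) (H : ℕ → ℕ → A) (κ : ℕ → ℕ → k) {β : A}
    (hβ : β ≠ 0) (x : ℕ → A)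
    (htab : ∀ u < m, ∀ w < m, ∀ l < m,
      σ [table, u, w, l] = coord e (basisElt e u * basisElt e w) l)
    (hφ : ∀ u < m, ∀ l < m, σ [frob, u, l] = coord e (φ (basisElt e u)) l)
    (hh : ∀ i < len, ∀ l < m, σ [points, i, l] = coord e (h i) l)
    (hH : ∀ i < len, ∀ j < R, ∀ l < m, σ [generator, i, j, l] = coord e (H i j) l)
    (hJ : ∀ i < len, ∀ j < r, ∀ l < m, σ [nuisance, i, j, l] = coord e (κ i j • β) l)
    (hy : ∀ i < len, ∀ l < m, σ [word, i, l] = coord e (y i) l)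
    (hw : ReceivedWord φ len R r z h H κ y x) :
    ∀ j < R, ∀ l < m, (decodeProgram mE lenE zE RE rE).sem ρ σ [message, j, l] =
      coord e (x j) l := by
  have : FiniteDimensional F A := Module.Basis.finiteDimensional_of_finite e
  have : FiniteDimensional k A := FiniteDimensional.right F k A
  have hm0 : 0 < m := by
    have : Nontrivial A := inferInstance
    have := Module.finrank_pos (R := F) (M := A)
    rwa [Module.finrank_eq_card_basis e, Fintype.card_fin] at this
  have ha := hz.add (IndexExpr.denotes_const (ρ₀ := ρ₀) 1)
  have hb := hR.add hz
  unfold decodeProgram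
  simp only [sem_seq]
  have hpow := powersProgram_spec e hm hb hρ σ (φ.restrictScalars F) hφ
  have f₁ : ∀ n ∉ [13, 26, 31], ∀ a, (powersProgram mE (RE.add zE)).sem ρ σ (n :: a) = σ (n :: a) :=
    fun n hn a => sem_of_noWrite (noWrite_powersProgram hn) _ _ _
  generalize (powersProgram mE (RE.add zE)).sem ρ σ = σ₁ at *
  -- The exponents that occur are at most z in V and at most R + z - 1 in N, so the powers up to R +
  -- z suffice.
  have hpow' : ∀ t < max (z + 1) (R + z), ∀ u < m, ∀ l < m, σ₁ [frobPow, t, u, l] =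
      coord e ((φ.restrictScalars F ^ t) (basisElt e u)) l := fun t ht =>
    hpow t (by rcases lt_max_iff.1 ht with h | h <;> omega)
  obtain ⟨W, ⟨hW0, hW⟩, hWc⟩ := annihilatorProgram_spec e hm hlen ha hb hr hρ σ₁
    (φ.restrictScalars F) y h (fun i j => κ i j • β)
    (fun u hu w hw l hl => by rw [f₁ _ (by decide), htab u hu w hw l hl]) hpow'
    (fun i hi l hl => by rw [f₁ _ (by decide), hy i hi l hl])
    (fun i hi l hl => by rw [f₁ _ (by decide), hh i hi l hl])
    (fun i hi j hj l hl => by rw [f₁ _ (by decide), hJ i hi j hj l hl])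
    (by
      simp only [relationColumn_restrictScalars]
      exact hw.exists_relation hβ)
  have f₂ : ∀ n ∉ [13, 27, 28, 29, 30, 32], ∀ a,
      (annihilatorProgram mE lenE (zE.add (.const 1)) (RE.add zE) rE).sem ρ σ₁ (n :: a) =
        σ₁ (n :: a) :=
    fun n hn a => sem_of_noWrite (noWrite_annihilatorProgram hn) _ _ _
  generalize (annihilatorProgram mE lenE (zE.add (.const 1)) (RE.add zE) rE).sem ρ σ₁ = σ₂ at *
  simp only [relationColumn_restrictScalars] at hW
  refine messageProgram_spec e hm hlen ha hb hR hρ hm0 σ₂ (φ.restrictScalars F) h H W x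
    (fun u hu w hw l hl => by rw [f₂ _ (by decide), f₁ _ (by decide), htab u hu w hw l hl])
    (fun t ht u hu l hl => by rw [f₂ _ (by decide), hpow' t ht u hu l hl])
    (fun i hi l hl => by rw [f₂ _ (by decide), f₁ _ (by decide), hh i hi l hl])
    (fun i hi j hj l hl => by rw [f₂ _ (by decide), f₁ _ (by decide), hH i hi j hj l hl])
    (fun c hc u hu => hWc c (by omega) u hu) ?_ ?_
  · intro i hi
    obtain ⟨f, hf⟩ := hw.code x
    rw [hf i hi, skewPoly_restrictScalars, skewPoly_restrictScalars]
    exact hw.skewPoly_eq hW hf (h i)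
  · intro x' τ hx' j hj
    rw [← algebraMap_smul k τ (x j)]
    refine hw.message_unique hβ hW0 hW (fun i hi => ?_) j hj
    rw [← hx' i hi, skewPoly_restrictScalars, skewPoly_restrictScalars, algebraMap_smul]

end DecodeProgram

/-! ### The transform matrices of random linear network codes -/

section SchwartzZippel

variable {F K ι : Type*} [Field F] [Fintype F] [Field K] [Fintype ι]

/-- The Schwartz–Zippel lemma for values in a finite subfield. -/
theorem card_eval_eq_zero_mul_card_le (i : F →+* K) {p : MvPolynomial ι K} (hp : p ≠ 0) :
    Nat.card {x : ι → F // MvPolynomial.eval (fun v => i (x v)) p = 0} * Fintype.card F ≤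
      p.totalDegree * Nat.card (ι → F) := by
  classical
  let n := Fintype.card ι
  let s : ι ≃ Fin n := Fintype.equivFin ι
  have hp' : MvPolynomial.rename s p ≠ 0 := fun h =>
    hp (MvPolynomial.rename_injective s s.injective (by simpa using h))
  -- The sample set is the copy of F inside K, although the polynomial has coefficients in K.
  let S : Finset K := Finset.univ.image i
  have hS : S.card = Fintype.card F := by
    rw [Finset.card_image_of_injective _ i.injective, Finset.card_univ]
  have key := MvPolynomial.schwartz_zippel_totalDegree hp' S
  have hF : 0 < Fintype.card F := Fintype.card_pos
  rw [hS, div_le_div_iff₀ (by positivity) (by positivity)] at key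
  have hdeg : (MvPolynomial.rename s p).totalDegree ≤ p.totalDegree :=
    MvPolynomial.totalDegree_rename_le _ _
  have key' : (Finset.filter (fun f => MvPolynomial.eval f (MvPolynomial.rename s p) = 0)
      (Fintype.piFinset fun _ => S)).card * Fintype.card F ≤
        p.totalDegree * Fintype.card F ^ n := by
    have : (Finset.filter (fun f => MvPolynomial.eval f (MvPolynomial.rename s p) = 0)
      (Fintype.piFinset fun _ => S)).card * Fintype.card F ≤
        (MvPolynomial.rename s p).totalDegree * Fintype.card F ^ n := by exact_mod_cast key
    exact this.trans (Nat.mul_le_mul_right _ hdeg)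
  have hcard : Nat.card (ι → F) = Fintype.card F ^ n := by
    simp [n, Nat.card_eq_fintype_card]
  rw [hcard]
  refine le_trans (Nat.mul_le_mul_right _ ?_) key'
  rw [Nat.card_eq_fintype_card, ← Finset.card_univ]
  refine Finset.card_le_card_of_injOn (fun x j => i (x.1 (s.symm j))) ?_ ?_
  · intro x _
    simp only [Finset.coe_filter, Fintype.mem_piFinset, Set.mem_ofPred_eq]
    refine ⟨fun j => Finset.mem_image_of_mem _ (Finset.mem_univ _), ?_⟩
    rw [MvPolynomial.eval_rename]
    simpa [Function.comp_def] using x.2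
  · intro x _ y _ hxy
    refine Subtype.ext (funext fun v => i.injective ?_)
    simpa using congrFun hxy (s v)

end SchwartzZippel

/-- Every term of the Leibniz formula takes one entry from each row. -/
theorem totalDegree_det_le {ι v K : Type*} [Fintype ι] [DecidableEq ι] [Field K]
    (M : Matrix ι ι (MvPolynomial v K)) (d : ι → ℕ) (h : ∀ i j, (M i j).totalDegree ≤ d i) :
    M.det.totalDegree ≤ ∑ i, d i := by
  rw [Matrix.det_apply']
  refine MvPolynomial.totalDegree_finsetSum_le fun σ _ => ?_
  refine (MvPolynomial.totalDegree_mul _ _).trans ?_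
  have h1 : (((Equiv.Perm.sign σ : ℤ) : MvPolynomial v K)).totalDegree = 0 := by
    rw [← map_intCast (MvPolynomial.C (R := K) (σ := v)), MvPolynomial.totalDegree_C]
  rw [h1, zero_add]
  refine (MvPolynomial.totalDegree_finsetProd _ _).trans ?_
  rw [← Equiv.sum_comp σ d]
  exact Finset.sum_le_sum fun i _ => h _ _

/-! ### Routing by Hall's theorem, and the flow matrix -/

namespace Network

section MinCut

variable {V E : Type*} (𝒢 : Network V E)

theorem minCut_le {S U : Set V} (h : S ⊆ U) (hU : 𝒢.receiver ∉ U) :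
    𝒢.minCut S ≤ 𝒢.cutCapacity U := Nat.sInf_le ⟨U, h, hU, rfl⟩

/-- No cut exists, and the infimum of the empty set of natural numbers is 0. A source placed at the
receiver is thereby limited to zero packets. -/
theorem minCut_eq_zero {S : Set V} (h : 𝒢.receiver ∈ S) : 𝒢.minCut S = 0 := by
  unfold minCut
  rw [show {c : ℕ | ∃ U : Set V, S ⊆ U ∧ 𝒢.receiver ∉ U ∧ 𝒢.cutCapacity U = c} = ∅ from ?_,
    Nat.sInf_empty]
  refine Set.eq_empty_of_forall_notMem fun c => ?_
  rintro ⟨U, h1, h2, -⟩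
  exact h2 (h1 h)

end MinCut

variable {V E : Type*} [DecidableEq V] [DecidableEq E] (𝒢 : Network V E) {C : ℕ}
  (incoming : Fin C ≃ {e : E // 𝒢.head e = 𝒢.receiver})

/-- A link, or a link that ends at the receiver, can take its packet from the first link or source
packet in the second argument; a link may also be unused. -/
def CanFollow (r₁ r₂ : ℕ) : E ⊕ Fin C → E ⊕ (Fin r₁ ⊕ Fin r₂) → Prop
  | Sum.inl e, Sum.inl e' => e' = e ∨ 𝒢.head e' = 𝒢.tail e
  | Sum.inl e, Sum.inr (Sum.inl _) => 𝒢.tail e = 𝒢.source₁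
  | Sum.inl e, Sum.inr (Sum.inr _) => 𝒢.tail e = 𝒢.source₂
  | Sum.inr i, Sum.inl e' => e' = incoming i
  | Sum.inr _, Sum.inr _ => False

/-- The max-flow min-cut theorem, as a matching. -/
theorem exists_routing [Fintype E] {r₁ r₂ : ℕ} (h₁ : r₁ ≤ 𝒢.minCut {𝒢.source₁})
    (h₂ : r₂ ≤ 𝒢.minCut {𝒢.source₂}) (h₁₂ : C ≤ 𝒢.minCut {𝒢.source₁, 𝒢.source₂})
    (hC : r₁ + r₂ = C) :
    ∃ f : E ⊕ Fin C → E ⊕ (Fin r₁ ⊕ Fin r₂), Function.Bijective f ∧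
      ∀ x, 𝒢.CanFollow incoming r₁ r₂ x (f x) := by
  classical
  suffices h : ∃ f : E ⊕ Fin C → E ⊕ (Fin r₁ ⊕ Fin r₂), Function.Injective f ∧
      ∀ x, f x ∈ Finset.univ.filter (𝒢.CanFollow incoming r₁ r₂ x) by
    obtain ⟨f, hf, hf'⟩ := h
    refine ⟨f, (Fintype.bijective_iff_injective_and_card f).2 ⟨hf, by simp [hC]⟩, fun x => ?_⟩
    simpa using hf' x
  rw [← Finset.all_card_le_biUnion_card_iff_exists_injective]
  intro s
  -- Hall's condition |s| ≤ |T| is to be shown. The relevant cut is the complement of `W`, the set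
  -- of the receiver and the starting points of the links in s.
  set T := s.biUnion fun x => Finset.univ.filter (𝒢.CanFollow incoming r₁ r₂ x) with hT
  have memT : ∀ y, y ∈ T ↔ ∃ x ∈ s, 𝒢.CanFollow incoming r₁ r₂ x y := by simp [hT]
  let W : Set V := {v | v = 𝒢.receiver ∨ ∃ e ∈ s.toLeft, 𝒢.tail e = v}
  have hrec : 𝒢.receiver ∉ Wᶜ := fun h => h (Or.inl rfl)
  let X : Finset E := Finset.univ.filter fun e => 𝒢.tail e ∉ W ∧ 𝒢.head e ∈ W
  have hX : 𝒢.cutCapacity Wᶜ = X.card := by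
    rw [cutCapacity, ← Set.ncard_coe_finset]
    congr 1
    ext e
    simp [X]
  -- Links into the receiver whose receiver slot is not in s need not be neighbours of s; there are
  -- at most C - |s ∩ Fin C| of them.
  let Y : Finset E := s.toRightᶜ.image fun i => (incoming i : E)
  have hY : Y.card + s.toRight.card ≤ C := by
    have h1 : Y.card ≤ s.toRightᶜ.card := Finset.card_image_le
    have h2 := Finset.card_compl_add_card s.toRight
    rw [Fintype.card_fin] at h2
    omega
  have hXY : X.card ≤ (X \ Y).card + Y.card := by
    have := Finset.le_card_sdiff Y X
    omega
  -- A link of s is its own neighbour, as it may stay unused. A link entering `W` can be followed by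
  -- a link of s, or ends at the receiver and serves a slot of s unless it lies in `Y`. The two
  -- kinds are disjoint: links of s start in `W`, those in `X` outside.
  have hleft : s.toLeft.card + (X \ Y).card ≤ T.toLeft.card := by
    rw [← Finset.card_union_of_disjoint]
    · refine Finset.card_le_card fun e he => ?_
      rw [Finset.mem_toLeft, memT]
      rcases Finset.mem_union.1 he with he | he
      · exact ⟨Sum.inl e, by simpa using he, Or.inl rfl⟩
      · obtain ⟨h3, h4⟩ := Finset.mem_sdiff.1 he
        obtain ⟨-, -, h5⟩ := Finset.mem_filter.1 h3
        rcases h5 with h5 | ⟨e', he', h5⟩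
        · obtain ⟨i, hi⟩ := incoming.surjective ⟨e, h5⟩
          have hi' : (incoming i : E) = e := congrArg Subtype.val hi
          refine ⟨Sum.inr i, ?_, hi'.symm⟩
          by_contra h6
          exact h4 (Finset.mem_image.2 ⟨i, by simpa using h6, hi'⟩)
        · exact ⟨Sum.inl e', by simpa using he', Or.inr h5.symm⟩
    · rw [Finset.disjoint_left]
      intro e he he'
      obtain ⟨-, h3, -⟩ := Finset.mem_filter.1 (Finset.mem_sdiff.1 he').1
      exact h3 (Or.inr ⟨e, he, rfl⟩)
  have hs₁ : 𝒢.source₁ ∈ W → r₁ ≤ T.toRight.toLeft.card := by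
    rintro (h | ⟨e, he, h⟩)
    · rw [𝒢.minCut_eq_zero (S := {𝒢.source₁}) (by simp [h])] at h₁
      omega
    · rw [show T.toRight.toLeft = Finset.univ from Finset.eq_univ_iff_forall.2 ?_, Finset.card_univ, Fintype.card_fin]
      intro j
      rw [Finset.mem_toLeft, Finset.mem_toRight, memT]
      exact ⟨Sum.inl e, by simpa using he, h⟩
  have hs₂ : 𝒢.source₂ ∈ W → r₂ ≤ T.toRight.toRight.card := by
    rintro (h | ⟨e, he, h⟩)
    · rw [𝒢.minCut_eq_zero (S := {𝒢.source₂}) (by simp [h])] at h₂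
      omega
    · rw [show T.toRight.toRight = Finset.univ from Finset.eq_univ_iff_forall.2 ?_, Finset.card_univ, Fintype.card_fin]
      intro j
      rw [Finset.mem_toRight, Finset.mem_toRight, memT]
      exact ⟨Sum.inl e, by simpa using he, h⟩
  -- A source in `W` contributes all its packets to T; for the sources outside `W`, the
  -- corresponding min-cut bound applies to the complement of `W`.
  have hcap : C ≤ X.card + T.toRight.toLeft.card + T.toRight.toRight.card := by
    rw [← hX]
    by_cases m₁ : 𝒢.source₁ ∈ W <;> by_cases m₂ : 𝒢.source₂ ∈ W
    · have := hs₁ m₁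
      have := hs₂ m₂
      omega
    · have := hs₁ m₁
      have := 𝒢.minCut_le (S := {𝒢.source₂}) (U := Wᶜ) (by simpa using m₂) hrec
      omega
    · have := hs₂ m₂
      have := 𝒢.minCut_le (S := {𝒢.source₁}) (U := Wᶜ) (by simpa using m₁) hrec
      omega
    · have := 𝒢.minCut_le (S := {𝒢.source₁, 𝒢.source₂}) (U := Wᶜ)
        (by rintro x (rfl | rfl); exacts [m₁, m₂]) hrec
      omega
  rw [← Finset.card_toLeft_add_card_toRight (u := s), ← Finset.card_toLeft_add_card_toRight (u := T),
    ← Finset.card_toLeft_add_card_toRight (u := T.toRight)]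
  omega

section FlowMatrix

variable {R : Type*} [CommRing R] {n₁ n₂ r₁ r₂ : ℕ}

/-- The matrix of the linear equations between the packets on the links, those at the sources and
those at the receiver. -/
def flowMatrix (Γ₁ : Matrix (Fin n₁) (Fin r₁) R) (Γ₂ : Matrix (Fin n₂) (Fin r₂) R)
    (a : Matrix E E R) (b₁ : Matrix E (Fin n₁) R) (b₂ : Matrix E (Fin n₂) R) :
    Matrix (E ⊕ Fin C) (E ⊕ (Fin r₁ ⊕ Fin r₂)) R :=
  Matrix.of fun x y => match x, y with
  | Sum.inl e, Sum.inl e' => (if e = e' then 1 else 0) - if 𝒢.head e' = 𝒢.tail e then a e e' else 0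
  | Sum.inl e, Sum.inr (Sum.inl j) => -if 𝒢.tail e = 𝒢.source₁ then (b₁ * Γ₁) e j else 0
  | Sum.inl e, Sum.inr (Sum.inr j) => -if 𝒢.tail e = 𝒢.source₂ then (b₂ * Γ₂) e j else 0
  | Sum.inr i, Sum.inl e' => if e' = incoming i then 1 else 0
  | Sum.inr _, Sum.inr _ => 0

theorem flowMatrix_map {S : Type*} [CommRing S] (φ : R →+* S) (Γ₁ : Matrix (Fin n₁) (Fin r₁) R)
    (Γ₂ : Matrix (Fin n₂) (Fin r₂) R) (a : Matrix E E R) (b₁ : Matrix E (Fin n₁) R)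
    (b₂ : Matrix E (Fin n₂) R) :
    (𝒢.flowMatrix incoming Γ₁ Γ₂ a b₁ b₂).map φ =
      𝒢.flowMatrix incoming (Γ₁.map φ) (Γ₂.map φ) (a.map φ) (b₁.map φ) (b₂.map φ) := by
  ext x y
  rcases x with e | i <;> rcases y with e' | j | j <;>
    simp [flowMatrix, Matrix.mul_apply, apply_ite φ]

end FlowMatrix

end Network

/-! ### Coefficients with injective flow matrix, and its meaning for the receiver -/

namespace Network

variable {V E : Type*} [DecidableEq V] [Fintype E] [DecidableEq E] (𝒢 : Network V E) {C : ℕ}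
  (incoming : Fin C ≃ {e : E // 𝒢.head e = 𝒢.receiver})

section Injective

variable {K : Type*} [Field K] {n₁ n₂ r₁ r₂ : ℕ}

/-- With coefficients 0 and 1 along a routing, the equations say that every used link copies its
predecessor and every unused link carries 0. If the receiver gets zeros, zeros propagate upstream to
all links and source packets. -/
theorem exists_flowMatrix_injective (h₁ : r₁ ≤ 𝒢.minCut {𝒢.source₁})
    (h₂ : r₂ ≤ 𝒢.minCut {𝒢.source₂}) (h₁₂ : C ≤ 𝒢.minCut {𝒢.source₁, 𝒢.source₂})
    (hC : r₁ + r₂ = C) {Γ₁ : Matrix (Fin n₁) (Fin r₁) K} {Γ₂ : Matrix (Fin n₂) (Fin r₂) K}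
    {P₁ : Matrix (Fin r₁) (Fin n₁) K} {P₂ : Matrix (Fin r₂) (Fin n₂) K} (hP₁ : P₁ * Γ₁ = 1)
    (hP₂ : P₂ * Γ₂ = 1) :
    ∃ (a : Matrix E E K) (b₁ : Matrix E (Fin n₁) K) (b₂ : Matrix E (Fin n₂) K),
      Function.Injective (𝒢.flowMatrix incoming Γ₁ Γ₂ a b₁ b₂).mulVec := by
  classical
  obtain ⟨f, hf, hf'⟩ := 𝒢.exists_routing incoming h₁ h₂ h₁₂ hC
  -- A link matched to itself is unused and must not relay, hence `e' ≠ e`.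
  let a : Matrix E E K := Matrix.of fun e e' =>
    if f (Sum.inl e) = Sum.inl e' ∧ e' ≠ e then 1 else 0
  let c₁ : Matrix E (Fin r₁) K := Matrix.of fun e j =>
    if f (Sum.inl e) = Sum.inr (Sum.inl j) then 1 else 0
  let c₂ : Matrix E (Fin r₂) K := Matrix.of fun e j =>
    if f (Sum.inl e) = Sum.inr (Sum.inr j) then 1 else 0
  -- The left inverses undo the precoding: c P Γ = c, so the routing may be designed for the r₁ + r₂
  -- symbols before precoding.
  refine ⟨a, c₁ * P₁, c₂ * P₂, ?_⟩
  change Function.Injective (Matrix.mulVecLin _)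
  rw [injective_iff_map_eq_zero]
  intro g hg
  have hrow : ∀ e, f (Sum.inl e) ≠ Sum.inl e → g (Sum.inl e) = g (f (Sum.inl e)) := by
    intro e he
    have h := congrFun hg (Sum.inl e)
    simp only [Matrix.mulVecLin_apply, Matrix.mulVec, dotProduct, Fintype.sum_sum_type, flowMatrix,
      Matrix.of_apply, Matrix.mul_assoc, hP₁, hP₂, Matrix.mul_one, sub_mul, Finset.sum_sub_distrib,
      ite_mul, one_mul, zero_mul, Finset.sum_ite_eq, Finset.mem_univ, if_true, Pi.zero_apply, a, c₁,
      c₂] at h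
    rcases hfe : f (Sum.inl e) with e' | j | j
    · have hee : e' ≠ e := fun h => he (by rw [hfe, h])
      have hadj : 𝒢.head e' = 𝒢.tail e := by
        have := hf' (Sum.inl e)
        rw [hfe] at this
        exact this.resolve_left hee
      rw [Finset.sum_eq_single e'] at h
      · simp [hfe, hee, hadj] at h
        linear_combination h
      · intro x _ hx
        simp [hfe, hx.symm]
      · simp
    · have hadj : 𝒢.tail e = 𝒢.source₁ := by
        have := hf' (Sum.inl e)
        rwa [hfe] at this
      simp [hfe, hadj, ite_mul] at h
      linear_combination h
    · have hadj : 𝒢.tail e = 𝒢.source₂ := by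
        have := hf' (Sum.inl e)
        rwa [hfe] at this
      simp [hfe, hadj, ite_mul] at h
      linear_combination h
  have hloop : ∀ e, f (Sum.inl e) = Sum.inl e → g (Sum.inl e) = 0 := by
    intro e he
    have h := congrFun hg (Sum.inl e)
    simp only [Matrix.mulVecLin_apply, Matrix.mulVec, dotProduct, Fintype.sum_sum_type, flowMatrix,
      Matrix.of_apply, Matrix.mul_assoc, hP₁, hP₂, Matrix.mul_one, sub_mul, Finset.sum_sub_distrib,
      ite_mul, one_mul, zero_mul, Finset.sum_ite_eq, Finset.mem_univ, if_true, Pi.zero_apply, a, c₁,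
      c₂] at h
    rw [Finset.sum_eq_zero (s := Finset.univ) (f := fun x => if 𝒢.head x = 𝒢.tail e then
      if f (Sum.inl e) = Sum.inl x ∧ x ≠ e then g (Sum.inl x) else 0 else 0)] at h
    · simpa [he] using h
    · intro x _
      rw [if_neg (c := f (Sum.inl e) = Sum.inl x ∧ x ≠ e)]
      · simp
      · rintro ⟨h1, h2⟩
        rw [he] at h1
        exact h2 (Sum.inl_injective h1).symm
  have hrec : ∀ i, g (f (Sum.inr i)) = 0 := by
    intro i
    have h := congrFun hg (Sum.inr i)
    have h' := hf' (Sum.inr i)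
    rcases hfi : f (Sum.inr i) with e | j
    · rw [hfi] at h'
      have h'' : e = incoming i := h'
      rw [h'']
      simpa [Matrix.mulVec, dotProduct, Fintype.sum_sum_type, flowMatrix] using h
    · rw [hfi] at h'
      exact h'.elim
  let r : E → E → Prop := fun e' e => Relation.TransGen (fun e₁ e₂ => 𝒢.head e₁ = 𝒢.tail e₂) e e'
  have : IsTrans E r := ⟨fun _ _ _ h₁ h₂ => Relation.TransGen.trans h₂ h₁⟩
  have : Std.Irrefl r := ⟨𝒢.acyclic⟩
  have wf : WellFounded r := Finite.wellFounded_of_trans_of_irrefl r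
  -- Induction from the receiver upstream, well founded by acyclicity. For a used link e the value
  -- at f(e) equals that at e, and by surjectivity e is the predecessor of a downstream link or of a
  -- receiver slot, where the claim is known.
  have hlink : ∀ e, g (f (Sum.inl e)) = 0 := by
    intro e
    induction e using wf.induction with
    | _ e ih =>
      by_cases he : f (Sum.inl e) = Sum.inl e
      · rw [he, hloop e he]
      · rw [← hrow e he]
        obtain ⟨x, hx⟩ := hf.2 (Sum.inl e)
        rw [← hx]
        rcases x with e' | i
        · refine ih e' (Relation.TransGen.single ?_)
          have := hf' (Sum.inl e')
          rw [hx] at this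
          refine this.resolve_left ?_
          rintro rfl
          exact he hx
        · exact hrec i
  funext y
  obtain ⟨x, rfl⟩ := hf.2 y
  rcases x with e | i
  exacts [hlink e, hrec i]

end Injective

section Transfer

variable {F : Type*} [Field F] {n₁ n₂ r₁ r₂ : ℕ}

/-- The transform matrix from the links to the receiver. -/
noncomputable def linkTransfer (κ : CodingCoeffs F E n₁ n₂) : Matrix (Fin C) E F :=
  (1 - 𝒢.relayMatrix κ.relay)⁻¹.submatrix (fun i => (incoming i : E)) id

theorem transfer₁_eq (κ : CodingCoeffs F E n₁ n₂) :
    𝒢.transfer₁ incoming κ = 𝒢.linkTransfer incoming κ * 𝒢.injectMatrix 𝒢.source₁ κ.inject₁ := by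
  ext i j
  simp [transfer₁, received, packets, linkTransfer, Matrix.mul_apply]

theorem transfer₂_eq (κ : CodingCoeffs F E n₁ n₂) :
    𝒢.transfer₂ incoming κ = 𝒢.linkTransfer incoming κ * 𝒢.injectMatrix 𝒢.source₂ κ.inject₂ := by
  ext i j
  simp [transfer₂, received, packets, linkTransfer, Matrix.mul_apply]

theorem received_eq {ι : Type*} (κ : CodingCoeffs F E n₁ n₂) (M₁ : Matrix (Fin n₁) ι F)
    (M₂ : Matrix (Fin n₂) ι F) (W : Matrix E ι F) :
    𝒢.received incoming κ M₁ M₂ W = 𝒢.transfer₁ incoming κ * M₁ + 𝒢.transfer₂ incoming κ * M₂ +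
      𝒢.linkTransfer incoming κ * W := by
  rw [transfer₁_eq, transfer₂_eq, Matrix.mul_assoc, Matrix.mul_assoc, ← Matrix.mul_add,
    ← Matrix.mul_add]
  rfl

variable {K : Type*} [Field K]

/-- If the equations between all packets have only one solution, the receiver can tell the packets
of the sources. -/
theorem eq_zero_of_flowMatrix_injective (i : F →+* K) (Γ₁ : Matrix (Fin n₁) (Fin r₁) K)
    (Γ₂ : Matrix (Fin n₂) (Fin r₂) K) (κ : CodingCoeffs F E n₁ n₂)
    (h : Function.Injective (𝒢.flowMatrix incoming Γ₁ Γ₂ (κ.relay.map i) (κ.inject₁.map i)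
      (κ.inject₂.map i)).mulVec) (w₁ : Fin r₁ → K) (w₂ : Fin r₂ → K)
    (hw : (𝒢.transfer₁ incoming κ).map i *ᵥ (Γ₁ *ᵥ w₁) +
      (𝒢.transfer₂ incoming κ).map i *ᵥ (Γ₂ *ᵥ w₂) = 0) : w₁ = 0 ∧ w₂ = 0 := by
  have hdet : IsUnit (1 - 𝒢.relayMatrix κ.relay).det :=
    (Matrix.isUnit_iff_isUnit_det _).1 (𝒢.isUnit_one_sub_relayMatrix κ.relay)
  set B₁ := 𝒢.injectMatrix 𝒢.source₁ κ.inject₁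
  set B₂ := 𝒢.injectMatrix 𝒢.source₂ κ.inject₂
  let u : E → K := B₁.map i *ᵥ (Γ₁ *ᵥ w₁) + B₂.map i *ᵥ (Γ₂ *ᵥ w₂)
  -- The link packets caused by the source packets Γ₁w₁ and Γ₂w₂. They vanish on the links into the
  -- receiver, so (v, w₁, w₂) lies in the kernel of the flow matrix.
  let v : E → K := (1 - 𝒢.relayMatrix κ.relay)⁻¹.map i *ᵥ u
  have hv : (1 - 𝒢.relayMatrix κ.relay).map i *ᵥ v = u := by
    rw [Matrix.mulVec_mulVec, ← Matrix.map_mul, Matrix.mul_nonsing_inv _ hdet,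
      Matrix.map_one _ (map_zero i) (map_one i), Matrix.one_mulVec]
  have hrec : ∀ j, v (incoming j) = 0 := by
    intro j
    rw [transfer₁_eq, transfer₂_eq, Matrix.map_mul, Matrix.map_mul, ← Matrix.mulVec_mulVec,
      ← Matrix.mulVec_mulVec, ← Matrix.mulVec_add] at hw
    exact congrFun hw j
  have h0 : 𝒢.flowMatrix incoming Γ₁ Γ₂ (κ.relay.map i) (κ.inject₁.map i) (κ.inject₂.map i) *ᵥ
      (Sum.elim v (Sum.elim w₁ w₂)) = 0 := by
    funext x
    rcases x with e | j
    · have h1 := congrFun hv e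
      have h2 : ((1 - 𝒢.relayMatrix κ.relay).map i *ᵥ v) e = ∑ e', 𝒢.flowMatrix incoming Γ₁ Γ₂
          (κ.relay.map i) (κ.inject₁.map i) (κ.inject₂.map i) (Sum.inl e) (Sum.inl e') * v e' := by
        refine Finset.sum_congr rfl fun e' _ => ?_
        simp [flowMatrix, relayMatrix, Matrix.one_apply, apply_ite i]
      have h3 : (B₁.map i *ᵥ (Γ₁ *ᵥ w₁)) e = -∑ j, 𝒢.flowMatrix incoming Γ₁ Γ₂
          (κ.relay.map i) (κ.inject₁.map i) (κ.inject₂.map i) (Sum.inl e) (Sum.inr (Sum.inl j)) *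
            w₁ j := by
        rw [Matrix.mulVec_mulVec, ← Finset.sum_neg_distrib]
        change ∑ j, (B₁.map i * Γ₁) e j * w₁ j = _
        refine Finset.sum_congr rfl fun j _ => ?_
        by_cases hs : 𝒢.tail e = 𝒢.source₁ <;>
          simp [flowMatrix, B₁, injectMatrix, Matrix.mul_apply, hs]
      have h4 : (B₂.map i *ᵥ (Γ₂ *ᵥ w₂)) e = -∑ j, 𝒢.flowMatrix incoming Γ₁ Γ₂
          (κ.relay.map i) (κ.inject₁.map i) (κ.inject₂.map i) (Sum.inl e) (Sum.inr (Sum.inr j)) *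
            w₂ j := by
        rw [Matrix.mulVec_mulVec, ← Finset.sum_neg_distrib]
        change ∑ j, (B₂.map i * Γ₂) e j * w₂ j = _
        refine Finset.sum_congr rfl fun j _ => ?_
        by_cases hs : 𝒢.tail e = 𝒢.source₂ <;>
          simp [flowMatrix, B₂, injectMatrix, Matrix.mul_apply, hs]
      simp only [u, Pi.add_apply] at h1
      rw [h2, h3, h4] at h1
      simp only [Matrix.mulVec, dotProduct, Fintype.sum_sum_type, Sum.elim_inl, Sum.elim_inr,
        Pi.zero_apply]
      linear_combination h1
    · simpa [Matrix.mulVec, dotProduct, Fintype.sum_sum_type, flowMatrix] using hrec j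
  have h1 := h (h0.trans (Matrix.mulVec_zero _).symm)
  exact ⟨funext fun j => congrFun h1 (Sum.inr (Sum.inl j)),
    funext fun j => congrFun h1 (Sum.inr (Sum.inr j))⟩

end Transfer

end Network

/-! ### The failure probability of a random linear network code -/

section Probability

/-- The complements of two events of small probability meet with large probability. -/
theorem one_sub_le_uniformProb {α : Type*} [Finite α] [Nonempty α] {P Q R : α → Prop} {a q : ℕ}
    (hq : 0 < q) (hP : Nat.card {x // ¬ P x} * q ≤ a * Nat.card α)
    (hQ : Nat.card {x // ¬ Q x} * q ≤ a * Nat.card α) (h : ∀ x, P x → Q x → R x) :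
    1 - 2 * (a : ℝ) / q ≤ uniformProb R := by
  classical
  have := Fintype.ofFinite α
  have h1 : Nat.card α ≤ Nat.card {x // R x} + Nat.card {x // ¬ P x} + Nat.card {x // ¬ Q x} := by
    simp only [Nat.card_eq_fintype_card, Fintype.card_subtype]
    rw [← Finset.card_univ]
    calc (Finset.univ : Finset α).card
        ≤ (Finset.univ.filter R ∪ Finset.univ.filter (¬ P ·) ∪ Finset.univ.filter (¬ Q ·)).card := by
          refine Finset.card_le_card fun x _ => ?_
          have := h x
          simp only [Finset.mem_union, Finset.mem_filter, Finset.mem_univ, true_and]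
          tauto
      _ ≤ _ := (Finset.card_union_le _ _).trans (Nat.add_le_add_right (Finset.card_union_le _ _) _)
  have hα : (0 : ℝ) < Nat.card α := by exact_mod_cast Nat.card_pos
  have hq' : (0 : ℝ) < q := by exact_mod_cast hq
  unfold uniformProb
  rw [le_div_iff₀ hα, sub_mul, one_mul, sub_le_iff_le_add, div_mul_eq_mul_div]
  have h2 : (Nat.card {x // ¬ P x} : ℝ) ≤ a * Nat.card α / q := by
    rw [le_div_iff₀ hq']; exact_mod_cast hP
  have h3 : (Nat.card {x // ¬ Q x} : ℝ) ≤ a * Nat.card α / q := by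
    rw [le_div_iff₀ hq']; exact_mod_cast hQ
  have h4 : (Nat.card α : ℝ) ≤ Nat.card {x // R x} + Nat.card {x // ¬ P x} + Nat.card {x // ¬ Q x} := by
    exact_mod_cast h1
  have h5 : 2 * (a : ℝ) * Nat.card α / q = a * Nat.card α / q + a * Nat.card α / q := by ring
  linarith

end Probability

namespace Network

variable {V E : Type*} [DecidableEq V] [Fintype E] [DecidableEq E] (𝒢 : Network V E) {C : ℕ}
  (incoming : Fin C ≃ {e : E // 𝒢.head e = 𝒢.receiver})

section Bound

variable {K : Type*} [Field K] {n₁ n₂ r₁ r₂ : ℕ}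

/-- The coding coefficients as a point. -/
def coeffsEquiv (F E : Type*) (n₁ n₂ : ℕ) :
    CodingCoeffs F E n₁ n₂ ≃ ((E × E) ⊕ ((E × Fin n₁) ⊕ (E × Fin n₂)) → F) where
  toFun κ := Sum.elim (fun p => κ.1 p.1 p.2) (Sum.elim (fun p => κ.2.1 p.1 p.2)
    fun p => κ.2.2 p.1 p.2)
  invFun x := (Matrix.of fun e e' => x (Sum.inl (e, e')),
    Matrix.of fun e i => x (Sum.inr (Sum.inl (e, i))),
    Matrix.of fun e i => x (Sum.inr (Sum.inr (e, i))))
  left_inv _ := rfl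
  right_inv x := by
    funext v
    rcases v with v | v | v <;> rfl

/-- The determinant of the flow matrix, as a polynomial in the coding coefficients. -/
noncomputable def flowPolynomial (s : Fin C ≃ Fin r₁ ⊕ Fin r₂) (Γ₁ : Matrix (Fin n₁) (Fin r₁) K)
    (Γ₂ : Matrix (Fin n₂) (Fin r₂) K) :
    MvPolynomial ((E × E) ⊕ ((E × Fin n₁) ⊕ (E × Fin n₂))) K :=
  ((𝒢.flowMatrix incoming (Γ₁.map MvPolynomial.C) (Γ₂.map MvPolynomial.C)
    (Matrix.of fun e e' => MvPolynomial.X (Sum.inl (e, e')))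
    (Matrix.of fun e i => MvPolynomial.X (Sum.inr (Sum.inl (e, i))))
    (Matrix.of fun e i => MvPolynomial.X (Sum.inr (Sum.inr (e, i))))).submatrix id
      (Equiv.sumCongr (Equiv.refl E) s)).det

theorem eval_flowPolynomial (s : Fin C ≃ Fin r₁ ⊕ Fin r₂) (Γ₁ : Matrix (Fin n₁) (Fin r₁) K)
    (Γ₂ : Matrix (Fin n₂) (Fin r₂) K) (κ : CodingCoeffs K E n₁ n₂) :
    MvPolynomial.eval (coeffsEquiv K E n₁ n₂ κ) (𝒢.flowPolynomial incoming s Γ₁ Γ₂) =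
      ((𝒢.flowMatrix incoming Γ₁ Γ₂ κ.1 κ.2.1 κ.2.2).submatrix id
        (Equiv.sumCongr (Equiv.refl E) s)).det := by
  rw [flowPolynomial, RingHom.map_det]
  congr 1
  rw [RingHom.mapMatrix_apply, ← Matrix.submatrix_map, flowMatrix_map]
  congr 2 <;> ext <;> simp <;> rfl

/-- Link rows are of degree at most 1 and receiver rows are constant. Treating the link packets as
unknowns, instead of inverting 1 - A, is what keeps the degree down to the number of links. -/
theorem totalDegree_flowPolynomial_le (s : Fin C ≃ Fin r₁ ⊕ Fin r₂)
    (Γ₁ : Matrix (Fin n₁) (Fin r₁) K) (Γ₂ : Matrix (Fin n₂) (Fin r₂) K) :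
    (𝒢.flowPolynomial incoming s Γ₁ Γ₂).totalDegree ≤ Fintype.card E := by
  have hC : ∀ c : K, ((MvPolynomial.C c :
      MvPolynomial ((E × E) ⊕ ((E × Fin n₁) ⊕ (E × Fin n₂))) K)).totalDegree ≤ 1 := fun c => by
    rw [MvPolynomial.totalDegree_C]; exact Nat.zero_le _
  have h1 : (1 : MvPolynomial ((E × E) ⊕ ((E × Fin n₁) ⊕ (E × Fin n₂))) K).totalDegree ≤ 1 := by
    rw [MvPolynomial.totalDegree_one]; exact Nat.zero_le _
  have h0 : (0 : MvPolynomial ((E × E) ⊕ ((E × Fin n₁) ⊕ (E × Fin n₂))) K).totalDegree ≤ 1 := by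
    rw [MvPolynomial.totalDegree_zero]; exact Nat.zero_le _
  refine (totalDegree_det_le _ (Sum.elim (fun _ => 1) fun _ => 0) ?_).trans (by simp)
  rintro (e | i) y
  · rw [Matrix.submatrix_apply]
    generalize (Equiv.sumCongr (Equiv.refl E) s) y = y
    simp only [id, Sum.elim_inl]
    rcases y with e' | j | j
    · simp only [flowMatrix, Matrix.of_apply]
      refine (MvPolynomial.totalDegree_sub _ _).trans (max_le ?_ ?_)
      · split_ifs
        exacts [h1, h0]
      · split_ifs
        · rw [MvPolynomial.totalDegree_X]
        · exact h0
    · simp only [flowMatrix, Matrix.of_apply]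
      rw [MvPolynomial.totalDegree_neg]
      split_ifs
      · rw [Matrix.mul_apply]
        refine MvPolynomial.totalDegree_finsetSum_le fun i _ => ?_
        refine (MvPolynomial.totalDegree_mul _ _).trans ?_
        simp
      · exact h0
    · simp only [flowMatrix, Matrix.of_apply]
      rw [MvPolynomial.totalDegree_neg]
      split_ifs
      · rw [Matrix.mul_apply]
        refine MvPolynomial.totalDegree_finsetSum_le fun i _ => ?_
        refine (MvPolynomial.totalDegree_mul _ _).trans ?_
        simp
      · exact h0
  · rw [Matrix.submatrix_apply]
    generalize (Equiv.sumCongr (Equiv.refl E) s) y = y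
    rcases y with e' | j
    · simp only [flowMatrix, Matrix.of_apply, id]
      split_ifs <;> simp
    · simp [flowMatrix]

theorem mulVec_injective_iff_det_ne_zero {m n : Type*} [Fintype m] [DecidableEq m] [Fintype n]
    (M : Matrix m n K) (s : m ≃ n) :
    Function.Injective M.mulVec ↔ (M.submatrix id s).det ≠ 0 := by
  rw [← isUnit_iff_ne_zero, ← Matrix.isUnit_iff_isUnit_det, ← Matrix.mulVec_injective_iff_isUnit]
  have h : (M.submatrix id s).mulVec = M.mulVec ∘ (Equiv.arrowCongr s (Equiv.refl K)) := by
    funext v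
    rw [Matrix.submatrix_mulVec_equiv]
    rfl
  rw [h, Equiv.injective_comp]

variable {F : Type*} [Field F] [Fintype F]

/-- A random linear network code transmits `r₁` and `r₂` packets with large probability. -/
theorem card_not_injective_le (i : F →+* K) (h₁ : r₁ ≤ 𝒢.minCut {𝒢.source₁})
    (h₂ : r₂ ≤ 𝒢.minCut {𝒢.source₂}) (h₁₂ : C ≤ 𝒢.minCut {𝒢.source₁, 𝒢.source₂})
    (hC : r₁ + r₂ = C) {Γ₁ : Matrix (Fin n₁) (Fin r₁) K} {Γ₂ : Matrix (Fin n₂) (Fin r₂) K}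
    {P₁ : Matrix (Fin r₁) (Fin n₁) K} {P₂ : Matrix (Fin r₂) (Fin n₂) K} (hP₁ : P₁ * Γ₁ = 1)
    (hP₂ : P₂ * Γ₂ = 1) :
    Nat.card {κ : CodingCoeffs F E n₁ n₂ // ¬ ∀ (w₁ : Fin r₁ → K) (w₂ : Fin r₂ → K),
      (𝒢.transfer₁ incoming κ).map i *ᵥ (Γ₁ *ᵥ w₁) +
        (𝒢.transfer₂ incoming κ).map i *ᵥ (Γ₂ *ᵥ w₂) = 0 → w₁ = 0 ∧ w₂ = 0} * Fintype.card F ≤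
      Fintype.card E * Nat.card (CodingCoeffs F E n₁ n₂) := by
  let s : Fin C ≃ Fin r₁ ⊕ Fin r₂ := Fintype.equivOfCardEq (by simp [hC])
  obtain ⟨a, b₁, b₂, hab⟩ := 𝒢.exists_flowMatrix_injective incoming h₁ h₂ h₁₂ hC hP₁ hP₂
  have hp : 𝒢.flowPolynomial incoming s Γ₁ Γ₂ ≠ 0 := by
    intro hp
    have := 𝒢.eval_flowPolynomial incoming s Γ₁ Γ₂ (a, b₁, b₂)
    rw [hp, map_zero] at this
    exact (mulVec_injective_iff_det_ne_zero _ _).1 hab this.symm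
  have key := card_eval_eq_zero_mul_card_le i hp
  rw [← Nat.card_congr (coeffsEquiv F E n₁ n₂)] at key
  refine le_trans (Nat.mul_le_mul_right _ ?_) (key.trans (Nat.mul_le_mul_right _
    (𝒢.totalDegree_flowPolynomial_le incoming s Γ₁ Γ₂)))
  refine Nat.card_le_card_of_injective (fun κ => ⟨coeffsEquiv F E n₁ n₂ κ.1, ?_⟩) ?_
  · by_contra h
    refine κ.2 (𝒢.eq_zero_of_flowMatrix_injective incoming i Γ₁ Γ₂ κ.1 ?_)
    rw [mulVec_injective_iff_det_ne_zero _ (Equiv.sumCongr (Equiv.refl E) s)]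
    have := 𝒢.eval_flowPolynomial incoming s Γ₁ Γ₂
      (κ.1.relay.map i, κ.1.inject₁.map i, κ.1.inject₂.map i)
    rw [← this]
    convert h using 3
    funext v
    rcases v with v | v | v <;> rfl
  · intro κ κ' h
    exact Subtype.ext ((coeffsEquiv F E n₁ n₂).injective (Subtype.ext_iff.1 h))

end Bound

end Network

/-! ### The basis of the larger field -/

namespace CodePair

variable {F K L : Type*} [Field F] [Field K] [Field L] [Algebra F K] [Algebra K L]
  {R₁ R₂ z k C : ℕ} (𝒞 : CodePair F K L R₁ R₂ z)

theorem coordK_eq (x : K) : 𝒞.coordK x = coord 𝒞.a x := rfl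

theorem coordL_of_lt (x : L) {s : ℕ} (hs : s < R₂ + 2 * z) (l : ℕ) :
    𝒞.coordL x s l = coord 𝒞.a (𝒞.b.repr x ⟨s, hs⟩) l := by
  simp [coordL, padZero, hs, coordK_eq]

variable [Algebra F L] [IsScalarTower F K L]

/-- The products of the two bases; the index of `a l • b s` is `l + (R₁ + 2 * z) * s`. -/
noncomputable def basisL : Module.Basis (Fin ((R₂ + 2 * z) * (R₁ + 2 * z))) F L :=
  (𝒞.a.smulTower 𝒞.b).reindex ((Equiv.prodComm _ _).trans finProdFinEquiv)

theorem lt_mul {s l m n : ℕ} (hs : s < m) (hl : l < n) : l + n * s < m * n := by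
  calc l + n * s < n + n * s := by omega
    _ = n * (s + 1) := by ring
    _ ≤ n * m := Nat.mul_le_mul_left _ hs
    _ = m * n := Nat.mul_comm _ _

theorem exists_eq_add_mul {u m n : ℕ} (hu : u < m * n) : ∃ s < m, ∃ l < n, u = l + n * s := by
  have hn : 0 < n := Nat.pos_of_ne_zero fun h => by simp [h] at hu
  exact ⟨u / n, Nat.div_lt_of_lt_mul (by rwa [Nat.mul_comm] at hu), u % n, Nat.mod_lt _ hn,
    (Nat.mod_add_div u n).symm⟩

theorem add_mul_inj {s l s' l' n : ℕ} (hl : l < n) (hl' : l' < n) :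
    l + n * s = l' + n * s' ↔ l = l' ∧ s = s' := by
  refine ⟨fun h => ?_, fun h => by rw [h.1, h.2]⟩
  have hn : 0 < n := by omega
  have h1 : (l + n * s) % n = (l' + n * s') % n := by rw [h]
  have h2 : (l + n * s) / n = (l' + n * s') / n := by rw [h]
  rw [Nat.add_mul_mod_self_left, Nat.add_mul_mod_self_left, Nat.mod_eq_of_lt hl,
    Nat.mod_eq_of_lt hl'] at h1
  rw [Nat.add_mul_div_left _ _ hn, Nat.add_mul_div_left _ _ hn, Nat.div_eq_of_lt hl,
    Nat.div_eq_of_lt hl'] at h2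
  omega

theorem coord_basisL (x : L) {s l : ℕ} (hs : s < R₂ + 2 * z) (hl : l < R₁ + 2 * z) :
    coord 𝒞.basisL x (l + (R₁ + 2 * z) * s) = coord 𝒞.a (𝒞.b.repr x ⟨s, hs⟩) l := by
  rw [coord_of_lt _ _ (lt_mul hs hl), coord_of_lt _ _ hl, basisL, Module.Basis.repr_reindex_apply]
  have h : ((Equiv.prodComm _ _).trans finProdFinEquiv).symm
      (⟨l + (R₁ + 2 * z) * s, lt_mul hs hl⟩ : Fin ((R₂ + 2 * z) * (R₁ + 2 * z))) =
      ((⟨l, hl⟩ : Fin (R₁ + 2 * z)), (⟨s, hs⟩ : Fin (R₂ + 2 * z))) := by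
    rw [Equiv.symm_apply_eq]
    rfl
  rw [h, Module.Basis.smulTower_repr]

theorem basisElt_basisL {s l : ℕ} (hs : s < R₂ + 2 * z) (hl : l < R₁ + 2 * z) :
    basisElt 𝒞.basisL (l + (R₁ + 2 * z) * s) = 𝒞.a ⟨l, hl⟩ • 𝒞.b ⟨s, hs⟩ := by
  rw [← show ((⟨l + (R₁ + 2 * z) * s, lt_mul hs hl⟩ : Fin ((R₂ + 2 * z) * (R₁ + 2 * z))) : ℕ) =
    l + (R₁ + 2 * z) * s from rfl, basisElt_fin, basisL, Module.Basis.reindex_apply]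
  have h : ((Equiv.prodComm _ _).trans finProdFinEquiv).symm
      (⟨l + (R₁ + 2 * z) * s, lt_mul hs hl⟩ : Fin ((R₂ + 2 * z) * (R₁ + 2 * z))) =
      ((⟨l, hl⟩ : Fin (R₁ + 2 * z)), (⟨s, hs⟩ : Fin (R₂ + 2 * z))) := by
    rw [Equiv.symm_apply_eq]
    rfl
  rw [h, Module.Basis.smulTower_apply]

/-- A matrix, extended by zero. -/
def _root_.padMatrix {α : Type*} [Zero α] {m n : ℕ} (M : Matrix (Fin m) (Fin n) α) (i j : ℕ) : α :=
  padZero (fun i' => padZero (M i') j) i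

theorem _root_.padMatrix_fin {α : Type*} [Zero α] {m n : ℕ} (M : Matrix (Fin m) (Fin n) α)
    (i : Fin m) (j : Fin n) : padMatrix M i j = M i j := by simp [padMatrix, padZero]

theorem _root_.padZero_fin {α : Type*} [Zero α] {n : ℕ} (f : Fin n → α) (i : Fin n) :
    padZero f i = f i := by simp [padZero]

/-- The code points at the receiver. -/
noncomputable def _root_.receivedPoints {A : Type*} [AddCommMonoid A] [Module F A] {n : ℕ}
    (T : Matrix (Fin C) (Fin n) F) (g : Fin n → A) : ℕ → A :=
  padZero fun i => ∑ i', T i i' • g i'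

/-- The generator matrix at the receiver. -/
noncomputable def _root_.receivedGenerator {A : Type*} [AddCommMonoid A] [Module F A] {n R : ℕ}
    (T : Matrix (Fin C) (Fin n) F) (G : Matrix (Fin n) (Fin R) A) : ℕ → ℕ → A :=
  padMatrix (Matrix.of fun i j => ∑ i', T i i' • G i' j)

end CodePair

/-- Used to invert the flat index l + n s, which determines (l, s) only when l < n. Distinctness of
the loop variables excludes a later rebinding. -/
theorem Program.InLoops.lt {vs : List (ℕ × IndexExpr)} {ρ₀ ρ ρ' : ℕ → ℕ}
    (h : Program.InLoops vs ρ ρ') (hρ : SameParams ρ₀ ρ) (hv : ∀ x ∈ vs, 4 ≤ x.1)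
    (hnd : (vs.map Prod.fst).Nodup) {v : ℕ} {t : IndexExpr} {n : ℕ} (hx : (v, t) ∈ vs)
    (ht : t.Denotes ρ₀ n) : ρ' v < n := by
  induction vs generalizing ρ with
  | nil => simp at hx
  | cons y vs ih =>
    obtain ⟨w, t'⟩ := y
    obtain ⟨i, hi, h⟩ := h
    rw [List.map_cons, List.nodup_cons] at hnd
    rcases List.mem_cons.1 hx with hx | hx
    · obtain ⟨rfl, rfl⟩ := Prod.mk.inj hx
      rw [h.eq_of_notMem, Function.update_self, ← ht ρ hρ]
      · exact hi
      · intro x hx' hxv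
        exact hnd.1 (List.mem_map.2 ⟨x, hx', hxv⟩)
    · exact ih h ((sameParams_update (hv _ List.mem_cons_self)).2 hρ)
        (fun x hx => hv x (List.mem_cons_of_mem _ hx)) hnd.2 hx

/-! ### The decoder -/

section Setup

open Program Term Arrays

/-- The degree of the smaller extension. -/
def degK : IndexExpr := .add (ix 0) (.mul (.const 2) (ix 2))

/-- The degree of the larger extension. -/
def degL : IndexExpr := .add (ix 1) (.mul (.const 2) (ix 2))

/-- The degree of the whole extension. -/
def degTotal : IndexExpr := .mul degL degK

/-- The number of received packets. -/
def packetCount : IndexExpr := .add (.add (ix 0) (ix 1)) (.mul (.const 2) (ix 2))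

/-- The index of an element of the product basis. -/
def flat (s l : ℕ) : IndexExpr := .add (ix l) (.mul degK (ix s))

/-- Prepares the decoding of the second message. -/
def setupL : Program :=
  seq (fill [(10, degL), (11, degK), (12, degL), (13, degK), (14, degL), (15, degK)] table
    [flat 10 11, flat 12 13, flat 14 15]
    (sum 16 degK (sum 17 degK (mul (mul (cell 0 [ix 11, ix 13, ix 16])
      (cell 1 [ix 10, ix 12, ix 14, ix 17])) (cell 0 [ix 16, ix 17, ix 15]))))) <|
  seq (fill [(10, degL), (11, degK), (12, degL), (13, degK)] frob [flat 10 11, flat 12 13]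
    (sum 16 degK (mul (cell 3 [ix 10, ix 12, ix 16]) (cell 0 [ix 11, ix 16, ix 13])))) <|
  seq (fill [(10, packetCount), (11, degL), (12, degK)] points [ix 10, flat 11 12]
    (sum 13 degL (mul (cell 9 [ix 10, ix 13]) (cell 5 [ix 13, ix 11, ix 12])))) <|
  seq (fill [(10, packetCount), (11, ix 1), (12, degL), (13, degK)] generator
    [ix 10, ix 11, flat 12 13]
    (sum 14 degL (mul (cell 9 [ix 10, ix 14]) (cell 7 [ix 14, ix 11, ix 12, ix 13])))) <|
  seq (fill [(10, packetCount), (11, ix 0), (12, degL), (13, degK)] nuisance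
    [ix 10, ix 11, flat 12 13] zero) <|
  fill [(10, packetCount), (11, ix 0), (12, degK)] nuisance [ix 10, ix 11, ix 12]
    (sum 13 degK (mul (cell 8 [ix 10, ix 13]) (cell 6 [ix 13, ix 11, ix 12])))

/-- Prepares the decoding of the first message. -/
def setupK : Program :=
  seq (fill [(10, degK), (11, degK), (12, degK)] table [ix 10, ix 11, ix 12]
    (cell 0 [ix 10, ix 11, ix 12])) <|
  seq (fill [(10, degK), (11, degK)] frob [ix 10, ix 11] (cell 2 [ix 10, ix 11])) <|
  seq (fill [(10, packetCount), (11, degK)] points [ix 10, ix 11]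
    (sum 13 degK (mul (cell 8 [ix 10, ix 13]) (cell 4 [ix 13, ix 11])))) <|
  fill [(10, packetCount), (11, ix 0), (12, degK)] generator [ix 10, ix 11, ix 12]
    (sum 13 degK (mul (cell 8 [ix 10, ix 13]) (cell 6 [ix 13, ix 11, ix 12])))

theorem noWrite_setupL {n : ℕ} (hn : n ∉ [13, 20, 21, 22, 23, 24]) : setupL.NoWrite n := by
  refine ⟨noWrite_fill ?_ ?_, noWrite_fill ?_ ?_, noWrite_fill ?_ ?_, noWrite_fill ?_ ?_,
    noWrite_fill ?_ ?_, noWrite_fill ?_ ?_⟩ <;> (rintro rfl; exact hn (by decide))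

theorem noWrite_setupK {n : ℕ} (hn : n ∉ [13, 20, 21, 22, 23]) : setupK.NoWrite n := by
  refine ⟨noWrite_fill ?_ ?_, noWrite_fill ?_ ?_, noWrite_fill ?_ ?_, noWrite_fill ?_ ?_⟩ <;>
    (rintro rfl; exact hn (by decide))

section Denotes

variable (R₁ R₂ z k : ℕ)

theorem denotes_degK : degK.Denotes (CodePair.params R₁ R₂ z k) (R₁ + 2 * z) := fun ρ hρ => by
  simp [degK, IndexExpr.eval, hρ 0 (by decide), hρ 2 (by decide), CodePair.params]

theorem denotes_degL : degL.Denotes (CodePair.params R₁ R₂ z k) (R₂ + 2 * z) := fun ρ hρ => by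
  simp [degL, IndexExpr.eval, hρ 1 (by decide), hρ 2 (by decide), CodePair.params]

theorem denotes_degTotal : degTotal.Denotes (CodePair.params R₁ R₂ z k)
    ((R₂ + 2 * z) * (R₁ + 2 * z)) := fun ρ hρ => by
  simp [degTotal, IndexExpr.eval, denotes_degK R₁ R₂ z k ρ hρ, denotes_degL R₁ R₂ z k ρ hρ]

theorem denotes_packetCount :
    packetCount.Denotes (CodePair.params R₁ R₂ z k) (R₁ + R₂ + 2 * z) := fun ρ hρ => by
  simp [packetCount, IndexExpr.eval, hρ 0 (by decide), hρ 1 (by decide), hρ 2 (by decide),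
    CodePair.params]

theorem denotes_rate₁ : (ix 0).Denotes (CodePair.params R₁ R₂ z k) R₁ := fun _ hρ =>
  hρ 0 (by decide)

theorem denotes_rate₂ : (ix 1).Denotes (CodePair.params R₁ R₂ z k) R₂ := fun _ hρ =>
  hρ 1 (by decide)

theorem denotes_errors : (ix 2).Denotes (CodePair.params R₁ R₂ z k) z := fun _ hρ =>
  hρ 2 (by decide)

theorem denotes_blocks : (ix 3).Denotes (CodePair.params R₁ R₂ z k) k := fun _ hρ =>
  hρ 3 (by decide)

end Denotes

variable {F K L : Type*} [Field F] [Field K] [Field L] [Algebra F K] [Algebra K L]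
  {R₁ R₂ z k : ℕ} (𝒞 : CodePair F K L R₁ R₂ z)
  (T₁ : Matrix (Fin (R₁ + R₂ + 2 * z)) (Fin (R₁ + 2 * z)) F)
  (T₂ : Matrix (Fin (R₁ + R₂ + 2 * z)) (Fin (R₂ + 2 * z)) F)
  (Y : Matrix (Fin (R₁ + R₂ + 2 * z)) (PacketIdx R₁ R₂ z k) F)

theorem coord_receivedPoints {A : Type*} [Field A] [Algebra F A] {m C n : ℕ}
    (e : Module.Basis (Fin m) F A) (T : Matrix (Fin C) (Fin n) F) (g : Fin n → A) {i : ℕ}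
    (hi : i < C) (l : ℕ) : coord e (receivedPoints T g i) l =
      ∑ u ∈ Finset.range n, padMatrix T i u * padZero (fun u' => coord e (g u') l) u := by
  rw [Finset.sum_range, receivedPoints, padZero, dif_pos hi, coord_sum]
  simp [coord_smul, padMatrix, padZero, hi]

theorem coord_receivedGenerator {A : Type*} [Field A] [Algebra F A] {m C n R : ℕ}
    (e : Module.Basis (Fin m) F A) (T : Matrix (Fin C) (Fin n) F) (G : Matrix (Fin n) (Fin R) A)
    {i j : ℕ} (hi : i < C) (hj : j < R) (l : ℕ) : coord e (receivedGenerator T G i j) l =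
      ∑ u ∈ Finset.range n,
        padMatrix T i u * padZero (fun u' => coord e (G u' ⟨j, hj⟩) l) u := by
  rw [Finset.sum_range, receivedGenerator, padMatrix, padZero, dif_pos hi, padZero, dif_pos hj,
    Matrix.of_apply, coord_sum]
  simp [coord_smul, padMatrix, padZero, hi]

/-- What the decoder of the first message needs to know about the memory. -/
structure IsSetupK (φ : K →ₗ[F] K) (σ : Memory F) : Prop where
  table : ∀ u < R₁ + 2 * z, ∀ w < R₁ + 2 * z, ∀ l < R₁ + 2 * z,
    σ [table, u, w, l] = coord 𝒞.a (basisElt 𝒞.a u * basisElt 𝒞.a w) l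
  frob : ∀ u < R₁ + 2 * z, ∀ l < R₁ + 2 * z, σ [frob, u, l] = coord 𝒞.a (φ (basisElt 𝒞.a u)) l
  points : ∀ i < R₁ + R₂ + 2 * z, ∀ l < R₁ + 2 * z,
    σ [points, i, l] = coord 𝒞.a (receivedPoints T₁ 𝒞.g₁ i) l
  generator : ∀ i < R₁ + R₂ + 2 * z, ∀ j < R₁, ∀ l < R₁ + 2 * z,
    σ [generator, i, j, l] = coord 𝒞.a (receivedGenerator T₁ 𝒞.G₁ i j) l

theorem setupK_spec {ρ : ℕ → ℕ} (hρ : SameParams (CodePair.params R₁ R₂ z k) ρ) {φ : K →ₗ[F] K}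
    (hφ : ∀ x, φ x = x ^ Nat.card F) {σ : Memory F}
    (hσ : ∀ n ≤ 10, ∀ a, σ (n :: a) = 𝒞.input T₁ T₂ Y (n :: a)) :
    IsSetupK 𝒞 T₁ φ (setupK.sem ρ σ) := by
  unfold setupK
  simp only [sem_seq]
  generalize hσ₁ : (fill _ table _ _).sem ρ σ = σ₁
  generalize hσ₂ : (fill _ frob _ _).sem ρ σ₁ = σ₂
  generalize hσ₃ : (fill _ points _ _).sem ρ σ₂ = σ₃
  generalize hσ₄ : (fill _ generator _ _).sem ρ σ₃ = σ₄
  have f₁ : ∀ n ∉ [13, 20], ∀ x, σ₁ (n :: x) = σ (n :: x) := fun n h x => by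
    rw [← hσ₁, sem_of_noWrite (noWrite_fill _ _)] <;> (rintro rfl; exact h (by decide))
  have f₂ : ∀ n ∉ [13, 21], ∀ x, σ₂ (n :: x) = σ₁ (n :: x) := fun n h x => by
    rw [← hσ₂, sem_of_noWrite (noWrite_fill _ _)] <;> (rintro rfl; exact h (by decide))
  have f₃ : ∀ n ∉ [13, 22], ∀ x, σ₃ (n :: x) = σ₂ (n :: x) := fun n h x => by
    rw [← hσ₃, sem_of_noWrite (noWrite_fill _ _)] <;> (rintro rfl; exact h (by decide))
  have f₄ : ∀ n ∉ [13, 23], ∀ x, σ₄ (n :: x) = σ₃ (n :: x) := fun n h x => by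
    rw [← hσ₄, sem_of_noWrite (noWrite_fill _ _)] <;> (rintro rfl; exact h (by decide))
  have hK := denotes_degK R₁ R₂ z k
  have hC := denotes_packetCount R₁ R₂ z k
  have h1 := denotes_rate₁ R₁ R₂ z k
  unfold IndexExpr.Denotes at *
  constructor
  · intro u hu w hw l hl
    rw [f₄ _ (by decide), f₃ _ (by decide), f₂ _ (by decide), ← hσ₁, sem_fill_eq σ
      (Function.update (Function.update (Function.update ρ 10 u) 11 w) 12 l)]
    · simp [Term.eval, IndexExpr.eval, hσ, CodePair.input, padZero, hu, hw, CodePair.coordK_eq,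
        basisElt]
    · decide
    · simp [Term.Reads]
    · simp [Term.Reads]
    · exact ⟨u, by simp [hK, hρ, hu], w, by simp [hK, hρ, hw], l, by simp [hK, hρ, hl], rfl⟩
    · simp [IndexExpr.eval]
    · intro ρ' _; simp [IndexExpr.eval]
  · intro u hu l hl
    rw [f₄ _ (by decide), f₃ _ (by decide), ← hσ₂, sem_fill_eq σ₁
      (Function.update (Function.update ρ 10 u) 11 l)]
    · simp [Term.eval, IndexExpr.eval, f₁, hσ, CodePair.input, padZero, hu, CodePair.coordK_eq,
        basisElt, hφ]
    · decide
    · simp [Term.Reads]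
    · simp [Term.Reads]
    · exact ⟨u, by simp [hK, hρ, hu], l, by simp [hK, hρ, hl], rfl⟩
    · simp [IndexExpr.eval]
    · intro ρ' _; simp [IndexExpr.eval]
  · intro i hi l hl
    rw [f₄ _ (by decide), ← hσ₃, sem_fill_eq σ₂ (Function.update (Function.update ρ 10 i) 11 l),
      coord_receivedPoints _ _ _ hi]
    · simp [Term.eval, IndexExpr.eval, f₁, f₂, hσ, CodePair.input, padMatrix, padZero, hi,
        CodePair.coordK_eq, hK, hρ, apply_dite, dite_apply]
    · decide
    · simp [Term.Reads]
    · simp [Term.Reads]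
    · exact ⟨i, by simp [hC, hρ, hi], l, by simp [hK, hρ, hl], rfl⟩
    · simp [IndexExpr.eval]
    · intro ρ' _; simp [IndexExpr.eval]
  · intro i hi j hj l hl
    rw [← hσ₄, sem_fill_eq σ₃ (Function.update (Function.update (Function.update ρ 10 i) 11 j) 12 l),
      coord_receivedGenerator _ _ _ hi hj]
    · simp [Term.eval, IndexExpr.eval, f₁, f₂, f₃, hσ, CodePair.input, padMatrix, padZero, hi, hj,
        CodePair.coordK_eq, hK, hρ, dite_apply]
    · decide
    · simp [Term.Reads]
    · simp [Term.Reads]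
    · exact ⟨i, by simp [hC, hρ, hi], j, by simp [h1, hρ, hj], l, by simp [hK, hρ, hl], rfl⟩
    · simp [IndexExpr.eval]
    · intro ρ' _; simp [IndexExpr.eval]

variable [Algebra F L] [IsScalarTower F K L]

/-- What the decoder of the second message needs to know about the memory. -/
structure IsSetupL (φ : L →ₗ[K] L) (β : L) (σ : Memory F) : Prop where
  table : ∀ u < (R₂ + 2 * z) * (R₁ + 2 * z), ∀ w < (R₂ + 2 * z) * (R₁ + 2 * z),
    ∀ l < (R₂ + 2 * z) * (R₁ + 2 * z),
    σ [table, u, w, l] = coord 𝒞.basisL (basisElt 𝒞.basisL u * basisElt 𝒞.basisL w) l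
  frob : ∀ u < (R₂ + 2 * z) * (R₁ + 2 * z), ∀ l < (R₂ + 2 * z) * (R₁ + 2 * z),
    σ [frob, u, l] = coord 𝒞.basisL (φ (basisElt 𝒞.basisL u)) l
  points : ∀ i < R₁ + R₂ + 2 * z, ∀ l < (R₂ + 2 * z) * (R₁ + 2 * z),
    σ [points, i, l] = coord 𝒞.basisL (receivedPoints T₂ 𝒞.g₂ i) l
  generator : ∀ i < R₁ + R₂ + 2 * z, ∀ j < R₂, ∀ l < (R₂ + 2 * z) * (R₁ + 2 * z),
    σ [generator, i, j, l] = coord 𝒞.basisL (receivedGenerator T₂ 𝒞.G₂ i j) l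
  nuisance : ∀ i < R₁ + R₂ + 2 * z, ∀ j < R₁, ∀ l < (R₂ + 2 * z) * (R₁ + 2 * z),
    σ [nuisance, i, j, l] = coord 𝒞.basisL (receivedGenerator T₁ 𝒞.G₁ i j • β) l

/-- On products of basis elements, multiplication separates into the two tables, and φ(a_u b_s) =
a_u φ(b_s) by K-linearity. The element β is the basis element b₀, since the coordinates of c b₀ are
those of c in the first block and zero elsewhere; no coordinates of 1 have to be known. -/
theorem setupL_spec {ρ : ℕ → ℕ} (hρ : SameParams (CodePair.params R₁ R₂ z k) ρ) {φ : L →ₗ[K] L}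
    (hφ : ∀ x, φ x = x ^ Nat.card K) (hL : 0 < R₂ + 2 * z) :
    IsSetupL 𝒞 T₁ T₂ φ (𝒞.b ⟨0, hL⟩) (setupL.sem ρ (𝒞.input T₁ T₂ Y)) := by
  unfold setupL
  simp only [sem_seq]
  generalize hσ : 𝒞.input T₁ T₂ Y = σ
  generalize hσ₁ : (fill _ table _ _).sem ρ σ = σ₁
  generalize hσ₂ : (fill _ frob _ _).sem ρ σ₁ = σ₂
  generalize hσ₃ : (fill _ points _ _).sem ρ σ₂ = σ₃
  generalize hσ₄ : (fill _ generator _ _).sem ρ σ₃ = σ₄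
  generalize hσ₅ : (fill _ nuisance _ _).sem ρ σ₄ = σ₅
  generalize hσ₆ : (fill _ nuisance _ _).sem ρ σ₅ = σ₆
  have f₁ : ∀ n ∉ [13, 20], ∀ x, σ₁ (n :: x) = σ (n :: x) := fun n h x => by
    rw [← hσ₁, sem_of_noWrite (noWrite_fill _ _)] <;> (rintro rfl; exact h (by decide))
  have f₂ : ∀ n ∉ [13, 21], ∀ x, σ₂ (n :: x) = σ₁ (n :: x) := fun n h x => by
    rw [← hσ₂, sem_of_noWrite (noWrite_fill _ _)] <;> (rintro rfl; exact h (by decide))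
  have f₃ : ∀ n ∉ [13, 22], ∀ x, σ₃ (n :: x) = σ₂ (n :: x) := fun n h x => by
    rw [← hσ₃, sem_of_noWrite (noWrite_fill _ _)] <;> (rintro rfl; exact h (by decide))
  have f₄ : ∀ n ∉ [13, 23], ∀ x, σ₄ (n :: x) = σ₃ (n :: x) := fun n h x => by
    rw [← hσ₄, sem_of_noWrite (noWrite_fill _ _)] <;> (rintro rfl; exact h (by decide))
  have f₅ : ∀ n ∉ [13, 24], ∀ x, σ₅ (n :: x) = σ₄ (n :: x) := fun n h x => by
    rw [← hσ₅, sem_of_noWrite (noWrite_fill _ _)] <;> (rintro rfl; exact h (by decide))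
  have f₆ : ∀ n ∉ [13, 24], ∀ x, σ₆ (n :: x) = σ₅ (n :: x) := fun n h x => by
    rw [← hσ₆, sem_of_noWrite (noWrite_fill _ _)] <;> (rintro rfl; exact h (by decide))
  have hdK := denotes_degK R₁ R₂ z k
  have hdL := denotes_degL R₁ R₂ z k
  have hdC := denotes_packetCount R₁ R₂ z k
  have hd1 := denotes_rate₁ R₁ R₂ z k
  have hd2 := denotes_rate₂ R₁ R₂ z k
  have hK := hdK
  have hL' := hdL
  have hC := hdC
  have h1 := hd1
  have h2 := hd2
  unfold IndexExpr.Denotes at hK hL' hC h1 h2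
  constructor
  · intro u hu' w hw' l hl'
    obtain ⟨s, hs, u, hu, rfl⟩ := CodePair.exists_eq_add_mul hu'
    obtain ⟨t, ht, w, hw, rfl⟩ := CodePair.exists_eq_add_mul hw'
    obtain ⟨r, hr, l, hl, rfl⟩ := CodePair.exists_eq_add_mul hl'
    rw [f₆ _ (by decide), f₅ _ (by decide), f₄ _ (by decide), f₃ _ (by decide), f₂ _ (by decide),
      ← hσ₁, sem_fill_eq σ (Function.update (Function.update (Function.update (Function.update
        (Function.update (Function.update ρ 10 s) 11 u) 12 t) 13 w) 14 r) 15 l)]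
    · rw [𝒞.basisElt_basisL hs hu, 𝒞.basisElt_basisL ht hw, 𝒞.coord_basisL _ hr hl,
        smul_mul_smul_comm, map_smul, Finsupp.smul_apply, smul_eq_mul, coord_mul]
      simp only [Term.eval, hK, sameParams_update, hρ, Nat.reduceLeDiff]
      refine Finset.sum_congr rfl fun x hx => Finset.sum_congr rfl fun y hy => ?_
      rw [Finset.mem_range] at hx hy
      simp [IndexExpr.eval, ← hσ, CodePair.input, padZero, hu, hw, hs, ht, hr, hx, hy,
        CodePair.coordK_eq, CodePair.coordL, basisElt]
    · decide
    · simp [Term.Reads]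
    · simp [Term.Reads]
    · exact ⟨s, by simp [hL', hρ, hs], u, by simp [hK, hρ, hu], t, by simp [hL', hρ, ht], w,
        by simp [hK, hρ, hw], r, by simp [hL', hρ, hr], l, by simp [hK, hρ, hl], rfl⟩
    · simp [flat, IndexExpr.eval, hK, hρ]
    · intro ρ' h' he
      have hs' := h'.sameParams (by simp) hρ
      have b₁ := h'.lt hρ (by simp) (by decide) (v := 11) (by simp) hdK
      have b₂ := h'.lt hρ (by simp) (by decide) (v := 13) (by simp) hdK
      have b₃ := h'.lt hρ (by simp) (by decide) (v := 15) (by simp) hdK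
      simp only [flat, IndexExpr.eval, List.map_cons, List.map_nil, hK ρ' hs', List.cons.injEq,
        CodePair.add_mul_inj b₁ hu, CodePair.add_mul_inj b₂ hw, CodePair.add_mul_inj b₃ hl] at he
      simp [he]
  · intro u hu' l hl'
    obtain ⟨s, hs, u, hu, rfl⟩ := CodePair.exists_eq_add_mul hu'
    obtain ⟨r, hr, l, hl, rfl⟩ := CodePair.exists_eq_add_mul hl'
    rw [f₆ _ (by decide), f₅ _ (by decide), f₄ _ (by decide), f₃ _ (by decide),
      ← hσ₂, sem_fill_eq σ₁ (Function.update (Function.update (Function.update (Function.update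
        ρ 10 s) 11 u) 12 r) 13 l)]
    · rw [𝒞.basisElt_basisL hs hu, 𝒞.coord_basisL _ hr hl, map_smul, map_smul, Finsupp.smul_apply,
        smul_eq_mul, ← basisElt_fin, coord_basisElt_mul]
      simp only [Term.eval, hK, sameParams_update, hρ, Nat.reduceLeDiff]
      refine Finset.sum_congr rfl fun x hx => ?_
      rw [Finset.mem_range] at hx
      simp [IndexExpr.eval, f₁, ← hσ, CodePair.input, padZero, hu, hs, hr, hx,
        CodePair.coordK_eq, CodePair.coordL, basisElt, hφ]
    · decide
    · simp [Term.Reads]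
    · simp [Term.Reads]
    · exact ⟨s, by simp [hL', hρ, hs], u, by simp [hK, hρ, hu], r, by simp [hL', hρ, hr], l,
        by simp [hK, hρ, hl], rfl⟩
    · simp [flat, IndexExpr.eval, hK, hρ]
    · intro ρ' h' he
      have hs' := h'.sameParams (by simp) hρ
      have b₁ := h'.lt hρ (by simp) (by decide) (v := 11) (by simp) hdK
      have b₂ := h'.lt hρ (by simp) (by decide) (v := 13) (by simp) hdK
      simp only [flat, IndexExpr.eval, List.map_cons, List.map_nil, hK ρ' hs', List.cons.injEq,
        CodePair.add_mul_inj b₁ hu, CodePair.add_mul_inj b₂ hl] at he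
      simp [he]
  · intro i hi l hl'
    obtain ⟨r, hr, l, hl, rfl⟩ := CodePair.exists_eq_add_mul hl'
    rw [f₆ _ (by decide), f₅ _ (by decide), f₄ _ (by decide), ← hσ₃, sem_fill_eq σ₂
      (Function.update (Function.update (Function.update ρ 10 i) 11 r) 12 l),
      coord_receivedPoints _ _ _ hi]
    · simp only [Term.eval, hL', sameParams_update, hρ, Nat.reduceLeDiff]
      refine Finset.sum_congr rfl fun x hx => ?_
      rw [Finset.mem_range] at hx
      simp [IndexExpr.eval, f₁, f₂, ← hσ, CodePair.input, padMatrix, padZero, hi, hx, hr,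
        𝒞.coord_basisL _ hr hl, CodePair.coordL_of_lt]
    · decide
    · simp [Term.Reads]
    · simp [Term.Reads]
    · exact ⟨i, by simp [hC, hρ, hi], r, by simp [hL', hρ, hr], l, by simp [hK, hρ, hl], rfl⟩
    · simp [flat, IndexExpr.eval, hK, hρ]
    · intro ρ' h' he
      have hs' := h'.sameParams (by simp) hρ
      have b₁ := h'.lt hρ (by simp) (by decide) (v := 12) (by simp) hdK
      simp only [flat, IndexExpr.eval, List.map_cons, List.map_nil, hK ρ' hs', List.cons.injEq,
        CodePair.add_mul_inj b₁ hl] at he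
      simp [he]
  · intro i hi j hj l hl'
    obtain ⟨r, hr, l, hl, rfl⟩ := CodePair.exists_eq_add_mul hl'
    rw [f₆ _ (by decide), f₅ _ (by decide), ← hσ₄, sem_fill_eq σ₃
      (Function.update (Function.update (Function.update (Function.update ρ 10 i) 11 j) 12 r) 13 l),
      coord_receivedGenerator _ _ _ hi hj]
    · simp only [Term.eval, hL', sameParams_update, hρ, Nat.reduceLeDiff]
      refine Finset.sum_congr rfl fun x hx => ?_
      rw [Finset.mem_range] at hx
      simp [IndexExpr.eval, f₁, f₂, f₃, ← hσ, CodePair.input, padMatrix, padZero, hi, hj, hx, hr,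
        𝒞.coord_basisL _ hr hl, CodePair.coordL_of_lt]
    · decide
    · simp [Term.Reads]
    · simp [Term.Reads]
    · exact ⟨i, by simp [hC, hρ, hi], j, by simp [h2, hρ, hj], r, by simp [hL', hρ, hr], l,
        by simp [hK, hρ, hl], rfl⟩
    · simp [flat, IndexExpr.eval, hK, hρ]
    · intro ρ' h' he
      have hs' := h'.sameParams (by simp) hρ
      have b₁ := h'.lt hρ (by simp) (by decide) (v := 13) (by simp) hdK
      simp only [flat, IndexExpr.eval, List.map_cons, List.map_nil, hK ρ' hs', List.cons.injEq,
        CodePair.add_mul_inj b₁ hl] at he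
      simp [he]
  · intro i hi j hj l hl'
    obtain ⟨r, hr, l, hl, rfl⟩ := CodePair.exists_eq_add_mul hl'
    rw [𝒞.coord_basisL _ hr hl, map_smul, 𝒞.b.repr_self, Finsupp.smul_apply, smul_eq_mul,
      Finsupp.single_apply, ← hσ₆]
    by_cases hr0 : r = 0
    · subst hr0
      rw [sem_fill_eq σ₅ (Function.update (Function.update (Function.update ρ 10 i) 11 j) 12 l),
        if_pos rfl, mul_one, coord_receivedGenerator _ _ _ hi hj]
      · simp [Term.eval, IndexExpr.eval, f₁, f₂, f₃, f₄, f₅, ← hσ, CodePair.input, padMatrix,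
          padZero, hi, hj, CodePair.coordK_eq, hK, hρ, dite_apply]
      · decide
      · simp [Term.Reads]
      · simp [Term.Reads]
      · exact ⟨i, by simp [hC, hρ, hi], j, by simp [h1, hρ, hj], l, by simp [hK, hρ, hl], rfl⟩
      · simp [IndexExpr.eval]
      · intro ρ' _; simp [IndexExpr.eval]
    · rw [if_neg (by simpa using Ne.symm hr0), mul_zero, coord_zero,
        sem_fill_of_ne (by decide) (by simp [Term.Reads]) (by simp [Term.Reads]), ← hσ₅, sem_fill_eq
        σ₄ (Function.update (Function.update (Function.update (Function.update ρ 10 i) 11 j) 12 r)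
          13 l)]
      · simp [Term.eval]
      · decide
      · simp [Term.Reads]
      · simp [Term.Reads]
      · exact ⟨i, by simp [hC, hρ, hi], j, by simp [h1, hρ, hj], r, by simp [hL', hρ, hr], l,
          by simp [hK, hρ, hl], rfl⟩
      · simp [flat, IndexExpr.eval, hK, hρ]
      · intro ρ' h' he
        have hs' := h'.sameParams (by simp) hρ
        have b₁ := h'.lt hρ (by simp) (by decide) (v := 13) (by simp) hdK
        simp only [flat, IndexExpr.eval, List.map_cons, List.map_nil, hK ρ' hs', List.cons.injEq,
          CodePair.add_mul_inj b₁ hl] at he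
        simp [he]
      · intro ρ' h' he
        have b₁ := h'.lt hρ (by simp) (by decide) (v := 12) (by simp) hdK
        simp only [IndexExpr.eval, List.map_cons, List.map_nil, List.cons.injEq] at he
        have := CodePair.add_mul_inj (s := 0) (s' := r) b₁ hl
        omega

end Setup

/-! ### The full decoder: second message, subtraction, first message -/

section Decoder

open Program Term Arrays

namespace Arrays

/-- What remains of the received words when the second message has been removed. -/
abbrev remainder : ℕ := 36

end Arrays

/-- Decodes one block of the second message and removes it from the received word. -/
def stepL : Program :=
  seq (fill [(10, packetCount), (11, degL), (12, degK)] word [ix 10, flat 11 12]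
    (cell 10 [ix 10, ix 4, ix 11, ix 12])) <|
  seq (decodeProgram degTotal packetCount (ix 2) (ix 1) (ix 0)) <|
  seq (fill [(10, ix 1), (11, degL), (12, degK)] 12 [ix 10, ix 4, ix 11, ix 12]
    (cell message [ix 10, flat 11 12])) <|
  fill [(10, packetCount), (11, degL), (12, degK)] remainder [ix 10, ix 4, ix 11, ix 12]
    (sub (cell word [ix 10, flat 11 12]) (sum 13 (ix 1) (sum 14 degTotal (sum 15 degTotal
      (mul (mul (cell message [ix 13, ix 14]) (cell generator [ix 10, ix 13, ix 15]))
        (cell table [ix 14, ix 15, flat 11 12]))))))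

/-- Decodes one block of the first message. -/
def stepK : Program :=
  seq (fill [(10, packetCount), (11, degK)] word [ix 10, ix 11]
    (cell remainder [ix 10, ix 4, ix 5, ix 11])) <|
  seq (decodeProgram degK packetCount (ix 2) (ix 0) (.const 0)) <|
  fill [(10, ix 0), (11, degK)] 11 [ix 10, ix 4, ix 5, ix 11] (cell message [ix 10, ix 11])

/-- The decoder of a coherent receiver. -/
def decoder : Program :=
  seq setupL <| seq (loop 4 (ix 3) stepL) <| seq setupK <| loop 4 (ix 3) <| loop 5 degL stepK

theorem noWrite_stepL {n : ℕ} (hn : n ∉ [12, 13, 25, 26, 27, 28, 29, 30, 31, 32, 33, 34, 35, 36]) :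
    stepL.NoWrite n := by
  simp only [List.mem_cons, List.not_mem_nil, or_false, not_or] at hn
  refine ⟨noWrite_fill ?_ ?_, noWrite_decodeProgram ?_, noWrite_fill ?_ ?_, noWrite_fill ?_ ?_⟩ <;>
    simp [scratch, word, remainder] <;> omega

theorem noWrite_stepK {n : ℕ} (hn : n ∉ [11, 13, 25, 26, 27, 28, 29, 30, 31, 32, 33, 34, 35]) :
    stepK.NoWrite n := by
  simp only [List.mem_cons, List.not_mem_nil, or_false, not_or] at hn
  refine ⟨noWrite_fill ?_ ?_, noWrite_decodeProgram ?_, noWrite_fill ?_ ?_⟩ <;>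
    simp [scratch, word] <;> omega

variable {F K L : Type*} [Field F] [Field K] [Field L] [Algebra F K] [Algebra K L]
  {R₁ R₂ z k : ℕ} (𝒞 : CodePair F K L R₁ R₂ z)
  (T₁ : Matrix (Fin (R₁ + R₂ + 2 * z)) (Fin (R₁ + 2 * z)) F)
  (T₂ : Matrix (Fin (R₁ + R₂ + 2 * z)) (Fin (R₂ + 2 * z)) F)
  (Y : Matrix (Fin (R₁ + R₂ + 2 * z)) (PacketIdx R₁ R₂ z k) F)

theorem IsSetupK.congr {φ : K →ₗ[F] K} {σ σ' : Memory F} (h : IsSetupK 𝒞 T₁ φ σ)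
    (hσ : ∀ n ∈ [20, 21, 22, 23], ∀ a, σ' (n :: a) = σ (n :: a)) : IsSetupK 𝒞 T₁ φ σ' := by
  constructor
  · intros; rw [hσ _ (by decide), h.table] <;> assumption
  · intros; rw [hσ _ (by decide), h.frob] <;> assumption
  · intros; rw [hσ _ (by decide), h.points] <;> assumption
  · intros; rw [hσ _ (by decide), h.generator] <;> assumption

theorem stepK_spec [Finite F] {ρ : ℕ → ℕ} (hρ : SameParams (CodePair.params R₁ R₂ z k) ρ)
    {φ : K →ₗ[F] K} {σ : Memory F} (hσ : IsSetupK 𝒞 T₁ φ σ) {κ : ℕ → ℕ → F} {y x : ℕ → K}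
    (hy : ∀ i < R₁ + R₂ + 2 * z, ∀ l < R₁ + 2 * z,
      σ [remainder, i, ρ 4, ρ 5, l] = coord 𝒞.a (y i) l)
    (hw : ReceivedWord φ (R₁ + R₂ + 2 * z) R₁ 0 z (receivedPoints T₁ 𝒞.g₁)
      (receivedGenerator T₁ 𝒞.G₁) κ y x) (i : ℕ) (hi : i < R₁) (j s l : ℕ) (hl : l < R₁ + 2 * z) :
    stepK.sem ρ σ [11, i, j, s, l] =
      if j = ρ 4 ∧ s = ρ 5 then coord 𝒞.a (x i) l else σ [11, i, j, s, l] := by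
  have hdK := denotes_degK R₁ R₂ z k
  have hdC := denotes_packetCount R₁ R₂ z k
  have hd1 := denotes_rate₁ R₁ R₂ z k
  have hK := hdK
  have hC := hdC
  have h1 := hd1
  unfold IndexExpr.Denotes at hK hC h1
  unfold stepK
  simp only [sem_seq]
  generalize hσ₁ : (fill _ word _ _).sem ρ σ = σ₁
  have f₁ : ∀ n ∉ [13, 25], ∀ x, σ₁ (n :: x) = σ (n :: x) := fun n h x => by
    rw [← hσ₁, sem_of_noWrite (noWrite_fill _ _)] <;> (rintro rfl; exact h (by decide))
  have hs₁ : IsSetupK 𝒞 T₁ φ σ₁ := hσ.congr 𝒞 T₁ fun n hn => f₁ n (by simp at hn ⊢; omega)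
  -- No interference is left, so r = 0. The stale nuisance array is then irrelevant and β can be any
  -- nonzero element.
  have hd := decodeProgram_spec 𝒞.a hdK hdC (denotes_errors R₁ R₂ z k) hd1
    (IndexExpr.denotes_const 0) hρ σ₁ φ y (receivedPoints T₁ 𝒞.g₁) (receivedGenerator T₁ 𝒞.G₁) κ
    (one_ne_zero (α := K)) x hs₁.table hs₁.frob hs₁.points hs₁.generator
    (fun _ _ _ h => absurd h (Nat.not_lt_zero _)) (fun i hi l hl => by
      rw [← hy i hi l hl, ← hσ₁, sem_fill_eq σ (Function.update (Function.update ρ 10 i) 11 l)]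
      · simp [Term.eval, IndexExpr.eval]
      · decide
      · simp [Term.Reads]
      · simp [Term.Reads]
      · exact ⟨i, by simp [hC, hρ, hi], l, by simp [hK, hρ, hl], rfl⟩
      · simp [IndexExpr.eval]
      · intro ρ' _; simp [IndexExpr.eval]) hw
  have f₂ : ∀ a, (decodeProgram degK packetCount (ix 2) (ix 0) (.const 0)).sem ρ σ₁ (11 :: a) =
    σ₁ (11 :: a) := fun a => sem_of_noWrite (noWrite_decodeProgram (by decide)) _ _ _
  generalize (decodeProgram _ _ _ _ _).sem ρ σ₁ = σ₂ at *
  split_ifs with hjs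
  · rw [hjs.1, hjs.2, sem_fill_eq σ₂ (Function.update (Function.update ρ 10 i) 11 l)]
    · simp [Term.eval, IndexExpr.eval, hd i hi l hl]
    · decide
    · simp [Term.Reads]
    · simp [Term.Reads]
    · exact ⟨i, by simp [h1, hρ, hi], l, by simp [hK, hρ, hl], rfl⟩
    · simp [IndexExpr.eval]
    · intro ρ' _; simp +contextual [IndexExpr.eval]
  · rw [sem_fill_of_ne (by decide) (by simp [Term.Reads]) (by simp [Term.Reads]), f₂,
      f₁ _ (by decide)]
    intro ρ' h' he
    have e4 : ρ' 4 = ρ 4 := h'.eq_of_notMem (by simp)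
    have e5 : ρ' 5 = ρ 5 := h'.eq_of_notMem (by simp)
    simp only [IndexExpr.eval, List.map_cons, List.map_nil, List.cons.injEq] at he
    omega

variable [Algebra F L] [IsScalarTower F K L]

theorem IsSetupL.congr {φ : L →ₗ[K] L} {β : L} {σ σ' : Memory F} (h : IsSetupL 𝒞 T₁ T₂ φ β σ)
    (hσ : ∀ n ∈ [20, 21, 22, 23, 24], ∀ a, σ' (n :: a) = σ (n :: a)) :
    IsSetupL 𝒞 T₁ T₂ φ β σ' := by
  constructor
  · intros; rw [hσ _ (by decide), h.table] <;> assumption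
  · intros; rw [hσ _ (by decide), h.frob] <;> assumption
  · intros; rw [hσ _ (by decide), h.points] <;> assumption
  · intros; rw [hσ _ (by decide), h.generator] <;> assumption
  · intros; rw [hσ _ (by decide), h.nuisance] <;> assumption

/-- Cells of blocks other than the current one (variable 4) are kept, so results accumulate over the
loop; the remainder holds the word minus the second code word as seen by the receiver. -/
theorem stepL_spec [Finite K] {ρ : ℕ → ℕ} (hρ : SameParams (CodePair.params R₁ R₂ z k) ρ)
    {φ : L →ₗ[K] L} {β : L} (hβ : β ≠ 0) {σ : Memory F} (hσ : IsSetupL 𝒞 T₁ T₂ φ β σ)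
    {y x : ℕ → L}
    (hy : ∀ i < R₁ + R₂ + 2 * z, ∀ s < R₂ + 2 * z, ∀ l < R₁ + 2 * z,
      σ [10, i, ρ 4, s, l] = coord 𝒞.basisL (y i) (l + (R₁ + 2 * z) * s))
    (hw : ReceivedWord φ (R₁ + R₂ + 2 * z) R₂ R₁ z (receivedPoints T₂ 𝒞.g₂)
      (receivedGenerator T₂ 𝒞.G₂) (receivedGenerator T₁ 𝒞.G₁) y x) (i j s l : ℕ)
    (hs : s < R₂ + 2 * z) (hl : l < R₁ + 2 * z) :
    (i < R₂ → stepL.sem ρ σ [12, i, j, s, l] =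
      if j = ρ 4 then coord 𝒞.basisL (x i) (l + (R₁ + 2 * z) * s) else σ [12, i, j, s, l]) ∧
    (i < R₁ + R₂ + 2 * z → stepL.sem ρ σ [remainder, i, j, s, l] =
      if j = ρ 4 then coord 𝒞.basisL
        (y i - ∑ u ∈ Finset.range R₂, x u * receivedGenerator T₂ 𝒞.G₂ i u) (l + (R₁ + 2 * z) * s)
      else σ [remainder, i, j, s, l]) := by
  have hdK := denotes_degK R₁ R₂ z k
  have hdL := denotes_degL R₁ R₂ z k
  have hdT := denotes_degTotal R₁ R₂ z k
  have hdC := denotes_packetCount R₁ R₂ z k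
  have hd1 := denotes_rate₁ R₁ R₂ z k
  have hd2 := denotes_rate₂ R₁ R₂ z k
  have hK := hdK
  have hL := hdL
  have hT := hdT
  have hC := hdC
  have h2 := hd2
  unfold IndexExpr.Denotes at hK hL hT hC h2
  unfold stepL
  simp only [sem_seq]
  generalize hσ₁ : (fill _ word _ _).sem ρ σ = σ₁
  have f₁ : ∀ n ∉ [13, 25], ∀ x, σ₁ (n :: x) = σ (n :: x) := fun n h x => by
    rw [← hσ₁, sem_of_noWrite (noWrite_fill _ _)] <;> (rintro rfl; exact h (by decide))
  have hs₁ : IsSetupL 𝒞 T₁ T₂ φ β σ₁ := hσ.congr 𝒞 T₁ T₂ fun n hn => f₁ n (by simp at hn ⊢; omega)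
  have hy₁ : ∀ i < R₁ + R₂ + 2 * z, ∀ l < (R₂ + 2 * z) * (R₁ + 2 * z),
      σ₁ [word, i, l] = coord 𝒞.basisL (y i) l := by
    intro i hi l hl'
    obtain ⟨s, hs, l, hl, rfl⟩ := CodePair.exists_eq_add_mul hl'
    rw [← hy i hi s hs l hl, ← hσ₁, sem_fill_eq σ (Function.update (Function.update
      (Function.update ρ 10 i) 11 s) 12 l)]
    · simp [Term.eval, IndexExpr.eval]
    · decide
    · simp [Term.Reads]
    · simp [Term.Reads]
    · exact ⟨i, by simp [hC, hρ, hi], s, by simp [hL, hρ, hs], l, by simp [hK, hρ, hl], rfl⟩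
    · simp [flat, IndexExpr.eval, hK, hρ]
    · intro ρ' h' he
      have hs' := h'.sameParams (by simp) hρ
      have b₁ := h'.lt hρ (by simp) (by decide) (v := 12) (by simp) hdK
      simp only [flat, IndexExpr.eval, List.map_cons, List.map_nil, hK ρ' hs', List.cons.injEq,
        CodePair.add_mul_inj b₁ hl] at he
      simp [he]
  have hd := decodeProgram_spec 𝒞.basisL hdT hdC (denotes_errors R₁ R₂ z k) hd2 hd1 hρ σ₁ φ y
    (receivedPoints T₂ 𝒞.g₂) (receivedGenerator T₂ 𝒞.G₂) (receivedGenerator T₁ 𝒞.G₁) hβ x hs₁.table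
    hs₁.frob hs₁.points hs₁.generator hs₁.nuisance hy₁ hw
  have f₂ : ∀ n ∉ [13, 26, 27, 28, 29, 30, 31, 32, 33, 34, 35], ∀ a,
      (decodeProgram degTotal packetCount (ix 2) (ix 1) (ix 0)).sem ρ σ₁ (n :: a) =
    σ₁ (n :: a) := fun n hn a => sem_of_noWrite (noWrite_decodeProgram hn) _ _ _
  generalize (decodeProgram _ _ _ _ _).sem ρ σ₁ = σ₂ at *
  generalize hσ₃ : (fill _ 12 _ _).sem ρ σ₂ = σ₃
  have f₃ : ∀ n ∉ [12, 13], ∀ x, σ₃ (n :: x) = σ₂ (n :: x) := fun n h x => by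
    rw [← hσ₃, sem_of_noWrite (noWrite_fill _ _)] <;> (rintro rfl; exact h (by decide))
  have hs₃ : IsSetupL 𝒞 T₁ T₂ φ β σ₃ := hs₁.congr 𝒞 T₁ T₂ fun n hn a => by
    rw [f₃ n (by simp at hn ⊢; omega), f₂ n (by simp at hn ⊢; omega)]
  constructor
  · intro hi
    rw [sem_of_noWrite (noWrite_fill (by decide) (by decide)), ← hσ₃]
    split_ifs with hj
    · rw [hj, sem_fill_eq σ₂ (Function.update (Function.update (Function.update ρ 10 i) 11 s) 12 l)]
      · simp [flat, Term.eval, IndexExpr.eval, hK, hρ, hd i hi _ (CodePair.lt_mul hs hl)]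
      · decide
      · simp [Term.Reads]
      · simp [Term.Reads]
      · exact ⟨i, by simp [h2, hρ, hi], s, by simp [hL, hρ, hs], l, by simp [hK, hρ, hl], rfl⟩
      · simp [IndexExpr.eval]
      · intro ρ' _; simp +contextual [IndexExpr.eval]
    · rw [sem_fill_of_ne (by decide) (by simp [Term.Reads]) (by simp [Term.Reads]),
        f₂ _ (by decide), f₁ _ (by decide)]
      intro ρ' h' he
      have e4 : ρ' 4 = ρ 4 := h'.eq_of_notMem (by simp)
      simp only [IndexExpr.eval, List.map_cons, List.map_nil, List.cons.injEq] at he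
      omega
  · intro hi
    split_ifs with hj
    · rw [hj, sem_fill_eq σ₃ (Function.update (Function.update (Function.update ρ 10 i) 11 s) 12 l)]
      · rw [coord_sub, coord_sum]
        have hy₃ : ∀ u, σ₃ [word, i, u] = σ₁ [word, i, u] := fun u => by
          rw [f₃ _ (by decide), f₂ _ (by decide)]
        simp only [Term.eval, sameParams_update, hρ, hT, h2, Nat.reduceLeDiff]
        congr 1
        · simp [flat, IndexExpr.eval, hK, hρ, hy₃, hy₁ i hi _ (CodePair.lt_mul hs hl)]
        · refine Finset.sum_congr rfl fun u hu => ?_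
          rw [coord_mul]
          refine Finset.sum_congr rfl fun v hv => Finset.sum_congr rfl fun w hw => ?_
          rw [Finset.mem_range] at hu hv hw
          simp [flat, IndexExpr.eval, hK, hρ, hs₃.generator i hi u hu w hw,
            hs₃.table v hv w hw _ (CodePair.lt_mul hs hl), f₃, hd u hu v hv]
      · decide
      · simp [Term.Reads]
      · simp [Term.Reads]
      · exact ⟨i, by simp [hC, hρ, hi], s, by simp [hL, hρ, hs], l, by simp [hK, hρ, hl], rfl⟩
      · simp [IndexExpr.eval]
      · intro ρ' _; simp +contextual [IndexExpr.eval]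
    · rw [sem_fill_of_ne (by decide) (by simp [Term.Reads]) (by simp [Term.Reads]),
        f₃ _ (by decide), f₂ _ (by decide), f₁ _ (by decide)]
      intro ρ' h' he
      have e4 : ρ' 4 = ρ 4 := h'.eq_of_notMem (by simp)
      simp only [IndexExpr.eval, List.map_cons, List.map_nil, List.cons.injEq] at he
      omega

/-- All blocks of the second message are decoded before the first is begun, since the setup for K
overwrites the arrays prepared for L; the remainders pass from one pass to the other. -/
theorem decoder_spec [Finite F] [Finite K] {φK : K →ₗ[F] K} {φL : L →ₗ[K] L}
    (hφK : ∀ x, φK x = x ^ Nat.card F) (hφL : ∀ x, φL x = x ^ Nat.card K)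
    {κ : ℕ → ℕ → F} {y x₂ : ℕ → ℕ → L} {x₁ : ℕ → ℕ → ℕ → K}
    (hy : ∀ j < k, ∀ i < R₁ + R₂ + 2 * z, ∀ s < R₂ + 2 * z, ∀ l < R₁ + 2 * z,
      𝒞.input T₁ T₂ Y [10, i, j, s, l] = coord 𝒞.basisL (y j i) (l + (R₁ + 2 * z) * s))
    (hwL : ∀ j < k, ReceivedWord φL (R₁ + R₂ + 2 * z) R₂ R₁ z (receivedPoints T₂ 𝒞.g₂)
      (receivedGenerator T₂ 𝒞.G₂) (receivedGenerator T₁ 𝒞.G₁) (y j) (x₂ j))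
    (hwK : ∀ j < k, ∀ s : Fin (R₂ + 2 * z), ReceivedWord φK (R₁ + R₂ + 2 * z) R₁ 0 z
      (receivedPoints T₁ 𝒞.g₁) (receivedGenerator T₁ 𝒞.G₁) κ
      (fun i => 𝒞.b.repr
        (y j i - ∑ u ∈ Finset.range R₂, x₂ j u * receivedGenerator T₂ 𝒞.G₂ i u) s)
      (x₁ j s)) (j : ℕ) (hj : j < k) (s : Fin (R₂ + 2 * z)) (l : Fin (R₁ + 2 * z)) :
    (∀ i < R₁, decoder.sem (CodePair.params R₁ R₂ z k) (𝒞.input T₁ T₂ Y) [11, i, j, s, l] =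
      coord 𝒞.a (x₁ j s i) l) ∧
    ∀ i < R₂, decoder.sem (CodePair.params R₁ R₂ z k) (𝒞.input T₁ T₂ Y) [12, i, j, s, l] =
      coord 𝒞.a (𝒞.b.repr (x₂ j i) s) l := by
  set ρ := CodePair.params R₁ R₂ z k with hρ'
  have hρ : SameParams (CodePair.params R₁ R₂ z k) ρ := SameParams.refl _
  have hL0 : 0 < R₂ + 2 * z := s.pos
  unfold decoder
  simp only [sem_seq]
  have hset := setupL_spec 𝒞 T₁ T₂ Y hρ hφL hL0
  have hβ := 𝒞.b.ne_zero ⟨0, hL0⟩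
  have f₁ : ∀ n ∉ [13, 20, 21, 22, 23, 24], ∀ a, setupL.sem ρ (𝒞.input T₁ T₂ Y) (n :: a) =
    𝒞.input T₁ T₂ Y (n :: a) := fun n hn a => sem_of_noWrite (noWrite_setupL hn) _ _ _
  generalize setupL.sem ρ (𝒞.input T₁ T₂ Y) = σ₁ at *
  have hloop := sem_loop_induction ρ σ₁ 4 (ix 3) stepL (fun j σ =>
    (∀ n ∉ [12, 13, 25, 26, 27, 28, 29, 30, 31, 32, 33, 34, 35, 36], ∀ a, σ (n :: a) = σ₁ (n :: a)) ∧
    ∀ j' < j, ∀ s < R₂ + 2 * z, ∀ l < R₁ + 2 * z,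
      (∀ i < R₂, σ [12, i, j', s, l] = coord 𝒞.basisL (x₂ j' i) (l + (R₁ + 2 * z) * s)) ∧
      ∀ i < R₁ + R₂ + 2 * z, σ [remainder, i, j', s, l] = coord 𝒞.basisL
        (y j' i - ∑ u ∈ Finset.range R₂, x₂ j' u * receivedGenerator T₂ 𝒞.G₂ i u)
        (l + (R₁ + 2 * z) * s))
    ⟨fun _ _ _ => rfl, fun _ h => absurd h (Nat.not_lt_zero _)⟩ (by
      rintro j hj σ ⟨h1, h2⟩
      rw [denotes_blocks R₁ R₂ z k ρ hρ] at hj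
      refine ⟨fun n hn a => ?_, fun j' hj' s hs l hl => ?_⟩
      · rw [sem_of_noWrite (noWrite_stepL hn), h1 n hn]
      · have hst := fun i => stepL_spec (k := k) 𝒞 T₁ T₂ (ρ := Function.update ρ 4 j) (by simp [hρ]) hβ
          (hset.congr 𝒞 T₁ T₂ fun n hn => h1 n (by simp at hn ⊢; omega)) (y := y j) (x := x₂ j)
          (fun i hi s hs l hl => by
            rw [h1 _ (by decide), f₁ _ (by decide), Function.update_self, hy j hj i hi s hs l hl])
          (hwL j hj) i j' s l hs hl
        simp only [Function.update_self] at hst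
        refine ⟨fun i hi => ?_, fun i hi => ?_⟩
        · rw [(hst i).1 hi]
          split_ifs with h
          · rw [h]
          · exact (h2 j' (by omega) s hs l hl).1 i hi
        · rw [(hst i).2 hi]
          split_ifs with h
          · rw [h]
          · exact (h2 j' (by omega) s hs l hl).2 i hi)
  rw [denotes_blocks R₁ R₂ z k ρ hρ] at hloop
  generalize (loop 4 (ix 3) stepL).sem ρ σ₁ = σ₂ at *
  obtain ⟨f₂, h₂⟩ := hloop
  have hsetK := setupK_spec 𝒞 T₁ T₂ Y hρ hφK (σ := σ₂) fun n hn a => by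
    rw [f₂ n (by simp; omega), f₁ n (by simp; omega)]
  have f₃ : ∀ n ∉ [13, 20, 21, 22, 23], ∀ a, setupK.sem ρ σ₂ (n :: a) = σ₂ (n :: a) :=
    fun n hn a => sem_of_noWrite (noWrite_setupK hn) _ _ _
  generalize setupK.sem ρ σ₂ = σ₃ at *
  have hloopK := sem_loop_induction ρ σ₃ 4 (ix 3) (loop 5 degL stepK) (fun j σ =>
    (∀ n ∉ [11, 13, 25, 26, 27, 28, 29, 30, 31, 32, 33, 34, 35], ∀ a, σ (n :: a) = σ₃ (n :: a)) ∧
    ∀ j' < j, ∀ s : Fin (R₂ + 2 * z), ∀ l < R₁ + 2 * z, ∀ i < R₁,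
      σ [11, i, j', s, l] = coord 𝒞.a (x₁ j' s i) l)
    ⟨fun _ _ _ => rfl, fun _ h => absurd h (Nat.not_lt_zero _)⟩ (by
      rintro j hj σ ⟨h1, h2⟩
      rw [denotes_blocks R₁ R₂ z k ρ hρ] at hj
      have hin := sem_loop_induction (Function.update ρ 4 j) σ 5 degL stepK (fun s σ =>
        (∀ n ∉ [11, 13, 25, 26, 27, 28, 29, 30, 31, 32, 33, 34, 35], ∀ a,
          σ (n :: a) = σ₃ (n :: a)) ∧
        ∀ (j' : ℕ) (s' : Fin (R₂ + 2 * z)), j' < j ∨ j' = j ∧ s' < s → ∀ l < R₁ + 2 * z, ∀ i < R₁,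
          σ [11, i, j', s', l] = coord 𝒞.a (x₁ j' s' i) l)
        ⟨h1, fun j' s' h => h2 j' (by omega) s'⟩ (by
          rintro s hs σ ⟨h1, h2⟩
          rw [denotes_degL R₁ R₂ z k _ (by simp [hρ])] at hs
          refine ⟨fun n hn a => ?_, fun j' s' h l hl i hi => ?_⟩
          · rw [sem_of_noWrite (noWrite_stepK hn), h1 n hn]
          · rw [stepK_spec (k := k) 𝒞 T₁ (by simp [hρ]) (hsetK.congr 𝒞 T₁ fun n hn => h1 n (by
              simp at hn ⊢; omega)) (fun i hi l hl => ?_) (hwK j hj ⟨s, hs⟩) i hi j' s' l hl]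
            · simp only [Function.update_self, ne_eq, Nat.reduceEqDiff, not_false_eq_true,
                Function.update_of_ne]
              split_ifs with h'
              · obtain ⟨rfl, rfl⟩ := h'
                rfl
              · exact h2 j' s' (by omega) l hl i hi
            · have e4 : Function.update (Function.update ρ 4 j) 5 s 4 = j := by simp
              have e5 : Function.update (Function.update ρ 4 j) 5 s 5 = s := by simp
              rw [e4, e5, h1 _ (by decide), f₃ _ (by decide), (h₂ j hj s hs l hl).2 i hi,
                𝒞.coord_basisL _ hs hl])
      rw [denotes_degL R₁ R₂ z k _ (by simp [hρ])] at hin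
      exact ⟨hin.1, fun j' hj' s => hin.2 j' s (by omega)⟩)
  rw [denotes_blocks R₁ R₂ z k ρ hρ] at hloopK
  refine ⟨hloopK.2 j hj s l l.2, fun i hi => ?_⟩
  rw [hloopK.1 _ (by decide), f₃ _ (by decide), (h₂ j hj s s.2 l l.2).1 i hi,
    𝒞.coord_basisL _ s.2 l.2]

end Decoder

/-! ### Received words from injective transforms -/

section Construction

theorem Matrix.exists_left_inverse_of_mulVec_injective {m n k : Type*} [Field k] [Fintype m]
    [Fintype n] [DecidableEq m] [DecidableEq n] {M : Matrix m n k}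
    (h : ∀ w, M *ᵥ w = 0 → w = 0) : ∃ P : Matrix n m k, P * M = 1 := by
  obtain ⟨f, hf⟩ := M.mulVecLin.exists_leftInverse_of_injective (LinearMap.ker_eq_bot'.2 h)
  refine ⟨LinearMap.toMatrix' f, ?_⟩
  rw [← LinearMap.toMatrix'_id, ← hf, LinearMap.toMatrix'_comp, ← Matrix.toLin'_apply',
    LinearMap.toMatrix'_toLin']

/-- The two blocks of rows of a left inverse of [A | B]: each recovers one summand and cancels the
other. -/
theorem Matrix.exists_left_inverses {k : Type*} [Field k] {C r n : ℕ}
    {A : Matrix (Fin C) (Fin r) k} {B : Matrix (Fin C) (Fin n) k}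
    (h : ∀ w₁ w₂, A *ᵥ w₁ + B *ᵥ w₂ = 0 → w₁ = 0 ∧ w₂ = 0) :
    ∃ (P : Matrix (Fin r) (Fin C) k) (Q : Matrix (Fin n) (Fin C) k),
      P * A = 1 ∧ P * B = 0 ∧ Q * A = 0 ∧ Q * B = 1 := by
  obtain ⟨P, hP⟩ := Matrix.exists_left_inverse_of_mulVec_injective (M := fromCols A B) fun w hw => by
    rw [fromCols_mulVec] at hw
    obtain ⟨h1, h2⟩ := h _ _ hw
    funext i
    rcases i with i | i
    · exact congrFun h1 i
    · exact congrFun h2 i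
  refine ⟨P.toRows₁, P.toRows₂, ?_⟩
  rw [← fromRows_toRows P, fromRows_mul_fromCols, ← fromBlocks_one, fromBlocks_inj] at hP
  exact hP

theorem Matrix.exists_left_inverse_of_linearIndependent {k : Type*} [Field k] {n R : ℕ}
    {G : Matrix (Fin n) (Fin R) k} (h : LinearIndependent k Gᵀ) :
    ∃ P : Matrix (Fin R) (Fin n) k, P * G = 1 := by
  refine Matrix.exists_left_inverse_of_mulVec_injective fun w hw => ?_
  rw [Matrix.mulVec_eq_sum] at hw
  funext i
  exact Fintype.linearIndependent_iff.1 h w (by simpa [op_smul_eq_smul] using hw) i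

variable {k A : Type*} [Field k] [Field A] [Algebra k A]

theorem sum_smul_sum_smul {M : Type*} [AddCommGroup M] [Module k M] {m n l : ℕ}
    (P : Matrix (Fin l) (Fin m) k) (B : Matrix (Fin m) (Fin n) k) (u : Fin n → M) (j : Fin l) :
    ∑ i, P j i • ∑ j', B i j' • u j' = ∑ j', (P * B) j j' • u j' := by
  simp only [Finset.smul_sum, Matrix.mul_apply, Finset.sum_smul, smul_smul]
  exact Finset.sum_comm

theorem pow_frobenius_apply {φ : A →ₗ[k] A} (hφ : ∀ x, φ x = x ^ Nat.card k) (j : ℕ) (x : A) :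
    (φ ^ j) x = x ^ Nat.card k ^ j := by
  induction j with
  | zero => simp
  | succ j ih => rw [pow_succ', Module.End.mul_apply, ih, hφ, ← pow_mul, ← pow_succ]

theorem sum_mul_receivedGenerator {C n R : ℕ} (T : Matrix (Fin C) (Fin n) k)
    (G : Matrix (Fin n) (Fin R) A) (x : ℕ → A) (i : Fin C) :
    ∑ j ∈ Finset.range R, x j * receivedGenerator T G i j =
      ∑ i', T i i' • ∑ j : Fin R, G i' j * x j := by
  rw [Finset.sum_range]
  simp only [receivedGenerator, padMatrix_fin, Matrix.of_apply, Finset.mul_sum, Finset.smul_sum]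
  rw [Finset.sum_comm]
  refine Finset.sum_congr rfl fun i' _ => Finset.sum_congr rfl fun j _ => ?_
  rw [mul_smul_comm, mul_comm]

/-- A word that is received through an injective linear transformation of the code word and the
interference. -/
theorem ReceivedWord.of_injective [FiniteDimensional k A] {C r R z : ℕ} {φ : A →ₗ[k] A}
    (hφ : ∀ x, φ x = x ^ Nat.card k) (hA : Module.finrank k A = R + 2 * z)
    {B : Matrix (Fin C) (Fin r) k} {T : Matrix (Fin C) (Fin (R + 2 * z)) k}
    (h : ∀ w₁ w₂, B *ᵥ w₁ + T *ᵥ w₂ = 0 → w₁ = 0 ∧ w₂ = 0) {g : Fin (R + 2 * z) → A}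
    {G : Matrix (Fin (R + 2 * z)) (Fin R) A} (hG : IsGabidulinGenerator k g G) {y x : ℕ → A}
    (w : Fin r → A) (ε : Fin C → A) (S : Submodule k A) (hS : Module.finrank k S ≤ z)
    (hε : ∀ i, ε i ∈ S)
    (hy : ∀ i : Fin C, y i = ∑ i', T i i' • ∑ j : Fin R, G i' j * x j + ∑ j, B i j • w j + ε i) :
    ReceivedWord φ C R r z (receivedPoints T g) (receivedGenerator T G) (padMatrix B) y x := by
  -- `P` isolates the interference, `Q` the code word. They occur in the proof only; the program
  -- never computes them.
  obtain ⟨P, Q, hPB, hPT, hQB, hQT⟩ := Matrix.exists_left_inverses h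
  obtain ⟨hg, hGi, hspan⟩ := hG
  have hnui : ∀ (u : ℕ → A) (i : Fin C), ∑ j ∈ Finset.range r, padMatrix B i j • u j =
      ∑ j : Fin r, B i j • u j := by
    intro u i
    simp only [Finset.sum_range, padMatrix_fin]
  refine ⟨hφ, hA, ⟨padZero w, padZero ε, S, hS, fun i hi => ?_, fun i hi => ?_⟩, fun x' => ?_,
    fun x' hx' j hj => ?_, fun u hu j hj => ?_, fun a => ?_⟩
  · lift i to Fin C using hi
    rw [padZero_fin]
    exact hε i
  · lift i to Fin C using hi
    rw [hy, sum_mul_receivedGenerator, hnui]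
    simp only [padZero_fin]
  · have hmem : ∑ j : Fin R, x' j • Gᵀ j ∈ Submodule.span A
        (Set.range fun (j : Fin R) (i : Fin (R + 2 * z)) => g i ^ Nat.card k ^ (j : ℕ)) := by
      rw [← hspan]
      exact Submodule.sum_mem _ fun j _ => Submodule.smul_mem _ _ (Submodule.subset_span ⟨j, rfl⟩)
    obtain ⟨f, hf⟩ := (Submodule.mem_span_range_iff_exists_fun A).1 hmem
    refine ⟨padZero f, fun i hi => ?_⟩
    lift i to Fin C using hi
    have hcode : ∀ i', ∑ j : Fin R, G i' j * x' j = skewPoly φ (padZero f) R (g i') := by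
      intro i'
      rw [skewPoly_apply, Finset.sum_range]
      have := congrFun hf i'
      simp only [Finset.sum_apply, Pi.smul_apply, smul_eq_mul, Matrix.transpose_apply] at this
      simp only [padZero_fin, pow_frobenius_apply hφ, this]
      exact Finset.sum_congr rfl fun j _ => mul_comm _ _
    rw [sum_mul_receivedGenerator, receivedPoints, padZero_fin, map_sum]
    simp only [hcode, map_smul]
  · lift j to Fin R using hj
    have h0 : ∀ i' : Fin (R + 2 * z), ∑ j : Fin R, G i' j * x' j = 0 := by
      intro i'
      have := sum_smul_sum_smul Q T (fun i' => ∑ j : Fin R, G i' j * x' j) i'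
      rw [hQT] at this
      simp only [← sum_mul_receivedGenerator, hx' _ (Fin.is_lt _), smul_zero, Finset.sum_const_zero, Matrix.one_apply,
        ite_smul, one_smul, zero_smul, Finset.sum_ite_eq, Finset.mem_univ, if_true] at this
      exact this.symm
    refine Fintype.linearIndependent_iff.1 hGi (fun j => x' j) ?_ j
    funext i'
    simpa [mul_comm] using h0 i'
  · lift j to Fin r using hj
    have := sum_smul_sum_smul P B (fun j => u j) j
    rw [hPB] at this
    simp only [← hnui, hu _ (Fin.is_lt _), smul_zero, Finset.sum_const_zero, Matrix.one_apply,
      ite_smul, one_smul, zero_smul, Finset.sum_ite_eq, Finset.mem_univ, if_true] at this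
    exact this.symm
  -- As many independent code points as the degree of the extension form a basis. If a = ∑ c_i g_i,
  -- the row vector cQ annihilates the interference and combines the received points Tg to a.
  · have hspang : a ∈ Submodule.span k (Set.range g) := by
      rw [hg.span_eq_top_of_card_eq_finrank' (by simp [hA])]
      trivial
    obtain ⟨c, hc⟩ := (Submodule.mem_span_range_iff_exists_fun k).1 hspang
    refine ⟨padZero (c ᵥ* Q), fun j hj => ?_, ?_⟩
    · lift j to Fin r using hj
      simp only [Finset.sum_range, padZero_fin, padMatrix_fin]
      change ((c ᵥ* Q) ᵥ* B) j = 0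
      rw [Matrix.vecMul_vecMul, hQB, Matrix.vecMul_zero, Pi.zero_apply]
    · simp only [Finset.sum_range, receivedPoints, padZero_fin]
      have := sum_smul_sum_smul (Matrix.of fun _ : Fin 1 => c ᵥ* Q) T g 0
      simp only [Matrix.of_apply] at this
      rw [this, ← hc]
      refine Finset.sum_congr rfl fun i' _ => ?_
      have : (Matrix.of fun _ : Fin 1 => c ᵥ* Q) * T = Matrix.of fun _ => c := by
        ext i j
        change ((c ᵥ* Q) ᵥ* T) j = c j
        rw [Matrix.vecMul_vecMul, hQT, Matrix.vecMul_one]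
      rw [this]
      rfl

end Construction

/-! ### Correctness of the decoder when the transforms are injective -/

section Correctness

open Program

/-- At most z corrupted links contribute, so all errors lie in the span of at most z elements,
whatever the transfer coefficients. The span is taken over the larger k although the coefficients
are in F. -/
theorem exists_submodule_sum_smul_mem {F k A E : Type*} [Semiring F] [Field k] [AddCommGroup A]
    [Module k A] [Module F A] [SMul F k] [IsScalarTower F k A] [Fintype E] (f : E → A)
    {s : Set E} (hf : ∀ e ∉ s, f e = 0) :
    ∃ S : Submodule k A, Module.finrank k S ≤ s.ncard ∧ ∀ c : E → F, ∑ e, c e • f e ∈ S := by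
  classical
  refine ⟨Submodule.span k (f '' s), ?_, fun c => Submodule.sum_mem _ fun e _ => ?_⟩
  · have := (s.toFinite.image f).fintype
    refine (finrank_span_le_card (f '' s)).trans ?_
    rw [← Set.ncard_eq_toFinset_card']
    exact Set.ncard_image_le s.toFinite
  · by_cases he : e ∈ s
    · exact Submodule.smul_of_tower_mem _ _ (Submodule.subset_span ⟨e, he, rfl⟩)
    · rw [hf e he, smul_zero]
      exact Submodule.zero_mem _

namespace CodePair

variable {F K L : Type*} [Field F] [Field K] [Field L] [Algebra F K] [Algebra K L]
  [Algebra F L] [IsScalarTower F K L] {R₁ R₂ z k : ℕ} (𝒞 : CodePair F K L R₁ R₂ z)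

/-- The element of `L` whose coordinates form a given block of a packet. -/
noncomputable def foldBlock (j : Fin k) : (PacketIdx R₁ R₂ z k → F) →ₗ[F] L where
  toFun v := ∑ s, (∑ l, v ((j, s), l) • 𝒞.a l) • 𝒞.b s
  map_add' v w := by simp [add_smul, Finset.sum_add_distrib]
  map_smul' c v := by simp [mul_smul, ← Finset.smul_sum, smul_assoc]

theorem foldBlock_apply (j : Fin k) (v : PacketIdx R₁ R₂ z k → F) :
    𝒞.foldBlock j v = ∑ s, (∑ l, v ((j, s), l) • 𝒞.a l) • 𝒞.b s := rfl

theorem repr_foldBlock (j : Fin k) (v : PacketIdx R₁ R₂ z k → F) (s : Fin (R₂ + 2 * z)) :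
    𝒞.b.repr (𝒞.foldBlock j v) s = ∑ l, v ((j, s), l) • 𝒞.a l := by
  rw [foldBlock_apply, 𝒞.b.repr_sum_self]

theorem repr_smul_apply (c : F) (x : L) (s : Fin (R₂ + 2 * z)) :
    𝒞.b.repr (c • x) s = c • 𝒞.b.repr x s := by
  rw [← algebraMap_smul K c x, map_smul, Finsupp.smul_apply, algebraMap_smul]

theorem foldBlock_mul {m n : Type*} [Fintype n] (j : Fin k) (T : Matrix m n F)
    (M : Matrix n (PacketIdx R₁ R₂ z k) F) (i : m) :
    𝒞.foldBlock j ((T * M) i) = ∑ i', T i i' • 𝒞.foldBlock j (M i') := by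
  have : (T * M) i = ∑ i', T i i' • M i' := by
    funext p
    simp [Matrix.mul_apply]
  simp only [this, map_sum, map_smul]

theorem foldBlock_encode₁ (j : Fin k) (X₁ : Matrix (Fin R₁) (Fin k × Fin (R₂ + 2 * z)) K)
    (i : Fin (R₁ + 2 * z)) :
    𝒞.foldBlock j (𝒞.encode₁ X₁ i) = ∑ s, (𝒞.G₁ * X₁) i (j, s) • 𝒞.b s := by
  simp [foldBlock_apply, encode₁, unfoldMatrix, 𝒞.a.sum_repr]

theorem foldBlock_encode₂ (j : Fin k) (X₂ : Matrix (Fin R₂) (Fin k) L)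
    (i : Fin (R₂ + 2 * z)) :
    𝒞.foldBlock j (𝒞.encode₂ X₂ i) = (𝒞.G₂ * X₂) i j := by
  simp [foldBlock_apply, encode₂, unfoldMatrix, 𝒞.a.sum_repr, 𝒞.b.sum_repr]

variable {C : ℕ}

theorem _root_.receivedPoints_map {n : ℕ} (T : Matrix (Fin C) (Fin n) F) (g : Fin n → L) :
    receivedPoints (T.map (algebraMap F K)) g = receivedPoints T g := by
  simp [receivedPoints, algebraMap_smul]

theorem _root_.receivedGenerator_map {n R : ℕ} (T : Matrix (Fin C) (Fin n) F)
    (G : Matrix (Fin n) (Fin R) L) :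
    receivedGenerator (T.map (algebraMap F K)) G = receivedGenerator T G := by
  simp [receivedGenerator, algebraMap_smul]

theorem _root_.padMatrix_map_mul {n R : ℕ} (T : Matrix (Fin C) (Fin n) F)
    (G : Matrix (Fin n) (Fin R) K) :
    padMatrix (T.map (algebraMap F K) * G) = receivedGenerator T G := by
  rw [receivedGenerator]
  congr 1
  ext i j
  simp [Matrix.mul_apply, Algebra.smul_def]

/-- Deterministic part: the first injectivity separates the second code from the interference of the
first over K, the second makes the remainder decodable over F. The matrix `D` from links to receiver
is arbitrary. -/
theorem isOutput_decoder [Finite F] {E : Type*} [Fintype E]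
    {T₁ : Matrix (Fin (R₁ + R₂ + 2 * z)) (Fin (R₁ + 2 * z)) F}
    {T₂ : Matrix (Fin (R₁ + R₂ + 2 * z)) (Fin (R₂ + 2 * z)) F}
    (h₁ : ∀ (w₁ : Fin R₁ → K) (w₂ : Fin (R₂ + 2 * z) → K),
      (T₁.map (algebraMap F K) * 𝒞.G₁) *ᵥ w₁ + T₂.map (algebraMap F K) *ᵥ w₂ = 0 →
        w₁ = 0 ∧ w₂ = 0)
    (h₂ : ∀ w : Fin (R₁ + 2 * z) → F, T₁ *ᵥ w = 0 → w = 0)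
    (D : Matrix (Fin (R₁ + R₂ + 2 * z)) E F)
    (X₁ : Matrix (Fin R₁) (Fin k × Fin (R₂ + 2 * z)) K) (X₂ : Matrix (Fin R₂) (Fin k) L)
    {W : Matrix E (PacketIdx R₁ R₂ z k) F} (hW : Set.ncard {e : E | W e ≠ 0} ≤ z) :
    𝒞.IsOutput X₁ X₂ (decoder.sem (params R₁ R₂ z k)
      (𝒞.input T₁ T₂ (T₁ * 𝒞.encode₁ X₁ + T₂ * 𝒞.encode₂ X₂ + D * W))) := by
  set Y := T₁ * 𝒞.encode₁ X₁ + T₂ * 𝒞.encode₂ X₂ + D * W with hY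
  have := Module.Basis.finiteDimensional_of_finite 𝒞.a
  have := Module.Basis.finiteDimensional_of_finite 𝒞.b
  have : Finite K := Module.finite_of_finite F
  have := Fintype.ofFinite F
  have := Fintype.ofFinite K
  let φK : K →ₗ[F] K := (FiniteField.frobeniusAlgHom F K).toLinearMap
  let φL : L →ₗ[K] L := (FiniteField.frobeniusAlgHom K L).toLinearMap
  have hφK : ∀ x, φK x = x ^ Nat.card F := fun x => by simp [φK]
  have hφL : ∀ x, φL x = x ^ Nat.card K := fun x => by simp [φL]
  let y : ℕ → ℕ → L := padMatrix (Matrix.of fun (j : Fin k) i => 𝒞.foldBlock j (Y i))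
  let x₂ : ℕ → ℕ → L := padMatrix X₂ᵀ
  let x₁ : ℕ → ℕ → ℕ → K := fun j s => padZero fun i =>
    padMatrix (Matrix.of fun j s => X₁ i (j, s)) j s
  have hyD : ∀ (j : Fin k) (i : Fin (R₁ + R₂ + 2 * z)), y j i =
      ∑ i', T₁ i i' • ∑ s, (𝒞.G₁ * X₁) i' (j, s) • 𝒞.b s +
        ∑ i', T₂ i i' • ∑ u : Fin R₂, 𝒞.G₂ i' u * x₂ j u + ∑ e, D i e • 𝒞.foldBlock j (W e) := by
    intro j i
    simp only [y, x₂, padMatrix_fin, Matrix.of_apply, Matrix.transpose_apply]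
    have hYi : Y i = (T₁ * 𝒞.encode₁ X₁) i + (T₂ * 𝒞.encode₂ X₂) i + (D * W) i := rfl
    rw [hYi, map_add, map_add, foldBlock_mul, foldBlock_mul,
      foldBlock_mul]
    simp only [foldBlock_encode₁, foldBlock_encode₂, Matrix.mul_apply]
  have hin : ∀ j < k, ∀ i < R₁ + R₂ + 2 * z, ∀ s < R₂ + 2 * z, ∀ l < R₁ + 2 * z,
      𝒞.input T₁ T₂ Y [10, i, j, s, l] = coord 𝒞.basisL (y j i) (l + (R₁ + 2 * z) * s) := by
    intro j hj i hi s hs l hl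
    rw [𝒞.coord_basisL _ hs hl, coord_of_lt _ _ hl]
    lift j to Fin k using hj
    lift i to Fin (R₁ + R₂ + 2 * z) using hi
    simp only [y, padMatrix_fin, Matrix.of_apply]
    rw [repr_foldBlock, 𝒞.a.repr_sum_self]
    simp [input, padZero, hs, hl]
  have hwL : ∀ j < k, ReceivedWord φL (R₁ + R₂ + 2 * z) R₂ R₁ z (receivedPoints T₂ 𝒞.g₂)
      (receivedGenerator T₂ 𝒞.G₂) (receivedGenerator T₁ 𝒞.G₁) (y j) (x₂ j) := by
    intro j hj
    lift j to Fin k using hj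
    obtain ⟨S, hS, hε⟩ := exists_submodule_sum_smul_mem (F := F) (k := K)
      (fun e => 𝒞.foldBlock j (W e)) (s := {e | W e ≠ 0}) fun e he => by
        rw [show W e = 0 from not_not.1 he, map_zero]
    rw [← receivedPoints_map (K := K), ← receivedGenerator_map (K := K), ← padMatrix_map_mul T₁ 𝒞.G₁]
    refine ReceivedWord.of_injective hφL (by simp [Module.finrank_eq_card_basis 𝒞.b]) h₁
      𝒞.gabidulin₂ (fun u => ∑ s, X₁ u (j, s) • 𝒞.b s) (fun i => ∑ e, D i e • 𝒞.foldBlock j (W e))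
      S (hS.trans hW) (fun i => hε _) fun i => ?_
    rw [hyD, add_comm (∑ i', T₁ i i' • _)]
    simp only [Matrix.map_apply, algebraMap_smul]
    congr 2
    -- Regrouping T₁(G₁X₁)b = (T₁G₁)(X₁b) exhibits the first message as interference with scalar
    -- matrix T₁G₁ over K and R₁ unknown elements of L.
    have e₁ := sum_smul_sum_smul (T₁.map (algebraMap F K))
      ((𝒞.G₁ * X₁).submatrix id fun s => (j, s)) 𝒞.b i
    have e₂ := sum_smul_sum_smul (T₁.map (algebraMap F K) * 𝒞.G₁)
      (X₁.submatrix id fun s => (j, s)) 𝒞.b i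
    simp only [Matrix.map_apply, algebraMap_smul, Matrix.submatrix_apply, id_eq] at e₁ e₂
    rw [e₁, e₂, Matrix.mul_assoc]
    rfl
  have hwK : ∀ j < k, ∀ s : Fin (R₂ + 2 * z), ReceivedWord φK (R₁ + R₂ + 2 * z) R₁ 0 z
      (receivedPoints T₁ 𝒞.g₁) (receivedGenerator T₁ 𝒞.G₁) (padMatrix (0 : Matrix (Fin (R₁ + R₂ + 2 * z)) (Fin 0) F))
      (fun i => 𝒞.b.repr
        (y j i - ∑ u ∈ Finset.range R₂, x₂ j u * receivedGenerator T₂ 𝒞.G₂ i u) s)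
      (x₁ j s) := by
    intro j hj s
    lift j to Fin k using hj
    obtain ⟨S, hS, hε⟩ := exists_submodule_sum_smul_mem (F := F) (k := F)
      (fun e => 𝒞.b.repr (𝒞.foldBlock j (W e)) s) (s := {e | W e ≠ 0}) fun e he => by
        rw [show W e = 0 from not_not.1 he, map_zero, map_zero, Finsupp.zero_apply]
    refine ReceivedWord.of_injective (r := 0) hφK (by simp [Module.finrank_eq_card_basis 𝒞.a])
      (fun w₁ w₂ h => ⟨Subsingleton.elim _ _, h₂ w₂ (by simpa using h)⟩)
      𝒞.gabidulin₁ 0 (fun i => ∑ e, D i e • 𝒞.b.repr (𝒞.foldBlock j (W e)) s)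
      S (hS.trans hW) (fun i => hε _) fun i => ?_
    -- After cancellation of the second code word, the coordinate with index s sees column (j, s) of
    -- G₁X₁ through T₁, plus errors spanned over F by coordinates of the corrupted packets.
    rw [sum_mul_receivedGenerator, hyD, add_right_comm, add_sub_cancel_right, map_add,
      Finsupp.add_apply, map_sum, map_sum, Finsupp.finsetSum_apply, Finsupp.finsetSum_apply]
    simp only [repr_smul_apply, 𝒞.b.repr_sum_self, Finset.univ_eq_empty, Finset.sum_empty, add_zero,
      x₁, padZero_fin, padMatrix_fin, Matrix.of_apply, Matrix.mul_apply]
  have hsp := decoder_spec 𝒞 T₁ T₂ Y hφK hφL hin hwL hwK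
  refine ⟨fun i j s l => ?_, fun i j s l => ?_⟩
  · rw [(hsp j j.2 s l).1 i i.2, coord_fin]
    simp only [x₁, padZero_fin, padMatrix_fin, Matrix.of_apply]
  · rw [(hsp j j.2 s l).2 i i.2, coord_fin]
    simp only [x₂, padMatrix_fin, Matrix.transpose_apply]

end CodePair

end Correctness

/-! ### The theorem -/

theorem mainTheorem1 :
    ∃ (dec : Program) (c d : ℕ),
      ∀ (F K L : Type*) [Field F] [Fintype F] [Field K] [Field L] [Algebra F K] [Algebra K L]
        (R₁ R₂ z k : ℕ) (𝒞 : CodePair F K L R₁ R₂ z)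
        (V E : Type*) [DecidableEq V] [Fintype E] [DecidableEq E] (𝒢 : Network V E)
        (incoming : Fin (R₁ + R₂ + 2 * z) ≃ {e : E // 𝒢.head e = 𝒢.receiver}),
        R₁ + 2 * z ≤ 𝒢.minCut {𝒢.source₁} →
        R₂ + 2 * z ≤ 𝒢.minCut {𝒢.source₂} →
        R₁ + R₂ + 2 * z = 𝒢.minCut {𝒢.source₁, 𝒢.source₂} →
        (∀ (T₁ : Matrix (Fin (R₁ + R₂ + 2 * z)) (Fin (R₁ + 2 * z)) F)
            (T₂ : Matrix (Fin (R₁ + R₂ + 2 * z)) (Fin (R₂ + 2 * z)) F)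
            (Y : Matrix (Fin (R₁ + R₂ + 2 * z)) (PacketIdx R₁ R₂ z k) F),
          (dec.run (CodePair.params R₁ R₂ z k) (𝒞.input T₁ T₂ Y)).2 ≤
            c * ((R₁ + R₂ + 2 * z) + k * (R₁ + 2 * z) * (R₂ + 2 * z)) ^ d) ∧
        1 - 2 * (Fintype.card E : ℝ) / (Fintype.card F : ℝ) ≤
          uniformProb fun κ : CodingCoeffs F E (R₁ + 2 * z) (R₂ + 2 * z) =>
            ∀ (X₁ : Matrix (Fin R₁) (Fin k × Fin (R₂ + 2 * z)) K)
              (X₂ : Matrix (Fin R₂) (Fin k) L)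
              (W : Matrix E (PacketIdx R₁ R₂ z k) F),
              Set.ncard {e : E | W e ≠ 0} ≤ z →
              𝒞.IsOutput X₁ X₂
                (dec.run (CodePair.params R₁ R₂ z k)
                  (𝒞.input (𝒢.transfer₁ incoming κ) (𝒢.transfer₂ incoming κ)
                    (𝒢.received incoming κ (𝒞.encode₁ X₁) (𝒞.encode₂ X₂) W))).1 := by
  obtain ⟨c, d, hcd⟩ := decoder.exists_time_le
  refine ⟨decoder, c, d, ?_⟩
  intro F K L _ _ _ _ _ _ R₁ R₂ z k 𝒞 V E _ _ _ 𝒢 incoming hc₁ hc₂ hc₁₂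
  -- A basis of a field is nonempty, so both degrees are positive. This gives k ≤ ℓ, whence every
  -- initial index variable is at most C + ℓ.
  have hn : 0 < R₁ + 2 * z := by
    rw [← Fintype.card_fin (R₁ + 2 * z), Fintype.card_pos_iff]
    exact 𝒞.a.index_nonempty
  have hN : 0 < R₂ + 2 * z := by
    rw [← Fintype.card_fin (R₂ + 2 * z), Fintype.card_pos_iff]
    exact 𝒞.b.index_nonempty
  constructor
  · intro T₁ T₂ Y
    refine hcd F _ _ _ (by omega) fun v => ?_
    have hk : k ≤ k * (R₁ + 2 * z) * (R₂ + 2 * z) := by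
      rw [Nat.mul_assoc]
      exact Nat.le_mul_of_pos_right k (Nat.mul_pos hn hN)
    match v with
    | 0 | 1 | 2 | 3 => simp only [CodePair.params]; omega
    | _ + 4 => exact Nat.zero_le _
  · let : Algebra F L := ((algebraMap K L).comp (algebraMap F K)).toAlgebra
    have : IsScalarTower F K L := IsScalarTower.of_algebraMap_eq fun _ => rfl
    obtain ⟨P₁, hP₁⟩ := Matrix.exists_left_inverse_of_linearIndependent 𝒞.gabidulin₁.2.1
    obtain ⟨P₂, hP₂⟩ := Matrix.exists_left_inverse_of_linearIndependent 𝒞.gabidulin₂.2.1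
    -- First event: [T₁G₁ | T₂] is injective over K, with R₁ and R₂ + 2z symbols. Second event: [T₁
    -- | T₂G₂] is injective over L, with R₁ + 2z and R₂ symbols. Only injectivity of T₁ is used from
    -- the latter, but adding T₂G₂ brings the number of symbols to C, as the square flow matrix
    -- requires.
    refine one_sub_le_uniformProb Fintype.card_pos
      (𝒢.card_not_injective_le incoming (algebraMap F K) (by omega) hc₂ hc₁₂.le (by omega)
        hP₁ (Matrix.one_mul (1 : Matrix (Fin (R₂ + 2 * z)) (Fin (R₂ + 2 * z)) K)))
      (𝒢.card_not_injective_le incoming (algebraMap F L) hc₁ (by omega) hc₁₂.le (by omega)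
        (Matrix.one_mul (1 : Matrix (Fin (R₁ + 2 * z)) (Fin (R₁ + 2 * z)) L)) hP₂) ?_
    intro κ hκ₁ hκ₂ X₁ X₂ W hW
    rw [𝒢.received_eq]
    refine 𝒞.isOutput_decoder (fun w₁ w₂ h => hκ₁ w₁ w₂ ?_) (fun w hw => ?_) _ X₁ X₂ hW
    · rw [Matrix.mulVec_mulVec, Matrix.one_mulVec, h]
    · have h := (hκ₂ (algebraMap F L ∘ w) 0 (by
        rw [Matrix.one_mulVec, Matrix.mulVec_zero, Matrix.mulVec_zero, add_zero]
        funext i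
        rw [← RingHom.map_mulVec, hw, Pi.zero_apply, map_zero, Pi.zero_apply])).1
      funext i
      exact (algebraMap F L).injective (by simpa using congrFun h i)
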